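/- Let $h:\mathbb{R}\to\mathbb{R}$ be convex and continuous with $h(u)\ge\alpha_1|u|^2+\alpha_2$ for all $u\in\mathbb{R}$, for some $\alpha_1>0$, $\alpha_2\ge0$; let $f\in C_b^2(\mathbb{R})$ with $f''\in L^1(\mathbb{R})$; and let $\sigma\in C_b^1(\mathbb{R})$ with $|\sigma(x)|\ge\rho>0$ for all $x\in\mathbb{R}$. (Here $C^k_b(\mathbb{R})$ is the space of $C^k$ functions whose derivatives of orders $0,\dots,k$ are bounded.) Let $H(u)=h(u)$ for $u\ge0$, $H(u)=+\infty$ for $u<0$, and let $H^*(p)=\sup_{u\in\mathbb{R}}\{pu-H(u)\}$ be its Legendre conjugate. Define the operator $A$ in $L^1(\mathbb{R})$ by $$Ay=-\Bigl(H^*\bigl(\tfrac{\sigma^2}{2}y\bigr)\Bigr)''-f\,y'\ \text{ in }\mathcal{D}'(\mathbb{R}),\qquad D(A)=\Bigl\{y\in L^1(\mathbb{R}):\ H^*\bigl(\tfrac{\sigma^2}{2}y\bigr)\in L^\infty(\mathbb{R}),\ Ay\in L^1(\mathbb{R})\Bigr\},$$ where the derivatives are taken in the sense of distributions, and let $\lambda_0=\|f'\|_\infty$.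 Then for every $\lambda>\lambda_0$ and every $\eta\in L^1(\mathbb{R})$ the equation $$\lambda y+Ay=\eta$$ has a unique solution $y=y(\eta)\in D(A)$, and $$\|y(\eta)-y(\bar\eta)\|_1\le(\lambda-\lambda_0)^{-1}\|\eta-\bar\eta\|_1\qquad\forall\,\eta,\bar\eta\in L^1(\mathbb{R}),\ \lambda>\lambda_0.$$ Moreover $A$ is quasi-$m$-accretive in $L^1(\mathbb{R})$, that is, there is $\omega\in\mathbb{R}$ such that $\omega I+A$ is $m$-accretive. Here an operator $B$ in a Banach space $X$ is accretive if for all $u_1,u_2\in D(B)$ and $v_i\in Bu_i$ there is $\xi\in X'$ with $\xi(u_1-u_2)=\|u_1-u_2\|^2=\|\xi\|^2$ and $\xi(v_1-v_2)\ge0$, and it is $m$-accretive if moreover the range of $\lambda I+B$ is $X$ for all $\lambda>0$. -/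

import Mathlib

open MeasureTheory Set
open scoped Distributions ENNReal

noncomputable section

namespace DynProg

/-! ### Accretive operators in a real Banach space

A (possibly multivalued, not everywhere defined) operator on `X` is a map `A : X → Set X`;
its domain is the set of `u` with `A u` nonempty. -/

section Accretive

variable {X : Type*} [NormedAddCommGroup X] [NormedSpace ℝ X]

/-- The duality mapping `J : X → X'`. -/
def dualityMap (x : X) : Set (StrongDual ℝ X) :=
  {ξ | ξ x = ‖x‖ ^ 2 ∧ ‖ξ‖ = ‖x‖}

/-- The operator `c I + A`. -/
def shift (c : ℝ) (A : X → Set X) : X → Set X :=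
  fun u => {w | ∃ v ∈ A u, w = c • u + v}

/-- Accretivity: the pairing of `v₁ - v₂` with some element of `J (u₁ - u₂)` is nonnegative. -/
def IsAccretive (A : X → Set X) : Prop :=
  ∀ u₁ u₂ : X, ∀ v₁ ∈ A u₁, ∀ v₂ ∈ A u₂, ∃ ξ ∈ dualityMap (u₁ - u₂), 0 ≤ ξ (v₁ - v₂)

/-- `A` is m-accretive: accretive, and `l I + A` has range `X` for every `l > 0`. -/
def IsMAccretive (A : X → Set X) : Prop :=
  IsAccretive A ∧ ∀ l : ℝ, 0 < l → ∀ w : X, ∃ u : X, w ∈ shift l A u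

/-- `A` is quasi-m-accretive: some translate `l I + A` is m-accretive. -/
def IsQuasiMAccretive (A : X → Set X) : Prop :=
  ∃ l : ℝ, IsMAccretive (shift l A)

end Accretive

/-! ### The data -/

/-- `C_b^k(ℝ)`: functions of class `C^k` whose derivatives of order `0, …, k` are bounded. -/
structure IsCb (k : ℕ) (f : ℝ → ℝ) : Prop where
  contDiff : ContDiff ℝ k f
  bounded : ∀ i ≤ k, ∃ C : ℝ, ∀ x, |iteratedDeriv i f x| ≤ C

/-- The hypothesis on the running cost `h`. -/
structure CostHyp (h : ℝ → ℝ) : Prop where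
  convex : ConvexOn ℝ univ h
  continuous : Continuous h
  coercive : ∃ α₁ α₂ : ℝ, 0 < α₁ ∧ 0 ≤ α₂ ∧ ∀ u, α₁ * |u| ^ 2 + α₂ ≤ h u

open Classical in
/-- `H = h + I_{[0,∞)}`, an extended-real-valued function. -/
def extendedCost (h : ℝ → ℝ) (u : ℝ) : EReal :=
  if 0 ≤ u then ((h u : ℝ) : EReal) else ⊤

/-- The Legendre conjugate of `H`, as an extended real number. -/
def conjE (H : ℝ → EReal) (p : ℝ) : EReal :=
  ⨆ u : ℝ, ((p * u : ℝ) : EReal) - H u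

/-- `H^*`, as a real-valued function (see `coe_Hstar`). -/
def Hstar (h : ℝ → ℝ) (p : ℝ) : ℝ :=
  (conjE (extendedCost h) p).toReal

/-- Under the hypothesis on `h`, the conjugate of `H` is finite everywhere, so that `Hstar` is the
conjugate itself. -/
theorem coe_Hstar {h : ℝ → ℝ} (hh : CostHyp h) (p : ℝ) :
    ((Hstar h p : ℝ) : EReal) = conjE (extendedCost h) p := by
  obtain ⟨a, b, ha, -, hab⟩ := hh.coercive
  refine EReal.coe_toReal (ne_of_lt ?_) (ne_of_gt ?_)
  · refine lt_of_le_of_lt (b := ((p ^ 2 / (4 * a) - b : ℝ) : EReal)) (iSup_le fun u => ?_)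
      (EReal.coe_lt_top _)
    unfold extendedCost
    split_ifs with hu
    · rw [← EReal.coe_sub, EReal.coe_le_coe_iff]
      have h1 := hab u
      rw [sq_abs] at h1
      have h2 : p * u - a * u ^ 2 ≤ p ^ 2 / (4 * a) := by
        rw [le_div_iff₀ (by positivity)]
        nlinarith [sq_nonneg (p - 2 * a * u)]
      linarith
    · simp
  · refine lt_of_lt_of_le (EReal.bot_lt_coe (p * 0 - h 0))
      (le_trans (le_of_eq ?_) (le_iSup _ (0 : ℝ)))
    simp [extendedCost]

/-! ### The operator -/

/-- The space `L^1(ℝ)`. -/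
abbrev L1 : Type := Lp ℝ 1 (volume : Measure ℝ)

/-- The distribution `u''`, for a locally integrable function `u`. -/
def distDeriv2 (u : ℝ → ℝ) (φ : 𝓓((⊤ : TopologicalSpace.Opens ℝ), ℝ)) : ℝ :=
  ∫ x, u x * deriv (deriv φ) x

/-- The distribution `f y'`, for `f` of class `C^1` and a locally integrable function `y`:
`⟨f y', φ⟩ = ⟨y', f φ⟩ = -∫ y (f φ)'`. -/
def distMulDeriv (f y : ℝ → ℝ) (φ : 𝓓((⊤ : TopologicalSpace.Opens ℝ), ℝ)) : ℝ :=
  -∫ x, y x * deriv (fun t => f t * φ t) x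

/-- `A y = -(H^*(σ² y / 2))'' - f y'` in the sense of distributions, with domain the set of
`y ∈ L^1` such that `H^*(σ² y / 2) ∈ L^∞` and `A y ∈ L^1`. -/
def opA (h f σ : ℝ → ℝ) (y : L1) : Set L1 :=
  {v | MemLp (fun x => Hstar h (σ x ^ 2 * y x / 2)) ∞ volume ∧
    ∀ φ : 𝓓((⊤ : TopologicalSpace.Opens ℝ), ℝ),
      ∫ x, v x * φ x =
        -distDeriv2 (fun x => Hstar h (σ x ^ 2 * y x / 2)) φ - distMulDeriv f y φ}

/-- `opA` is single-valued. -/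
theorem opA_subsingleton (h f σ : ℝ → ℝ) (y : L1) : (opA h f σ y).Subsingleton := by
  rintro v ⟨-, hv⟩ w ⟨-, hw⟩
  have iv := (L1.integrable_coeFn v).locallyIntegrable
  have iw := (L1.integrable_coeFn w).locallyIntegrable
  refine Lp.ext (ae_eq_of_integral_contDiff_smul_eq iv iw fun g hg hc => ?_)
  have key := (hv ⟨g, hg, hc, by simp⟩).trans (hw ⟨g, hg, hc, by simp⟩).symm
  simpa [mul_comm] using key

/-- `y` solves `l y + A y = η`; in particular `y` belongs to the domain of `A`. -/
def IsSol (h f σ : ℝ → ℝ) (l : ℝ) (η y : L1) : Prop :=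
  ∃ v ∈ opA h f σ y, l • y + v = η

end DynProg

end

/-! Write j for `Hstar h`. The only facts used about the cost are that j is finite, nondecreasing
and continuous. The relation v = A y is a first order system: with z = j(σ² y / 2) and flux F = z' +
f y, it reads F' = f' y - v, z' = F - f y. Since z is bounded and f y is integrable, F tends to 0 at
both infinities (`exists_primitives`).

Accretivity. For two elements of the graph the differences w, V, F, z of the y, v, F, z solve the
same linear system, and z has weakly the sign of w because j is monotone. Let Λ bound |f'|. One
looks for a sign s of w with ∫ s (V + Λ w) ≥ 0; as V = f' w - F' and s w = |w|, it is enough that ∫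
s F' ≤ 0. Since j may be constant on an interval, z = 0 leaves w undetermined; but almost everywhere
on {z = 0} also z' = 0, so F = f w, and where F > 0 the sign of w is then that of f. So on {F > 0}
let s be 1 on `posSet f z` and -1 off it. The equation z' = F - f w shows that, inside a component
of {F > 0}, s can only jump from -1 to 1 when x increases (`rightPersistent_posSet`). As F vanishes
at both ends of the component, the integral of s F' over it is -2 F(c) ≤ 0 for a jump at c, and 0
without a jump. The set {F < 0} follows by changing signs, and F' = 0 almost everywhere on {F = 0}.
This is `exists_sign`; it gives the accretivity of Λ I + A, the resolvent estimate and uniqueness.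

Existence. For large λ and continuous compactly supported η, the problem is solved on [-R, R] with z
= 0 at the ends and with j regularized to j + ε id: a shooting argument (`exists_isBVP`), a maximum
principle (`IsBVP.le_of_coeff`) and an L¹ estimate (`IsBVP.integral_abs_le`). As R → ∞ and ε → 0, y
converges weakly in L² along a subsequence while F and z converge pointwise, and Minty's
monotonicity argument identifies the limit of z (`ae_eq_of_isApprox`). General η follow because A is
closed (`opA_closed`), and the remaining λ > Λ by a contraction (`exists_isSol_of_le`). -/

namespace DynProg

open Filter Topology

/-! ### Primitives of integrable functions -/

/-- If `z` has derivative `d` almost everywhere, then `d` vanishes almost everywhere on the zero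
set of `z`. -/
theorem ae_deriv_eq_zero_of_eq_zero {z d : ℝ → ℝ} (h : ∀ᵐ x, HasDerivAt z (d x) x) :
    ∀ᵐ x, z x = 0 → d x = 0 := by
  -- Zeros isolated from the right are countable, hence null. At any other zero the difference
  -- quotients along nearby zeros to the right all vanish, and they converge to the derivative.
  have hc : ({x ∈ {x | z x = 0} | 𝓝[{x | z x = 0} ∩ Ioi x] x = ⊥}).Countable :=
    countable_setOfPred_isolated_right_within
  have h0 := hc.ae_notMem (volume : Measure ℝ)
  filter_upwards [h, h0] with x hx hx0 hz
  have hne : (𝓝[{x | z x = 0} ∩ Ioi x] x).NeBot := by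
    rw [neBot_iff]
    intro hb
    exact hx0 ⟨hz, hb⟩
  have h1 := (hasDerivAt_iff_tendsto_slope.1 hx).mono_left
    (nhdsWithin_mono x (t := {x}ᶜ) (s := {x | z x = 0} ∩ Ioi x) (fun y hy => ne_of_gt hy.2))
  refine tendsto_nhds_unique h1 (tendsto_const_nhds.congr' ?_)
  filter_upwards [self_mem_nhdsWithin] with y hy
  have : z y = 0 := hy.1
  simp [slope, this, hz]

theorem locallyIntegrable_intervalIntegrable {G : ℝ → ℝ} (h : LocallyIntegrable G volume)
    (a b : ℝ) : IntervalIntegrable G volume a b :=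
  intervalIntegrable_iff.mpr <|
    (h.integrableOn_isCompact isCompact_uIcc).mono_set uIoc_subset_uIcc

/-- `F` is a primitive of the locally integrable function `G`. -/
structure IsPrimitive (F G : ℝ → ℝ) : Prop where
  locInt : LocallyIntegrable G volume
  sub_eq : ∀ a b, F b - F a = ∫ x in a..b, G x

namespace IsPrimitive

variable {F G F' G' : ℝ → ℝ}

theorem intervalIntegrable (h : IsPrimitive F G) (a b : ℝ) : IntervalIntegrable G volume a b :=
  locallyIntegrable_intervalIntegrable h.locInt a b

theorem eq (h : IsPrimitive F G) (a x : ℝ) : F x = F a + ∫ t in a..x, G t := by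
  rw [← h.sub_eq]; ring

theorem continuous (h : IsPrimitive F G) : Continuous F := by
  have : F = fun x => F 0 + ∫ t in (0:ℝ)..x, G t := funext fun x => h.eq 0 x
  rw [this]
  exact continuous_const.add (intervalIntegral.continuous_primitive h.intervalIntegrable 0)

theorem ae_hasDerivAt (h : IsPrimitive F G) : ∀ᵐ x, HasDerivAt F (G x) x := by
  have : F = fun x => F 0 + ∫ t in (0:ℝ)..x, G t := funext fun x => h.eq 0 x
  filter_upwards [LocallyIntegrable.ae_hasDerivAt_integral h.locInt] with x hx
  rw [this]
  exact (hx 0).const_add _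

theorem neg (h : IsPrimitive F G) : IsPrimitive (fun x => -F x) (fun x => -G x) :=
  ⟨h.locInt.neg, fun a b => by rw [intervalIntegral.integral_neg, ← h.sub_eq]; ring⟩

theorem sub (h : IsPrimitive F G) (h' : IsPrimitive F' G') :
    IsPrimitive (fun x => F x - F' x) (fun x => G x - G' x) :=
  ⟨h.locInt.sub h'.locInt, fun a b => by
    rw [intervalIntegral.integral_sub (h.intervalIntegrable a b) (h'.intervalIntegrable a b),
      ← h.sub_eq, ← h'.sub_eq]; ring⟩

theorem comp_neg (h : IsPrimitive F G) : IsPrimitive (fun x => F (-x)) (fun x => -G (-x)) := by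
  refine ⟨?_, fun a b => ?_⟩
  · have : LocallyIntegrable (fun x => G (-x)) volume := by
      rw [locallyIntegrable_iff]
      intro k hk
      have h1 : IntegrableOn G (-k) := (locallyIntegrable_iff.1 h.locInt) _ hk.neg
      have h2 := (Measure.measurePreserving_neg (volume : Measure ℝ)).integrableOn_comp_preimage
        (Homeomorph.neg ℝ).measurableEmbedding (f := G) (s := -k)
      have h3 := h2.2 h1
      simpa [Function.comp_def] using h3
    exact this.neg
  · rw [intervalIntegral.integral_neg, intervalIntegral.integral_comp_neg, ← h.sub_eq]; ring

theorem add_const (h : IsPrimitive F G) (c : ℝ) : IsPrimitive (fun x => F x + c) G :=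
  ⟨h.locInt, fun a b => by rw [← h.sub_eq]; ring⟩

end IsPrimitive

theorem isPrimitive_integral {G : ℝ → ℝ} (hG : LocallyIntegrable G volume) (a : ℝ) :
    IsPrimitive (fun x => ∫ t in a..x, G t) G :=
  ⟨hG, fun _ _ => intervalIntegral.integral_interval_sub_left
    (locallyIntegrable_intervalIntegrable hG _ _) (locallyIntegrable_intervalIntegrable hG _ _)⟩

/-- A set is right persistent for `F` if it can be left, going to the right, only through a point
at which `F ≤ 0`. -/
def RightPersistent (F : ℝ → ℝ) (Q : Set ℝ) : Prop :=
  ∀ a b, a ≤ b → (∀ x ∈ Icc a b, 0 < F x) → a ∈ Q → b ∈ Q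

/-! ### Increments of a function over the components of its positivity set. -/

section components

variable {F G : ℝ → ℝ} {Q : Set ℝ}

/-- Persistence makes `J ∩ Q` a final segment of `J`, so the integral telescopes from `x` to the
right end of `J`. There `F` is 0, either as a boundary point of `J` or as the limit at infinity. -/
theorem integral_Ioi_inter_component (hF : IsPrimitive F G) (hG : Integrable G volume)
    (htop : Tendsto F atTop (𝓝 0)) (hQ : RightPersistent F Q) {J : Set ℝ} (hJo : IsOpen J)
    (hJc : J.OrdConnected) (hJF : ∀ x ∈ J, 0 < F x)
    (hJb : ∀ b, b ∉ J → b ∈ closure J → F b = 0) {x : ℝ} (hx : x ∈ J ∩ Q) :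
    ∫ t in (J ∩ Q) ∩ Ioi x, G t = - F x := by
  have hsub : ∀ y ∈ J, x ≤ y → y ∈ Q := fun y hy hxy =>
    hQ x y hxy (fun t ht => hJF t (hJc.out hx.1 hy ht)) hx.2
  by_cases hb : BddAbove J
  · set b := sSup J with hbdef
    have hbJ : b ∉ J := by
      intro hbJ
      obtain ⟨u, hu, hu2⟩ := exists_Ico_subset_of_mem_nhds (hJo.mem_nhds hbJ) ⟨b + 1, by linarith⟩
      have : (b + u) / 2 ∈ J := hu2 ⟨by linarith, by linarith⟩
      have := le_csSup hb this
      linarith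
    have hlt : ∀ y ∈ J, y < b := fun y hy =>
      lt_of_le_of_ne (le_csSup hb hy) (fun h => hbJ (h ▸ hy))
    have hset : (J ∩ Q) ∩ Ioi x = Ioo x b := by
      ext y
      constructor
      · rintro ⟨⟨h1, -⟩, h2⟩; exact ⟨h2, hlt y h1⟩
      · rintro ⟨h1, h2⟩
        obtain ⟨c, hc, hyc⟩ := exists_lt_of_lt_csSup ⟨x, hx.1⟩ h2
        have : y ∈ J := hJc.out hx.1 hc ⟨h1.le, hyc.le⟩
        exact ⟨⟨this, hsub y this h1.le⟩, h1⟩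
    have hFb : F b = 0 := hJb b hbJ (csSup_mem_closure ⟨x, hx.1⟩ hb)
    rw [hset, ← integral_Ioc_eq_integral_Ioo, ← intervalIntegral.integral_of_le (hlt x hx.1).le,
      ← hF.sub_eq, hFb, zero_sub]
  · have hset : (J ∩ Q) ∩ Ioi x = Ioi x := by
      refine inter_eq_right.2 fun y hy => ?_
      rw [not_bddAbove_iff] at hb
      obtain ⟨c, hc, hyc⟩ := hb y
      have : y ∈ J := hJc.out hx.1 hc ⟨le_of_lt hy, hyc.le⟩
      exact ⟨this, hsub y this (le_of_lt hy)⟩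
    rw [hset]
    have h1 := intervalIntegral_tendsto_integral_Ioi x hG.integrableOn tendsto_id
    have h2 : Tendsto (fun b => ∫ t in x..b, G t) atTop (𝓝 (0 - F x)) := by
      simp_rw [← hF.sub_eq]
      exact htop.sub_const _
    rw [tendsto_nhds_unique h1 h2, zero_sub]

/-- The final segment `J ∩ Q` is exhausted by its parts to the right of points decreasing to its
left end; each part contributes `-F x ≤ 0`. The left end may be finite or -∞, which are the two
cases of the proof. -/
theorem setIntegral_component_nonpos (hF : IsPrimitive F G) (hG : Integrable G volume)
    (htop : Tendsto F atTop (𝓝 0)) (hQ : RightPersistent F Q)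
    (hQm : MeasurableSet Q) {J : Set ℝ} (hJo : IsOpen J)
    (hJc : J.OrdConnected) (hJF : ∀ x ∈ J, 0 < F x)
    (hJb : ∀ b, b ∉ J → b ∈ closure J → F b = 0) :
    ∫ t in J ∩ Q, G t ≤ 0 := by
  rcases (J ∩ Q).eq_empty_or_nonempty with he | ⟨x₀, hx₀⟩
  · simp [he]
  have hKm : MeasurableSet (J ∩ Q) := hJo.measurableSet.inter hQm
  have key : ∀ x ∈ J ∩ Q, ∫ t in (J ∩ Q) ∩ Ioi x, G t ≤ 0 := fun x hx => by
    rw [integral_Ioi_inter_component hF hG htop hQ hJo hJc hJF hJb hx]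
    linarith [hJF x hx.1]
  have hup : ∀ x ∈ J ∩ Q, ∀ y, x ≤ y → y ≤ x₀ → y ∈ J ∩ Q := fun x hx y hxy hy => by
    have hyJ : y ∈ J := hJc.out hx.1 hx₀.1 ⟨hxy, hy⟩
    exact ⟨hyJ, hQ x y hxy (fun t ht => hJF t (hJc.out hx.1 hyJ ht)) hx.2⟩
  -- a sequence decreasing to the left end
  have hlim : ∀ (c : ℕ → ℝ) (a : Set ℝ), Antitone c → (⋃ n, Ioi (c n)) = a →
      (∀ᶠ n in atTop, c n ∈ J ∩ Q) → ∫ t in (J ∩ Q) ∩ a, G t ≤ 0 := by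
    intro c a hc ha hev
    have h1 : Tendsto (fun n => ∫ t in (J ∩ Q) ∩ Ioi (c n), G t) atTop
        (𝓝 (∫ t in ⋃ n, (J ∩ Q) ∩ Ioi (c n), G t)) :=
      tendsto_setIntegral_of_monotone (fun n => hKm.inter measurableSet_Ioi)
        (fun m n hmn => inter_subset_inter_right _ (Ioi_subset_Ioi (hc hmn))) hG.integrableOn
    rw [← inter_iUnion, ha] at h1
    refine le_of_tendsto h1 ?_
    filter_upwards [hev] with n hn using key _ hn
  by_cases hb : BddBelow (J ∩ Q)
  · set a := sInf (J ∩ Q)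
    have hle : ∀ y ∈ J ∩ Q, a ≤ y := fun y hy => csInf_le hb hy
    have hax : a < x₀ ∨ a = x₀ := (hle x₀ hx₀).lt_or_eq
    -- The infimum may itself lie in `J ∩ Q`. A second point strictly to its right guarantees that
    -- `a + 1/(n+1)` is eventually in the set.
    obtain ⟨x₁, hx₁J, hx₁⟩ : ∃ x₁ ∈ J ∩ Q, a < x₁ := by
      obtain ⟨u, hu, hu2⟩ := exists_Ico_subset_of_mem_nhds (hJo.mem_nhds hx₀.1) ⟨x₀ + 1, by linarith⟩
      have h3 : (x₀ + u) / 2 ∈ J := hu2 ⟨by linarith, by linarith⟩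
      refine ⟨(x₀ + u) / 2, ⟨h3, hQ x₀ _ (by linarith)
        (fun t ht => hJF t (hJc.out hx₀.1 h3 ht)) hx₀.2⟩, ?_⟩
      have := hle x₀ hx₀
      linarith
    have h := hlim (fun n => a + 1 / ((n : ℝ) + 1)) (Ioi a)
      (fun m n hmn => by
        have : 1 / ((n : ℝ) + 1) ≤ 1 / ((m : ℝ) + 1) := Nat.one_div_le_one_div hmn
        simpa using this) ?_ ?_
    · have hae : ∫ t in J ∩ Q, G t = ∫ t in (J ∩ Q) ∩ Ioi a, G t := by
        have h1 : J ∩ Q = (J ∩ Q) ∩ Ici a := (inter_eq_left.2 hle).symm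
        conv_lhs => rw [h1]
        exact setIntegral_congr_set ((ae_eq_refl _).inter Ioi_ae_eq_Ici.symm)
      rw [hae]; exact h
    · ext y
      simp only [mem_iUnion, mem_Ioi]
      constructor
      · rintro ⟨n, hn⟩
        have : 0 < 1 / ((n : ℝ) + 1) := Nat.one_div_pos_of_nat
        linarith
      · intro hy
        obtain ⟨n, hn⟩ := exists_nat_one_div_lt (sub_pos.2 hy)
        exact ⟨n, by linarith⟩
    · obtain ⟨n, hn⟩ := exists_nat_one_div_lt (sub_pos.2 hx₁)
      filter_upwards [eventually_ge_atTop n] with m hm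
      have h4 : 1 / ((m : ℝ) + 1) ≤ 1 / ((n : ℝ) + 1) := Nat.one_div_le_one_div hm
      have h5 : 0 < 1 / ((m : ℝ) + 1) := Nat.one_div_pos_of_nat
      obtain ⟨k, hk, hka⟩ := exists_lt_of_csInf_lt ⟨x₀, hx₀⟩ (show a < a + 1 / ((m : ℝ) + 1) by linarith)
      have hJ : a + 1 / ((m : ℝ) + 1) ∈ J :=
        hJc.out hk.1 hx₁J.1 ⟨hka.le, by linarith⟩
      exact ⟨hJ, hQ k _ hka.le (fun t ht => hJF t (hJc.out hk.1 hJ ht)) hk.2⟩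
  · have h := hlim (fun n => -(n : ℝ)) univ
      (fun m n hmn => by simpa using hmn) ?_ ?_
    · simpa using h
    · refine eq_univ_of_forall fun y => mem_iUnion.2 ?_
      obtain ⟨n, hn⟩ := exists_nat_gt (-y)
      exact ⟨n, by simp only [mem_Ioi]; linarith⟩
    · rw [not_bddBelow_iff] at hb
      obtain ⟨n, hn⟩ := exists_nat_gt (-x₀)
      filter_upwards [eventually_ge_atTop n] with m hm
      obtain ⟨k, hk, hkm⟩ := hb (-(m : ℝ))
      have : (n : ℝ) ≤ m := by exact_mod_cast hm
      exact hup k hk _ hkm.le (by linarith)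

/-- The increments of `F` over the part of a right persistent set where `F > 0` sum up to a
nonpositive number. -/
theorem setIntegral_pos_inter_nonpos (hF : IsPrimitive F G) (hG : Integrable G volume)
    (htop : Tendsto F atTop (𝓝 0)) (hQ : RightPersistent F Q)
    (hQm : MeasurableSet Q) :
    ∫ t in {x | 0 < F x} ∩ Q, G t ≤ 0 := by
  set U := {x | 0 < F x} with hU
  have hUo : IsOpen U := isOpen_lt continuous_const hF.continuous
  set S : Set (Set ℝ) := (fun x => connectedComponentIn U x) '' U with hS
  have hdisj : S.PairwiseDisjoint id := by
    rintro _ ⟨x, hx, rfl⟩ _ ⟨y, hy, rfl⟩ hxy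
    by_contra hnd
    rw [Function.onFun, id, id, not_disjoint_iff] at hnd
    obtain ⟨t, ht1, ht2⟩ := hnd
    exact hxy ((connectedComponentIn_eq ht1).trans (connectedComponentIn_eq ht2).symm)
  have hcount : S.Countable := by
    refine hdisj.countable_of_isOpen ?_ ?_
    · rintro _ ⟨x, -, rfl⟩; exact hUo.connectedComponentIn
    · rintro _ ⟨x, hx, rfl⟩; exact ⟨x, mem_connectedComponentIn hx⟩
  have hUS : U ∩ Q = ⋃ J ∈ S, J ∩ Q := by
    ext x
    simp only [mem_iUnion, mem_inter_iff, exists_prop]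
    constructor
    · rintro ⟨h1, h2⟩
      exact ⟨_, ⟨x, h1, rfl⟩, mem_connectedComponentIn h1, h2⟩
    · rintro ⟨_, ⟨y, hy, rfl⟩, h1, h2⟩
      exact ⟨connectedComponentIn_subset _ _ h1, h2⟩
  have : Countable S := hcount.to_subtype
  rw [hUS, biUnion_eq_iUnion]
  have hs := hasSum_integral_iUnion (μ := volume) (f := G) (s := fun J : S => (J : Set ℝ) ∩ Q)
    (fun J => by
      obtain ⟨_, ⟨x, hx, rfl⟩⟩ := J
      exact hUo.connectedComponentIn.measurableSet.inter hQm)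
    (fun J K hJK => (hdisj J.2 K.2 (fun h => hJK (Subtype.ext h))).mono inter_subset_left
      inter_subset_left) hG.integrableOn
  rw [← hs.tsum_eq]
  refine tsum_nonpos ?_
  rintro ⟨_, ⟨x, hx, rfl⟩⟩
  have hpre : IsPreconnected (connectedComponentIn U x) := isPreconnected_connectedComponentIn
  refine setIntegral_component_nonpos hF hG htop hQ hQm hUo.connectedComponentIn
    hpre.ordConnected (fun y hy => connectedComponentIn_subset U x hy) ?_
  -- At a boundary point `F ≥ 0` by continuity. If `F b > 0`, the component of `b` would be open and
  -- meet the given one, so `b` would already belong to it.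
  intro b hb hbc
  have h0 : 0 ≤ F b := by
    have : closure (connectedComponentIn U x) ⊆ {y | 0 ≤ F y} :=
      closure_minimal (fun y hy => by
        have h : 0 < F y := connectedComponentIn_subset U x hy
        exact h.le)
        (isClosed_le continuous_const hF.continuous)
    exact this hbc
  by_contra hne
  have hbU : b ∈ U := lt_of_le_of_ne h0 (Ne.symm hne)
  obtain ⟨y, hy1, hy2⟩ := mem_closure_iff.1 hbc _ hUo.connectedComponentIn
    (mem_connectedComponentIn hbU)
  apply hb
  have : connectedComponentIn U x = connectedComponentIn U b :=
    (connectedComponentIn_eq hy2).trans (connectedComponentIn_eq hy1).symm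
  simp only [this]
  exact mem_connectedComponentIn hbU

/-- The same with the sign `+1` on the persistent set and `-1` off it. -/
theorem setIntegral_pos_sign_nonpos (hF : IsPrimitive F G) (hG : Integrable G volume)
    (htop : Tendsto F atTop (𝓝 0)) (hbot : Tendsto F atBot (𝓝 0)) (hQ : RightPersistent F Q)
    (hQm : MeasurableSet Q) :
    ∫ t in {x | 0 < F x}, (Q.indicator (fun _ => (2 : ℝ)) t - 1) * G t ≤ 0 := by
  have h1 := setIntegral_pos_inter_nonpos hF hG htop hQ hQm
  have hU : MeasurableSet {x | 0 < F x} :=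
    (isOpen_lt continuous_const hF.continuous).measurableSet
  -- The reflection x ↦ -x turns the complement of a right persistent set into a right persistent
  -- set for the reflected `F`, and reverses the sign of the derivative.
  have h2 : 0 ≤ ∫ t in {x | 0 < F x} ∩ Qᶜ, G t := by
    have h3 := setIntegral_pos_inter_nonpos (Q := {x | -x ∈ Qᶜ}) hF.comp_neg
      (hG.comp_neg.neg) (hbot.comp tendsto_neg_atTop_atBot) ?_ (measurable_neg hQm.compl)
    · have h4 := (Measure.measurePreserving_neg (volume : Measure ℝ)).setIntegral_preimage_emb
        (Homeomorph.neg ℝ).measurableEmbedding G ({x | 0 < F x} ∩ Qᶜ)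
      rw [integral_neg] at h3
      have h5 : {x | 0 < F (-x)} ∩ {x | -x ∈ Qᶜ} = Neg.neg ⁻¹' ({x | 0 < F x} ∩ Qᶜ) := rfl
      rw [h5, h4] at h3
      linarith
    · intro a b hab hpos ha hb
      exact ha (hQ (-b) (-a) (by linarith) (fun x hx => by
        have := hpos (-x) ⟨by linarith [hx.2], by linarith [hx.1]⟩
        simpa using this) hb)
  have h3 : ∫ t in {x | 0 < F x}, (Q.indicator (fun _ => (2 : ℝ)) t - 1) * G t =
      ∫ t in {x | 0 < F x}, (Q.indicator G t - Qᶜ.indicator G t) := by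
    refine integral_congr_ae (ae_of_all _ fun t => ?_)
    by_cases ht : t ∈ Q
    · simp [ht]; ring
    · simp [ht]
  rw [h3, integral_sub (hG.integrableOn.indicator hQm) (hG.integrableOn.indicator hQm.compl),
    setIntegral_indicator hQm, setIntegral_indicator hQm.compl]
  linarith

end components

/-! ### The sign of a solution of the linearized equation -/

section sign

variable {f w F z : ℝ → ℝ}

/-- `w` has the sign of `z`, weakly. -/
def SameSign (z w : ℝ → ℝ) : Prop :=
  ∀ᵐ x, (0 < z x → 0 ≤ w x) ∧ (z x < 0 → w x ≤ 0)

theorem SameSign.neg (h : SameSign z w) : SameSign (fun x => -z x) (fun x => -w x) := by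
  filter_upwards [h] with x hx
  exact ⟨fun h => by have := hx.2 (by linarith); linarith,
    fun h => by have := hx.1 (by linarith); linarith⟩

/-- The set on which the sign is taken to be `+1`, where `F > 0`. -/
def posSet (f z : ℝ → ℝ) : Set ℝ := {x | 0 < z x ∨ (z x = 0 ∧ 0 < f x)}

theorem measurableSet_posSet (hf : Continuous f) (hz : Continuous z) :
    MeasurableSet (posSet f z) :=
  (isOpen_lt continuous_const hz).measurableSet.union
    ((isClosed_eq hz continuous_const).measurableSet.inter
      (isOpen_lt continuous_const hf).measurableSet)

theorem IsPrimitive.lt_of_ae_pos {G : ℝ → ℝ} (hz : IsPrimitive z G) {c d : ℝ} (hcd : c < d)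
    (h : ∀ᵐ x, x ∈ Ioo c d → 0 < G x) : z c < z d := by
  have h1 : 0 < ∫ x in c..d, G x := by
    -- `G` is replaced on a null set, the endpoint `d` included, by values that make it positive
    -- everywhere.
    have hae : ∀ᵐ x, x ∈ uIoc c d → G x = if 0 < G x then G x else 1 := by
      filter_upwards [h, compl_mem_ae_iff.2 (measure_singleton d)] with x hx hxd hxm
      rw [uIoc_of_le hcd.le] at hxm
      rw [if_pos (hx ⟨hxm.1, lt_of_le_of_ne hxm.2 hxd⟩)]
    rw [intervalIntegral.integral_congr_ae hae]
    refine intervalIntegral.intervalIntegral_pos_of_pos ?_ (fun x => ?_) hcd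
    · exact (hz.intervalIntegrable c d).congr_ae
        ((ae_restrict_iff' measurableSet_uIoc).2 hae)
    · split_ifs with h0
      exacts [h0, one_pos]
  linarith [hz.sub_eq c d]

/-- Here `w ≤ 0` and `f ≥ 0`, so z' = F - f w ≥ F > 0. The next lemma is the mirror case, with both
signs reversed. -/
theorem lt_of_neg_on (hz : IsPrimitive z (fun x => F x - f x * w x)) (hzw : SameSign z w)
    {c d : ℝ} (hcd : c < d) (hF : ∀ x ∈ Ioo c d, 0 < F x)
    (h : ∀ x ∈ Ioo c d, z x < 0 ∧ 0 ≤ f x) : z c < z d := by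
  refine hz.lt_of_ae_pos hcd ?_
  filter_upwards [hzw] with x hx hxm
  nlinarith [hF x hxm, mul_nonneg (h x hxm).2 (neg_nonneg.2 (hx.2 (h x hxm).1))]

theorem lt_of_pos_on (hz : IsPrimitive z (fun x => F x - f x * w x)) (hzw : SameSign z w)
    {c d : ℝ} (hcd : c < d) (hF : ∀ x ∈ Ioo c d, 0 < F x)
    (h : ∀ x ∈ Ioo c d, 0 < z x ∧ f x ≤ 0) : z c < z d := by
  refine hz.lt_of_ae_pos hcd ?_
  filter_upwards [hzw] with x hx hxm
  nlinarith [hF x hxm, mul_nonneg (neg_nonneg.2 (h x hxm).2) (hx.1 (h x hxm).1)]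

theorem abs_sub_le_of_deriv (hf : ContDiff ℝ 1 f) {Λ : ℝ} (hΛ : ∀ x, |deriv f x| ≤ Λ) (x y : ℝ) :
    |f x - f y| ≤ Λ * |x - y| := by
  have := Convex.norm_image_sub_le_of_norm_deriv_le (f := f) (s := univ) (C := Λ) (x := y) (y := x)
    (fun t _ => hf.differentiable (by norm_num) t) (fun t _ => hΛ t) convex_univ trivial trivial
  simpa using this

/-- To the left of a common zero of `f` and `z` at which `F > 0`, the function `z` is negative. -/
theorem exists_neg_left (hf : ContDiff ℝ 1 f) {Λ : ℝ} (hΛ : ∀ x, |deriv f x| ≤ Λ)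
    (hw : Integrable w volume) (hFc : Continuous F)
    (hz : IsPrimitive z (fun x => F x - f x * w x)) {x : ℝ} (hfx : f x = 0) (hzx : z x = 0)
    (hFx : 0 < F x) : ∀ᶠ y in 𝓝[<] x, z y < 0 := by
  have hΛ0 : 0 ≤ Λ := (abs_nonneg _).trans (hΛ 0)
  have h1 : ∀ᶠ y in 𝓝 x, F x / 2 < F y := hFc.continuousAt.eventually (lt_mem_nhds (by linarith))
  obtain ⟨δ, hδ, h1⟩ := Metric.eventually_nhds_iff.1 h1
  have hwa : Integrable (fun t => |w t|) volume := hw.abs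
  have hcont : Continuous fun y => Λ * ∫ t in y..x, |w t| := by
    have := (intervalIntegral.continuous_primitive (fun a b => hwa.intervalIntegrable) x).neg
    refine continuous_const.mul (this.congr fun y => ?_)
    rw [Pi.neg_apply, intervalIntegral.integral_symm y x, neg_neg]
  have h2 : ∀ᶠ y in 𝓝 x, Λ * ∫ t in y..x, |w t| < F x / 2 :=
    hcont.continuousAt.eventually (gt_mem_nhds (by simp; linarith))
  filter_upwards [h2.filter_mono nhdsWithin_le_nhds, self_mem_nhdsWithin,
    nhdsWithin_le_nhds (Metric.ball_mem_nhds x hδ)] with y hy2 hyx hyδ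
  have hyx : y < x := hyx
  -- As `f` vanishes at `x`, |f| ≤ Λ (x - y) on [y, x]. So f w contributes at most (x - y) Λ ∫ |w|,
  -- which by `hy2` is less than (x - y) F(x) / 2, although `w` is merely integrable.
  have h3 : ∫ t in y..x, (F x / 2 - (x - y) * Λ * |w t|) ≤ ∫ t in y..x, (F t - f t * w t) := by
    refine intervalIntegral.integral_mono_on hyx.le
      (intervalIntegrable_const.sub (hwa.intervalIntegrable.const_mul _))
      (hz.intervalIntegrable _ _) fun t ht => ?_
    have h4 : F x / 2 < F t := h1 (by
      rw [Metric.mem_ball, Real.dist_eq, abs_lt] at hyδ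
      rw [Real.dist_eq, abs_lt]; constructor <;> linarith [ht.1, ht.2])
    have h5 : |f t * w t| ≤ (x - y) * Λ * |w t| := by
      rw [abs_mul]
      refine mul_le_mul_of_nonneg_right ?_ (abs_nonneg _)
      have h6 := abs_sub_le_of_deriv hf hΛ t x
      rw [hfx, sub_zero] at h6
      have h7 : |t - x| ≤ x - y := by rw [abs_le]; constructor <;> linarith [ht.1, ht.2]
      nlinarith
    linarith [le_abs_self (f t * w t)]
  rw [intervalIntegral.integral_sub intervalIntegrable_const
    (hwa.intervalIntegrable.const_mul _), intervalIntegral.integral_const,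
    intervalIntegral.integral_const_mul, ← hz.sub_eq, hzx, smul_eq_mul] at h3
  nlinarith [sub_pos.2 hyx]

/-- On the set where `F > 0`, the sign `+1` persists to the right. -/
theorem rightPersistent_posSet (hf : ContDiff ℝ 1 f) {Λ : ℝ} (hΛ : ∀ x, |deriv f x| ≤ Λ)
    (hw : Integrable w volume) (hFc : Continuous F)
    (hz : IsPrimitive z (fun x => F x - f x * w x)) (hzw : SameSign z w) :
    RightPersistent F (posSet f z) := by
  intro a b hab hF ha
  have hzc := hz.continuous
  have hnn : ∀ x ∈ posSet f z, 0 ≤ z x := fun x hx => hx.elim le_of_lt fun h => h.1.ge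
  -- closedness on the left
  have hclosed : ∀ x, a < x → x ≤ b → (∀ y ∈ Ico a x, y ∈ posSet f z) → x ∈ posSet f z := by
    intro x hax hxb h
    have hz0 : 0 ≤ z x := by
      refine ge_of_tendsto (hzc.continuousAt.tendsto.mono_left (nhdsWithin_le_nhds (s := Iio x))) ?_
      filter_upwards [Ico_mem_nhdsLT hax] with y hy using hnn y (h y hy)
    rcases hz0.lt_or_eq with hz0 | hz0
    · exact Or.inl hz0
    rcases lt_trichotomy (f x) 0 with hfx | hfx | hfx
    -- Just to the left of `x` one has f < 0, so membership there means z > 0; then z increases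
    -- strictly up to `x`, which contradicts z x = 0.
    · exfalso
      have h1 : ∀ᶠ y in 𝓝[<] x, f y < 0 :=
        (hf.continuous.continuousAt.eventually (gt_mem_nhds hfx)).filter_mono nhdsWithin_le_nhds
      obtain ⟨c, hc, hcx⟩ := (mem_nhdsLT_iff_exists_Ioo_subset' hax).1
        (h1.and (Ico_mem_nhdsLT hax))
      have hcx' : c < x := hc
      have h2 : ∀ y ∈ Ioo c x, 0 < z y := fun y hy => by
        have h3 : y ∈ posSet f z := h y (hcx hy).2
        have h4 : f y < 0 := (hcx hy).1
        rcases h3 with h3 | h3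
        · exact h3
        · linarith [h3.2]
      have hm : (c + x) / 2 ∈ Ioo c x := ⟨by linarith, by linarith⟩
      have h5 := lt_of_pos_on hz hzw hm.2
        (fun y hy => hF y ⟨((hcx ⟨hm.1.trans hy.1, hy.2⟩).2).1, hy.2.le.trans hxb⟩)
        (fun y hy => ⟨h2 y ⟨hm.1.trans hy.1, hy.2⟩, le_of_lt (hcx ⟨hm.1.trans hy.1, hy.2⟩).1⟩)
      linarith [h2 _ hm]
    · exfalso
      have h1 := exists_neg_left hf hΛ hw hFc hz hfx hz0.symm (hF x ⟨hax.le, hxb⟩)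
      obtain ⟨y, hy1, hy2⟩ := (h1.and (Ico_mem_nhdsLT hax)).exists
      linarith [hnn y (h y hy2)]
    · exact Or.inr ⟨hz0.symm, hfx⟩
  -- openness on the right
  have hopen : ∀ x, a ≤ x → x < b → x ∈ posSet f z →
      ∃ d, x < d ∧ d ≤ b ∧ ∀ y ∈ Icc x d, y ∈ posSet f z := by
    intro x hax hxb hx
    rcases hx with hx | ⟨hx, hfx⟩
    · have h1 : ∀ᶠ y in 𝓝[>] x, 0 < z y :=
        (hzc.continuousAt.eventually (lt_mem_nhds hx)).filter_mono nhdsWithin_le_nhds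
      obtain ⟨d, hd, hdx⟩ := mem_nhdsGT_iff_exists_Ioc_subset.1
        (h1.and (Ioc_mem_nhdsGT hxb))
      refine ⟨d, hd, (hdx ⟨hd, le_rfl⟩).2.2, fun y hy => Or.inl ?_⟩
      rcases hy.1.lt_or_eq with h | h
      · exact (hdx ⟨h, hy.2⟩).1
      · exact h ▸ hx
    · have h1 : ∀ᶠ y in 𝓝[>] x, 0 < f y :=
        (hf.continuous.continuousAt.eventually (lt_mem_nhds hfx)).filter_mono nhdsWithin_le_nhds
      obtain ⟨d, hd, hdx⟩ := mem_nhdsGT_iff_exists_Ioc_subset.1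
        (h1.and (Ioc_mem_nhdsGT hxb))
      refine ⟨d, hd, (hdx ⟨hd, le_rfl⟩).2.2, fun y hy => ?_⟩
      have hfy : 0 < f y := by
        rcases hy.1.lt_or_eq with h | h
        · exact (hdx ⟨h, hy.2⟩).1
        · exact h ▸ hfx
      -- Otherwise let `c` be the last point before `y` with z ≥ 0. Beyond it z < 0 and f > 0, which
      -- forces z to increase.
      have hzy : 0 ≤ z y := by
        by_contra hneg
        push Not at hneg
        have hcpt : IsCompact (Icc x y ∩ {t | 0 ≤ z t}) :=
          isCompact_Icc.inter_right (isClosed_le continuous_const hzc)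
        obtain ⟨c, ⟨hc1, hc2⟩, hc3⟩ := hcpt.exists_isGreatest ⟨x, ⟨le_rfl, hy.1⟩, hx.ge⟩
        have hc2 : 0 ≤ z c := hc2
        have hcy : c < y := lt_of_le_of_ne hc1.2 (fun h => by rw [h] at hc2; linarith)
        have h5 := lt_of_neg_on hz hzw hcy
          (fun t ht => hF t ⟨hax.trans (hc1.1.trans ht.1.le),
            ht.2.le.trans (hy.2.trans (hdx ⟨hd, le_rfl⟩).2.2)⟩)
          (fun t ht => ⟨by
            by_contra hnt
            push Not at hnt
            have := hc3 ⟨⟨hc1.1.trans ht.1.le, ht.2.le⟩, hnt⟩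
            linarith [ht.1], le_of_lt (hdx ⟨hc1.1.trans_lt ht.1, ht.2.le.trans hy.2⟩).1⟩)
        linarith
      rcases hzy.lt_or_eq with h | h
      · exact Or.inl h
      · exact Or.inr ⟨h.symm, hfy⟩
  -- continuous induction
  let T := {x ∈ Icc a b | ∀ y ∈ Icc a x, y ∈ posSet f z}
  have haT : a ∈ T := ⟨⟨le_rfl, hab⟩, fun y hy => by
    have : y = a := le_antisymm hy.2 hy.1
    rwa [this]⟩
  have hTb : BddAbove T := ⟨b, fun x hx => hx.1.2⟩
  set c := sSup T with hc
  have hac : a ≤ c := le_csSup hTb haT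
  have hcb : c ≤ b := csSup_le ⟨a, haT⟩ fun x hx => hx.1.2
  have hlt : ∀ y ∈ Ico a c, y ∈ posSet f z := fun y hy => by
    obtain ⟨x, hx, hyx⟩ := exists_lt_of_lt_csSup ⟨a, haT⟩ hy.2
    exact hx.2 y ⟨hy.1, hyx.le⟩
  have hcP : c ∈ posSet f z := by
    rcases hac.lt_or_eq with h | h
    · exact hclosed c h hcb hlt
    · rwa [← h]
  rcases hcb.lt_or_eq with h | h
  · exfalso
    obtain ⟨d, hd, hdb, hdP⟩ := hopen c hac h hcP
    have : d ∈ T := ⟨⟨hac.trans hd.le, hdb⟩, fun y hy => by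
      rcases lt_or_ge y c with h' | h'
      · exact hlt y ⟨hy.1, h'⟩
      · exact hdP y ⟨h', hy.2⟩⟩
    linarith [le_csSup hTb this]
  · rwa [← h]

/-- Off {z = 0} this is the weak sign condition. On {z = 0} almost everywhere z' = 0, so f w = F > 0
and `w` has the sign of `f`, which is the tie-break built into `posSet`. -/
theorem ae_sign_on_pos 
    (hz : IsPrimitive z (fun x => F x - f x * w x)) (hzw : SameSign z w) :
    ∀ᵐ x, 0 < F x → ((posSet f z).indicator (fun _ => (2 : ℝ)) x - 1) * w x = |w x| := by
  filter_upwards [hzw, ae_deriv_eq_zero_of_eq_zero hz.ae_hasDerivAt] with x h1 h2 hF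
  by_cases hx : x ∈ posSet f z
  · rw [indicator_of_mem hx]
    have : 0 ≤ w x := by
      rcases hx with h | ⟨h, hf⟩
      · exact h1.1 h
      · have h3 := h2 h
        by_contra hn
        push Not at hn
        nlinarith
    rw [abs_of_nonneg this]; ring
  · rw [indicator_of_notMem hx]
    have : w x ≤ 0 := by
      rcases lt_trichotomy (z x) 0 with h | h | h
      · exact h1.2 h
      · have h3 := h2 h
        have hf : f x ≤ 0 := by
          by_contra hn
          push Not at hn
          exact hx (Or.inr ⟨h, hn⟩)
        by_contra hn
        push Not at hn
        nlinarith
      · exact absurd (Or.inl h) hx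
    rw [abs_of_nonpos this]; ring

/-- The key one-dimensional fact: the operator `w ↦ V = -z'' - f w'`, shifted by `Λ`, pairs
nonnegatively with a sign of `w`. -/
theorem exists_sign {V : ℝ → ℝ} (hf : ContDiff ℝ 1 f) {Λ : ℝ} (hΛ : ∀ x, |deriv f x| ≤ Λ)
    (hw : Integrable w volume) (hV : Integrable V volume)
    (hF : IsPrimitive F (fun x => deriv f x * w x - V x))
    (hz : IsPrimitive z (fun x => F x - f x * w x)) (htop : Tendsto F atTop (𝓝 0))
    (hbot : Tendsto F atBot (𝓝 0)) (hzw : SameSign z w) :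
    ∃ s : ℝ → ℝ, AEStronglyMeasurable s volume ∧ (∀ x, |s x| ≤ 1) ∧
      (∀ᵐ x, s x * w x = |w x|) ∧ 0 ≤ ∫ x, s x * (V x + Λ * w x) := by
  set G := fun x => deriv f x * w x - V x with hGdef
  have hG : Integrable G volume := by
    refine Integrable.sub ?_ hV
    exact hw.bdd_mul (c := Λ) (hf.continuous_deriv (by norm_num)).aestronglyMeasurable
      (ae_of_all _ hΛ)
  have hfc := hf.continuous
  have hzc := hz.continuous
  have hFc := hF.continuous
  have hzn : IsPrimitive (fun x => -z x) (fun x => -F x - f x * -w x) := by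
    have := hz.neg
    have h2 : (fun x => -(F x - f x * w x)) = fun x => -F x - f x * -w x := by
      funext x; ring
    rwa [h2] at this
  have h1 := setIntegral_pos_sign_nonpos hF hG htop hbot
    (rightPersistent_posSet hf hΛ hw hFc hz hzw) (measurableSet_posSet hfc hzc)
  have h2 := setIntegral_pos_sign_nonpos hF.neg hG.neg (by simpa using htop.neg)
    (by simpa using hbot.neg)
    (rightPersistent_posSet hf hΛ hw.neg hFc.neg hzn hzw.neg)
    (measurableSet_posSet hfc hzc.neg)
  have e1 := ae_sign_on_pos hz hzw
  have e2 := ae_sign_on_pos hzn hzw.neg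
  have e3 := ae_deriv_eq_zero_of_eq_zero hF.ae_hasDerivAt
  set P := posSet f z
  set N := posSet f (fun x => -z x)
  set A := {x | 0 < F x} with hA
  set B := {x | 0 < -F x} with hB
  have hAm : MeasurableSet A := (isOpen_lt continuous_const hFc).measurableSet
  have hBm : MeasurableSet B := (isOpen_lt continuous_const hFc.neg).measurableSet
  have hPm : MeasurableSet P := measurableSet_posSet hfc hzc
  have hNm : MeasurableSet N := measurableSet_posSet hfc hzc.neg
  -- Where `F = 0` any sign of `w` will do; a measurable representative of `w` supplies a measurable
  -- one.
  obtain ⟨w', hw'm, hw'⟩ := hw.aestronglyMeasurable.aemeasurable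
  let sA : ℝ → ℝ := fun x => P.indicator (fun _ => (2 : ℝ)) x - 1
  let sB : ℝ → ℝ := fun x => -(N.indicator (fun _ => (2 : ℝ)) x - 1)
  let s0 : ℝ → ℝ := fun x => {x | 0 < w' x}.indicator (fun _ => (2 : ℝ)) x - 1
  classical
  let s : ℝ → ℝ := A.piecewise sA (B.piecewise sB s0)
  have hsm : Measurable s := by
    refine Measurable.piecewise hAm ?_ (Measurable.piecewise hBm ?_ ?_)
    · exact (measurable_const.indicator hPm).sub_const 1
    · exact ((measurable_const.indicator hNm).sub_const 1).neg
    · exact (measurable_const.indicator (measurableSet_lt measurable_const hw'm)).sub_const 1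
  have hsign : ∀ (S : Set ℝ) (x : ℝ), |S.indicator (fun _ => (2 : ℝ)) x - 1| ≤ 1 := by
    intro S x
    by_cases hx : x ∈ S
    · rw [indicator_of_mem hx]; norm_num
    · rw [indicator_of_notMem hx]; norm_num
  have hs1 : ∀ x, |s x| ≤ 1 := by
    intro x
    by_cases hx : x ∈ A
    · simp only [s, piecewise_eq_of_mem _ _ _ hx]; exact hsign P x
    · simp only [s, piecewise_eq_of_notMem _ _ _ hx]
      by_cases hx : x ∈ B
      · simp only [piecewise_eq_of_mem _ _ _ hx, sB, abs_neg]; exact hsign N x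
      · simp only [piecewise_eq_of_notMem _ _ _ hx]; exact hsign _ x
  have hsw : ∀ᵐ x, s x * w x = |w x| := by
    filter_upwards [e1, e2, hw'] with x h1 h2 h3
    by_cases hx : x ∈ A
    · simp only [s, piecewise_eq_of_mem _ _ _ hx]; exact h1 hx
    · simp only [s, piecewise_eq_of_notMem _ _ _ hx]
      by_cases hx : x ∈ B
      · simp only [piecewise_eq_of_mem _ _ _ hx, sB]
        have := h2 hx
        rw [abs_neg] at this
        rw [← this]; ring
      · simp only [piecewise_eq_of_notMem _ _ _ hx, s0]
        by_cases hw0 : x ∈ {x | 0 < w' x}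
        · rw [indicator_of_mem hw0]
          have : 0 < w' x := hw0
          rw [h3, abs_of_pos this]; ring
        · rw [indicator_of_notMem hw0]
          have : ¬ 0 < w' x := hw0
          rw [h3, abs_of_nonpos (not_lt.1 this)]; ring
  refine ⟨s, hsm.aestronglyMeasurable, hs1, hsw, ?_⟩
  have hsG : Integrable (fun x => s x * G x) volume :=
    hG.bdd_mul (c := 1) hsm.aestronglyMeasurable (ae_of_all _ hs1)
  have hsV : Integrable (fun x => s x * (V x + Λ * w x)) volume :=
    (hV.add (hw.const_mul Λ)).bdd_mul (c := 1) hsm.aestronglyMeasurable (ae_of_all _ hs1)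
  have hle : ∫ x, -(s x * G x) ≤ ∫ x, s x * (V x + Λ * w x) := by
    refine integral_mono_ae hsG.neg hsV ?_
    filter_upwards [hsw] with x hx
    have h3 : s x * (V x + Λ * w x) = (deriv f x + Λ) * (s x * w x) - s x * G x := by
      simp only [hGdef]; ring
    rw [h3, hx]
    have := neg_le_of_abs_le (hΛ x)
    nlinarith [abs_nonneg (w x)]
  refine le_trans ?_ hle
  rw [integral_neg, neg_nonneg]
  -- The set {F = 0} drops out because `G`, the derivative of `F`, vanishes almost everywhere on it.
  have hdecomp : ∀ᵐ x, s x * G x =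
      A.indicator (fun x => sA x * G x) x + B.indicator (fun x => sB x * G x) x := by
    filter_upwards [e3] with x h3
    by_cases hx : x ∈ A
    · have hxB : x ∉ B := by
        have h4 : 0 < F x := hx
        intro h5
        have h5 : 0 < -F x := h5
        linarith
      simp only [s, piecewise_eq_of_mem _ _ _ hx, indicator_of_mem hx, indicator_of_notMem hxB,
        add_zero]
    · simp only [s, piecewise_eq_of_notMem _ _ _ hx, indicator_of_notMem hx, zero_add]
      by_cases hxB : x ∈ B
      · simp only [piecewise_eq_of_mem _ _ _ hxB, indicator_of_mem hxB]
      · have h4 : ¬ 0 < F x := hx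
        have h5 : ¬ 0 < -F x := hxB
        have h6 : G x = 0 := h3 (by linarith)
        simp only [piecewise_eq_of_notMem _ _ _ hxB, indicator_of_notMem hxB, h6, mul_zero]
  have iA : Integrable (fun x => sA x * G x) volume :=
    hG.bdd_mul (c := 1) ((measurable_const.indicator hPm).sub_const 1).aestronglyMeasurable
      (ae_of_all _ fun x => hsign P x)
  have iB : Integrable (fun x => sB x * G x) volume :=
    hG.bdd_mul (c := 1) ((measurable_const.indicator hNm).sub_const 1).neg.aestronglyMeasurable
      (ae_of_all _ fun x => by simp only [sB, norm_neg]; exact hsign N x)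
  rw [integral_congr_ae hdecomp, integral_add (iA.indicator hAm) (iB.indicator hBm),
    integral_indicator hAm, integral_indicator hBm]
  have h3 : ∫ x in B, sB x * G x ≤ 0 := by
    refine le_trans (le_of_eq ?_) h2
    refine integral_congr_ae (ae_of_all _ fun x => ?_)
    simp only [sB]; ring
  have h1 : ∫ x in A, sA x * G x ≤ 0 := h1
  linarith

end sign

/-! ### Weak derivatives on the line -/

section weak

theorem exists_support_Icc {φ : ℝ → ℝ} (hφ : HasCompactSupport φ) :
    ∃ R : ℝ, 0 < R ∧ ∀ x, φ x ≠ 0 → x ∈ Ioo (-R) R := by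
  obtain ⟨R, hR⟩ := hφ.isCompact.isBounded.subset_ball (0 : ℝ)
  refine ⟨max R 1, lt_max_of_lt_right one_pos, fun x hx => ?_⟩
  have := hR (subset_tsupport φ hx)
  rw [Metric.mem_ball, dist_zero_right, Real.norm_eq_abs, abs_lt] at this
  exact ⟨by linarith [le_max_left R 1], by linarith [le_max_left R 1]⟩

theorem integral_eq_intervalIntegral {g : ℝ → ℝ} {R : ℝ}
    (h : ∀ x, g x ≠ 0 → x ∈ Ioo (-R) R) : ∫ x, g x = ∫ x in (-R)..R, g x := by
  rw [intervalIntegral.integral_eq_integral_of_support_subset]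
  intro x hx
  exact Ioo_subset_Ioc_self (h x hx)

/-- Integration by parts against a compactly supported function. -/
theorem IsPrimitive.integral_mul_deriv {F G φ : ℝ → ℝ} (hF : IsPrimitive F G)
    (hφ : ContDiff ℝ 1 φ) (hc : HasCompactSupport φ) :
    ∫ x, F x * deriv φ x = -∫ x, G x * φ x := by
  obtain ⟨R, hR, hs⟩ := exists_support_Icc hc
  obtain ⟨R', hR', hs'⟩ := exists_support_Icc hc.deriv
  set S := max R R' with hS
  have hS0 : 0 < S := lt_max_of_lt_left hR
  have h1 : ∀ x, φ x ≠ 0 → x ∈ Ioo (-S) S := fun x hx =>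
    ⟨by linarith [(hs x hx).1, le_max_left R R'], by linarith [(hs x hx).2, le_max_left R R']⟩
  have h2 : ∀ x, deriv φ x ≠ 0 → x ∈ Ioo (-S) S := fun x hx =>
    ⟨by linarith [(hs' x hx).1, le_max_right R R'], by linarith [(hs' x hx).2, le_max_right R R']⟩
  have e1 : φ S = 0 := by
    by_contra h
    exact lt_irrefl _ (h1 S h).2
  have e2 : φ (-S) = 0 := by
    by_contra h
    exact lt_irrefl _ (h1 _ h).1
  have hFac : AbsolutelyContinuousOnInterval F (-S) S := by
    have := (hF.intervalIntegrable (-S) S).absolutelyContinuousOnInterval_intervalIntegral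
      (c := -S) (by simp)
    have h3 : F = fun x => (∫ t in (-S)..x, G t) - (fun _ => - F (-S)) x := by
      funext x; rw [hF.eq (-S) x]; ring
    rw [h3]
    exact this.sub (LipschitzWith.const (-F (-S))).lipschitzOnWith.absolutelyContinuousOnInterval
  have hφac : AbsolutelyContinuousOnInterval φ (-S) S :=
    hφ.contDiffOn.absolutelyContinuousOnInterval
  rw [integral_eq_intervalIntegral (fun x hx => h2 x (right_ne_zero_of_mul hx)),
    integral_eq_intervalIntegral (fun x hx => h1 x (right_ne_zero_of_mul hx)),
    hFac.integral_mul_deriv_eq_deriv_mul hφac, e1, e2]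
  have : ∫ x in (-S)..S, deriv F x * φ x = ∫ x in (-S)..S, G x * φ x := by
    refine intervalIntegral.integral_congr_ae ?_
    filter_upwards [hF.ae_hasDerivAt] with x hx _
    rw [hx.deriv]
  rw [this]; ring

theorem locallyIntegrable_mul_compact {u ψ : ℝ → ℝ} (hu : LocallyIntegrable u volume)
    (hψ : Continuous ψ) (hc : HasCompactSupport ψ) : Integrable (fun x => u x * ψ x) volume := by
  have := hu.integrable_smul_right_of_hasCompactSupport hψ hc
  simpa using this

/-- A test function minus a multiple of a fixed one of integral `1` is the derivative of a test
function. -/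
theorem exists_deriv_eq_sub {θ ψ : ℝ → ℝ} (hθ : ContDiff ℝ (⊤ : ℕ∞) θ) (hθc : HasCompactSupport θ)
    (hθ1 : ∫ x, θ x = 1) (hψ : ContDiff ℝ (⊤ : ℕ∞) ψ) (hψc : HasCompactSupport ψ) :
    ∃ φ : ℝ → ℝ, ContDiff ℝ (⊤ : ℕ∞) φ ∧ HasCompactSupport φ ∧
      deriv φ = fun x => ψ x - (∫ t, ψ t) * θ x := by
  set g : ℝ → ℝ := fun x => ψ x - (∫ t, ψ t) * θ x with hg
  have hgs : ContDiff ℝ (⊤ : ℕ∞) g := hψ.sub (contDiff_const.mul hθ)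
  have hgc : HasCompactSupport g := hψc.sub (hθc.mul_left)
  have hgi : Integrable g volume := hgs.continuous.integrable_of_hasCompactSupport hgc
  have hg0 : ∫ x, g x = 0 := by
    rw [hg, integral_sub (hψ.continuous.integrable_of_hasCompactSupport hψc)
      ((hθ.continuous.integrable_of_hasCompactSupport hθc).const_mul _), integral_const_mul, hθ1]
    ring
  obtain ⟨R, hR, hs⟩ := exists_support_Icc hgc
  have hd : ∀ x, HasDerivAt (fun x => ∫ t in (-R)..x, g t) (g x) x := fun x =>
    intervalIntegral.integral_hasDerivAt_right hgi.intervalIntegrable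
      hgs.continuous.aestronglyMeasurable.stronglyMeasurableAtFilter hgs.continuous.continuousAt
  have hderiv : deriv (fun x => ∫ t in (-R)..x, g t) = g := funext fun x => (hd x).deriv
  refine ⟨fun x => ∫ t in (-R)..x, g t, ?_, ?_, hderiv⟩
  · rw [contDiff_infty_iff_deriv, hderiv]
    exact ⟨fun x => (hd x).differentiableAt, hgs⟩
  · refine HasCompactSupport.intro (isCompact_Icc (a := -R) (b := R)) fun x hx => ?_
    rcases lt_or_ge x (-R) with h | h
    · rw [intervalIntegral.integral_symm, neg_eq_zero]
      refine intervalIntegral.integral_zero_ae (ae_of_all _ fun t ht => ?_)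
      rw [uIoc_of_le h.le] at ht
      by_contra hne
      linarith [(hs t hne).1, ht.2]
    · have hRx : R < x := by
        by_contra hn
        exact hx ⟨h, not_lt.1 hn⟩
      have h1 : ∫ t in R..x, g t = 0 := by
        refine intervalIntegral.integral_zero_ae (ae_of_all _ fun t ht => ?_)
        rw [uIoc_of_le hRx.le] at ht
        by_contra hne
        linarith [(hs t hne).2, ht.1]
      rw [← intervalIntegral.integral_add_adjacent_intervals (b := R) hgi.intervalIntegrable
        hgi.intervalIntegrable, h1, ← integral_eq_intervalIntegral hs, hg0, add_zero]

theorem exists_bump : ∃ θ : ℝ → ℝ, ContDiff ℝ (⊤ : ℕ∞) θ ∧ HasCompactSupport θ ∧ ∫ x, θ x = 1 := by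
  let b : ContDiffBump (0 : ℝ) := default
  exact ⟨b.normed volume, b.contDiff_normed, b.hasCompactSupport_normed, b.integral_normed⟩

/-- A locally integrable function whose second distributional derivative vanishes is affine. -/
theorem ae_eq_affine {u : ℝ → ℝ} (hu : LocallyIntegrable u volume)
    (h : ∀ φ : ℝ → ℝ, ContDiff ℝ (⊤ : ℕ∞) φ → HasCompactSupport φ →
      ∫ x, u x * deriv (deriv φ) x = 0) : ∃ c d : ℝ, ∀ᵐ x, u x = c + d * x := by
  obtain ⟨θ, hθ, hθc, hθ1⟩ := exists_bump
  have hder : ∀ {ψ : ℝ → ℝ}, ContDiff ℝ (⊤ : ℕ∞) ψ → ContDiff ℝ (⊤ : ℕ∞) (deriv ψ) := fun hψ =>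
    (contDiff_infty_iff_deriv.1 hψ).2
  -- Testing with a φ for which φ' = ψ - (∫ ψ) θ gives ∫ u ψ' = c ∫ ψ. So u' = -c in the sense of
  -- distributions, and u + c x has zero derivative.
  set c := ∫ x, u x * deriv θ x with hc
  have hid : IsPrimitive (fun x : ℝ => c * x) (fun _ => c) :=
    ⟨(continuous_const).locallyIntegrable, fun a b => by
      rw [intervalIntegral.integral_const, smul_eq_mul]; ring⟩
  have h1 : ∀ ψ : ℝ → ℝ, ContDiff ℝ (⊤ : ℕ∞) ψ → HasCompactSupport ψ →
      ∫ x, (u x + c * x) * deriv ψ x = 0 := by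
    intro ψ hψ hψc
    obtain ⟨φ, hφ, hφc, hd⟩ := exists_deriv_eq_sub hθ hθc hθ1 hψ hψc
    have h2 := h φ hφ hφc
    have hd2 : deriv (deriv φ) = fun x => deriv ψ x - (∫ t, ψ t) * deriv θ x := by
      rw [hd]; funext x
      rw [deriv_fun_sub ((hψ.differentiable (by simp)) x)
        (((hθ.differentiable (by simp)) x).const_mul _),
        deriv_const_mul _ ((hθ.differentiable (by simp)) x)]
    have iψ := locallyIntegrable_mul_compact hu (hder hψ).continuous hψc.deriv
    have iθ := locallyIntegrable_mul_compact hu (hder hθ).continuous hθc.deriv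
    have h3 : ∫ x, u x * deriv ψ x = (∫ t, ψ t) * c := by
      rw [hd2] at h2
      have : ∀ x, u x * (deriv ψ x - (∫ t, ψ t) * deriv θ x) =
          u x * deriv ψ x - (∫ t, ψ t) * (u x * deriv θ x) := fun x => by ring
      simp_rw [this] at h2
      rw [integral_sub iψ (iθ.const_mul _), integral_const_mul] at h2
      linarith
    have h4 := hid.integral_mul_deriv (hψ.of_le (by simp)) hψc
    simp_rw [add_mul]
    rw [integral_add iψ (locallyIntegrable_mul_compact hid.continuous.locallyIntegrable
      (hder hψ).continuous hψc.deriv), h3, h4, integral_const_mul]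
    ring
  have hu1 : LocallyIntegrable (fun x => u x + c * x) volume :=
    hu.add hid.continuous.locallyIntegrable
  set e := ∫ x, (u x + c * x) * θ x with he
  have h2 : ∀ᵐ x, u x + c * x = e := by
    refine ae_eq_of_integral_contDiff_smul_eq hu1 continuous_const.locallyIntegrable ?_
    intro ψ hψ hψc
    obtain ⟨φ, hφ, hφc, hd⟩ := exists_deriv_eq_sub hθ hθc hθ1 hψ hψc
    have h2 := h1 φ hφ hφc
    rw [hd] at h2
    have iψ := locallyIntegrable_mul_compact hu1 hψ.continuous hψc
    have iθ := locallyIntegrable_mul_compact hu1 hθ.continuous hθc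
    have : ∀ x, (u x + c * x) * (ψ x - (∫ t, ψ t) * θ x) =
        (u x + c * x) * ψ x - (∫ t, ψ t) * ((u x + c * x) * θ x) := fun x => by ring
    simp_rw [this] at h2
    rw [integral_sub iψ (iθ.const_mul _), integral_const_mul] at h2
    simp only [smul_eq_mul]
    rw [integral_mul_const]
    simp_rw [mul_comm (ψ _)]
    linarith
  refine ⟨e, -c, ?_⟩
  filter_upwards [h2] with x hx
  linarith

end weak

/-! ### Primitives associated with the operator -/

section primitives

variable {f y v ζ F z : ℝ → ℝ}

theorem le_of_ae_le_of_continuous {z : ℝ → ℝ} (hz : Continuous z) {C : ℝ} (h : ∀ᵐ x, |z x| ≤ C) :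
    ∀ x, |z x| ≤ C := by
  have hd : Dense {x | |z x| ≤ C} := Measure.dense_of_ae h
  have hc : IsClosed {x | |z x| ≤ C} := isClosed_le hz.abs continuous_const
  intro x
  have : x ∈ closure {x | |z x| ≤ C} := hd x
  rwa [hc.closure_eq] at this

/-- A limit L ≠ 0 would make the integral of `F` over an interval of length T, far to the right, at
least |L| T / 2 in absolute value, which is unbounded in T. -/
theorem tendsto_zero_of_bounded_integral {L C : ℝ} (hF : Continuous F)
    (h : Tendsto F atTop (𝓝 L)) (hC : ∀ a b, |∫ x in a..b, F x| ≤ C) : L = 0 := by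
  by_contra hL
  have hL' : 0 < |L| := abs_pos.2 hL
  obtain ⟨M, hM⟩ := eventually_atTop.1 (Metric.tendsto_nhds.1 h (|L| / 2) (by linarith))
  have h1 : ∀ T : ℝ, 0 ≤ T → |L| / 2 * T ≤ C := by
    intro T hT
    have h2 : ‖∫ x in M..(M + T), (F x - L)‖ ≤ |L| / 2 * |M + T - M| := by
      refine intervalIntegral.norm_integral_le_of_norm_le_const fun x hx => ?_
      rw [uIoc_of_le (by linarith)] at hx
      exact (hM x hx.1.le).le
    rw [intervalIntegral.integral_sub (hF.intervalIntegrable _ _) intervalIntegrable_const,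
      intervalIntegral.integral_const, add_sub_cancel_left, abs_of_nonneg hT, smul_eq_mul,
      Real.norm_eq_abs] at h2
    have h3 := hC M (M + T)
    have h4 : |T * L| = T * |L| := by rw [abs_mul, abs_of_nonneg hT]
    have h5 := abs_sub_abs_le_abs_sub (T * L) (∫ x in M..(M + T), F x)
    rw [abs_sub_comm (T * L)] at h5
    linarith
  have h2 := h1 (2 * (|C| + 1) / |L|) (by positivity)
  have h3 : |L| / 2 * (2 * (|C| + 1) / |L|) = |C| + 1 := by field_simp
  linarith [le_abs_self C]

/-- Integrals of `F` are increments of the bounded `z` plus integrals of the integrable `g`, hence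
uniformly bounded. -/
theorem tendsto_zero_atTop (hF : Continuous F) {L : ℝ} (hL : Tendsto F atTop (𝓝 L))
    {g : ℝ → ℝ} (hg : Integrable g volume)
    (hz : IsPrimitive z (fun x => F x - g x)) {C : ℝ} (hC : ∀ x, |z x| ≤ C) :
    L = 0 := by
  refine tendsto_zero_of_bounded_integral hF hL (C := 2 * C + ∫ x, |g x|) fun a b => ?_
  have h1 := hz.sub_eq a b
  rw [intervalIntegral.integral_sub (hF.intervalIntegrable _ _) hg.intervalIntegrable] at h1
  have h2 : |∫ x in a..b, g x| ≤ ∫ x, |g x| :=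
    (intervalIntegral.norm_integral_le_integral_norm_uIoc).trans
      (setIntegral_le_integral hg.norm (ae_of_all _ fun _ => norm_nonneg _))
  have h3 : ∫ x in a..b, F x = z b - z a + ∫ x in a..b, g x := by linarith
  rw [h3]
  refine (abs_add_le _ _).trans (add_le_add ((abs_sub _ _).trans ?_) h2)
  linarith [hC a, hC b]

theorem IsPrimitive.exists_tendsto_atTop {G : ℝ → ℝ} (hF : IsPrimitive F G)
    (hG : Integrable G volume) : ∃ L, Tendsto F atTop (𝓝 L) := by
  refine ⟨F 0 + ∫ x in Ioi 0, G x, ?_⟩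
  have := (intervalIntegral_tendsto_integral_Ioi 0 hG.integrableOn tendsto_id).const_add (F 0)
  exact this.congr fun x => (hF.eq 0 x).symm

/-- In a weak solution of `v = -ζ'' - f y'` the functions `ζ` and its flux are absolutely
continuous, and the flux vanishes at infinity. -/
theorem exists_primitives (hf : ContDiff ℝ 1 f) {Λ Cf : ℝ} (hΛ : ∀ x, |deriv f x| ≤ Λ)
    (hCf : ∀ x, |f x| ≤ Cf) (hy : Integrable y volume) (hv : Integrable v volume)
    (hζ : MemLp ζ ∞ volume)
    (h : ∀ φ : ℝ → ℝ, ContDiff ℝ (⊤ : ℕ∞) φ → HasCompactSupport φ →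
      ∫ x, v x * φ x = -(∫ x, ζ x * deriv (deriv φ) x) + ∫ x, y x * deriv (fun t => f t * φ t) x) :
    ∃ F z : ℝ → ℝ, IsPrimitive F (fun x => deriv f x * y x - v x) ∧
      IsPrimitive z (fun x => F x - f x * y x) ∧ Tendsto F atTop (𝓝 0) ∧ Tendsto F atBot (𝓝 0) ∧
      (∀ᵐ x, z x = ζ x) ∧ ∃ C, ∀ x, |z x| ≤ C := by
  have hdf : Continuous (deriv f) := hf.continuous_deriv (by norm_num)
  have hfy : Integrable (fun x => f x * y x) volume :=
    hy.bdd_mul (c := Cf) hf.continuous.aestronglyMeasurable (ae_of_all _ hCf)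
  have hfy' : Integrable (fun x => deriv f x * y x) volume :=
    hy.bdd_mul (c := Λ) hdf.aestronglyMeasurable (ae_of_all _ hΛ)
  have hG : Integrable (fun x => deriv f x * y x - v x) volume := hfy'.sub hv
  set F₀ := fun x => ∫ t in (0 : ℝ)..x, (deriv f t * y t - v t) with hF₀
  have pF₀ : IsPrimitive F₀ _ := isPrimitive_integral hG.locallyIntegrable 0
  have lz : LocallyIntegrable (fun x => F₀ x - f x * y x) volume :=
    pF₀.continuous.locallyIntegrable.sub hfy.locallyIntegrable
  set z₀ := fun x => ∫ t in (0 : ℝ)..x, (F₀ t - f t * y t) with hz₀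
  have pz₀ : IsPrimitive z₀ _ := isPrimitive_integral lz 0
  have hζl : LocallyIntegrable ζ volume := hζ.locallyIntegrable (by simp)
  -- The double primitive `z₀` has the same second distributional derivative as `ζ`. The affine
  -- difference c + d x is then absorbed: d into the flux and c + d x into `z`.
  obtain ⟨c, d, hcd⟩ := ae_eq_affine (hζl.sub pz₀.continuous.locallyIntegrable) (by
    intro φ hφ hφc
    have hφ' : ContDiff ℝ (⊤ : ℕ∞) (deriv φ) := (contDiff_infty_iff_deriv.1 hφ).2
    have hφ'' : ContDiff ℝ (⊤ : ℕ∞) (deriv (deriv φ)) := (contDiff_infty_iff_deriv.1 hφ').2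
    have e1 := pz₀.integral_mul_deriv (hφ'.of_le (by simp)) hφc.deriv
    have e2 := pF₀.integral_mul_deriv (hφ.of_le (by simp)) hφc
    have e3 := h φ hφ hφc
    have e4 : ∀ x, y x * deriv (fun t => f t * φ t) x =
        (deriv f x * y x) * φ x + (f x * y x) * deriv φ x := fun x => by
      rw [deriv_fun_mul ((hf.differentiable (by simp)) x) ((hφ.differentiable (by simp)) x)]
      ring
    simp only [sub_mul] at e1 e2
    simp_rw [e4] at e3
    rw [integral_add (locallyIntegrable_mul_compact hfy'.locallyIntegrable hφ.continuous hφc)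
      (locallyIntegrable_mul_compact hfy.locallyIntegrable hφ'.continuous hφc.deriv)] at e3
    rw [integral_sub
      (locallyIntegrable_mul_compact pF₀.continuous.locallyIntegrable hφ'.continuous hφc.deriv)
      (locallyIntegrable_mul_compact hfy.locallyIntegrable hφ'.continuous hφc.deriv)] at e1
    rw [integral_sub (locallyIntegrable_mul_compact hfy'.locallyIntegrable hφ.continuous hφc)
      (locallyIntegrable_mul_compact hv.locallyIntegrable hφ.continuous hφc)] at e2
    simp only [Pi.sub_apply, sub_mul]
    rw [integral_sub (locallyIntegrable_mul_compact hζl hφ''.continuous hφc.deriv.deriv)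
      (locallyIntegrable_mul_compact pz₀.continuous.locallyIntegrable hφ''.continuous
        hφc.deriv.deriv)]
    linarith)
  have hlin : IsPrimitive (fun x : ℝ => -(c + d * x)) (fun _ => -d) :=
    ⟨(continuous_const).locallyIntegrable, fun a b => by
      rw [intervalIntegral.integral_const, smul_eq_mul]; ring⟩
  have pF : IsPrimitive (fun x => F₀ x + d) (fun x => deriv f x * y x - v x) := pF₀.add_const d
  have pz : IsPrimitive (fun x => z₀ x - -(c + d * x)) (fun x => (F₀ x + d) - f x * y x) := by
    have := pz₀.sub hlin
    convert this using 2
    ring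
  have hzζ : ∀ᵐ x, z₀ x - -(c + d * x) = ζ x := by
    filter_upwards [hcd] with x hx
    simp only [Pi.sub_apply] at hx
    linarith
  obtain ⟨C, hC⟩ : ∃ C, ∀ x, |z₀ x - -(c + d * x)| ≤ C := by
    refine ⟨(eLpNormEssSup ζ volume).toReal, le_of_ae_le_of_continuous pz.continuous ?_⟩
    filter_upwards [hzζ, ae_le_eLpNormEssSup (f := ζ) (μ := volume)] with x h1 h2
    rw [h1, ← Real.norm_eq_abs, ← toReal_enorm]
    refine ENNReal.toReal_mono ?_ h2
    have := hζ.eLpNorm_ne_top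
    rwa [eLpNorm_exponent_top] at this
  refine ⟨_, _, pF, pz, ?_, ?_, hzζ, C, hC⟩
  · obtain ⟨L, hL⟩ := pF.exists_tendsto_atTop hG
    rwa [tendsto_zero_atTop pF.continuous hL hfy pz hC] at hL
  -- The limit at -∞ is reduced to the one at +∞ by reflection; `z(-x)` changes sign so that the
  -- reflected pair again satisfies a system of the same form.
  · have qF := pF.comp_neg
    obtain ⟨L, hL⟩ := qF.exists_tendsto_atTop hG.comp_neg.neg
    have qz := pz.comp_neg.neg
    simp only [neg_neg] at qz
    have hL0 := tendsto_zero_atTop qF.continuous hL hfy.comp_neg qz (fun x => by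
      rw [abs_neg]; exact hC (-x))
    rw [hL0] at hL
    have := hL.comp tendsto_neg_atBot_atTop
    simpa [Function.comp_def] using this

/-- The converse of `exists_primitives`. -/
theorem weak_of_primitives (hf : ContDiff ℝ 1 f) {Λ Cf : ℝ} (hΛ : ∀ x, |deriv f x| ≤ Λ)
    (hCf : ∀ x, |f x| ≤ Cf) (hy : Integrable y volume) (hv : Integrable v volume)
    (pF : IsPrimitive F (fun x => deriv f x * y x - v x))
    (pz : IsPrimitive z (fun x => F x - f x * y x)) (hzζ : ∀ᵐ x, z x = ζ x)
    {φ : ℝ → ℝ} (hφ : ContDiff ℝ (⊤ : ℕ∞) φ) (hφc : HasCompactSupport φ) :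
    ∫ x, v x * φ x =
      -(∫ x, ζ x * deriv (deriv φ) x) + ∫ x, y x * deriv (fun t => f t * φ t) x := by
  have hdf : Continuous (deriv f) := hf.continuous_deriv (by norm_num)
  have hfy : Integrable (fun x => f x * y x) volume :=
    hy.bdd_mul (c := Cf) hf.continuous.aestronglyMeasurable (ae_of_all _ hCf)
  have hfy' : Integrable (fun x => deriv f x * y x) volume :=
    hy.bdd_mul (c := Λ) hdf.aestronglyMeasurable (ae_of_all _ hΛ)
  have hφ' : ContDiff ℝ (⊤ : ℕ∞) (deriv φ) := (contDiff_infty_iff_deriv.1 hφ).2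
  have e1 := pz.integral_mul_deriv (hφ'.of_le (by simp)) hφc.deriv
  have e2 := pF.integral_mul_deriv (hφ.of_le (by simp)) hφc
  have e4 : ∀ x, y x * deriv (fun t => f t * φ t) x =
      (deriv f x * y x) * φ x + (f x * y x) * deriv φ x := fun x => by
    rw [deriv_fun_mul ((hf.differentiable (by simp)) x) ((hφ.differentiable (by simp)) x)]
    ring
  have e5 : ∫ x, ζ x * deriv (deriv φ) x = ∫ x, z x * deriv (deriv φ) x := by
    refine integral_congr_ae ?_
    filter_upwards [hzζ] with x hx
    rw [hx]
  simp_rw [e4]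
  rw [integral_add (locallyIntegrable_mul_compact hfy'.locallyIntegrable hφ.continuous hφc)
    (locallyIntegrable_mul_compact hfy.locallyIntegrable hφ'.continuous hφc.deriv), e5]
  simp only [sub_mul] at e1 e2
  rw [integral_sub
    (locallyIntegrable_mul_compact pF.continuous.locallyIntegrable hφ'.continuous hφc.deriv)
    (locallyIntegrable_mul_compact hfy.locallyIntegrable hφ'.continuous hφc.deriv)] at e1
  rw [integral_sub (locallyIntegrable_mul_compact hfy'.locallyIntegrable hφ.continuous hφc)
    (locallyIntegrable_mul_compact hv.locallyIntegrable hφ.continuous hφc)] at e2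
  linarith

end primitives

/-! ### The conjugate `H^*` -/

section conj

variable {h : ℝ → ℝ}

theorem le_Hstar (hh : CostHyp h) (p : ℝ) {u : ℝ} (hu : 0 ≤ u) : p * u - h u ≤ Hstar h p := by
  rw [← EReal.coe_le_coe_iff, coe_Hstar hh]
  refine le_trans (le_of_eq ?_) (le_iSup _ u)
  simp [extendedCost, hu]

theorem Hstar_le (hh : CostHyp h) {p c : ℝ} (hc : ∀ u, 0 ≤ u → p * u - h u ≤ c) :
    Hstar h p ≤ c := by
  rw [← EReal.coe_le_coe_iff, coe_Hstar hh]
  refine iSup_le fun u => ?_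
  unfold extendedCost
  split_ifs with hu
  · rw [← EReal.coe_sub, EReal.coe_le_coe_iff]; exact hc u hu
  · simp

theorem monotone_Hstar (hh : CostHyp h) : Monotone (Hstar h) := fun p q hpq =>
  Hstar_le hh fun u hu =>
    le_trans (by nlinarith [mul_le_mul_of_nonneg_right hpq hu]) (le_Hstar hh q hu)

/-- A supremum of affine functions is convex, and a finite convex function on the line is
continuous. -/
theorem continuous_Hstar (hh : CostHyp h) : Continuous (Hstar h) := by
  have hc : ConvexOn ℝ univ (Hstar h) := by
    refine ⟨convex_univ, fun p _ q _ a b ha hb hab => Hstar_le hh fun u hu => ?_⟩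
    have h1 := mul_le_mul_of_nonneg_left (le_Hstar hh p hu) ha
    have h2 := mul_le_mul_of_nonneg_left (le_Hstar hh q hu) hb
    have h3 : h u = a * h u + b * h u := by rw [← add_mul, hab, one_mul]
    simp only [smul_eq_mul]
    rw [h3]
    linarith
  exact continuousOn_univ.1 (hc.continuousOn isOpen_univ)

end conj

/-! ### Accretivity of the operator -/

section accretive

variable {h f σ : ℝ → ℝ} {Λ Cf : ℝ}

theorem opA_weak {y v : L1} (hv : v ∈ opA h f σ y) {φ : ℝ → ℝ} (hφ : ContDiff ℝ (⊤ : ℕ∞) φ)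
    (hφc : HasCompactSupport φ) :
    ∫ x, v x * φ x = -(∫ x, Hstar h (σ x ^ 2 * y x / 2) * deriv (deriv φ) x) +
      ∫ x, y x * deriv (fun t => f t * φ t) x := by
  have := hv.2 ⟨φ, hφ, hφc, by simp⟩
  simp only [distDeriv2, distMulDeriv, sub_neg_eq_add] at this
  exact this

theorem opA_exists_primitives (hf : ContDiff ℝ 1 f) (hΛ : ∀ x, |deriv f x| ≤ Λ)
    (hCf : ∀ x, |f x| ≤ Cf) {y v : L1} (hv : v ∈ opA h f σ y) :
    ∃ F z : ℝ → ℝ, IsPrimitive F (fun x => deriv f x * y x - v x) ∧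
      IsPrimitive z (fun x => F x - f x * y x) ∧ Tendsto F atTop (𝓝 0) ∧ Tendsto F atBot (𝓝 0) ∧
      (∀ᵐ x, z x = Hstar h (σ x ^ 2 * y x / 2)) ∧ ∃ C, ∀ x, |z x| ≤ C :=
  exists_primitives hf hΛ hCf (L1.integrable_coeFn y) (L1.integrable_coeFn v) hv.1
    fun _ => opA_weak hv

theorem mem_opA_of_primitives (hf : ContDiff ℝ 1 f) (hΛ : ∀ x, |deriv f x| ≤ Λ)
    (hCf : ∀ x, |f x| ≤ Cf) {y v : L1} {F z : ℝ → ℝ}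
    (pF : IsPrimitive F (fun x => deriv f x * y x - v x))
    (pz : IsPrimitive z (fun x => F x - f x * y x))
    (hz : ∀ᵐ x, z x = Hstar h (σ x ^ 2 * y x / 2)) {C : ℝ} (hC : ∀ x, |z x| ≤ C) :
    v ∈ opA h f σ y := by
  refine ⟨?_, fun φ => ?_⟩
  · have : MemLp z ∞ volume :=
      memLp_top_of_bound pz.continuous.aestronglyMeasurable C (ae_of_all _ hC)
    exact this.ae_eq hz
  · simp only [distDeriv2, distMulDeriv, sub_neg_eq_add]
    exact weak_of_primitives hf hΛ hCf (L1.integrable_coeFn y) (L1.integrable_coeFn v) pF pz hz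
      φ.contDiff φ.hasCompactSupport

/-- The system for (y, v, F, z) is linear, so differences satisfy it too. The nonlinearity enters
only through monotonicity: a strict inequality between values of `Hstar` orders the two arguments,
which is the weak sign condition of `exists_sign`. -/
theorem opA_exists_sign (hh : CostHyp h) (hf : ContDiff ℝ 1 f) (hΛ : ∀ x, |deriv f x| ≤ Λ)
    (hCf : ∀ x, |f x| ≤ Cf) {y₁ y₂ v₁ v₂ : L1} (h₁ : v₁ ∈ opA h f σ y₁) (h₂ : v₂ ∈ opA h f σ y₂) :
    ∃ s : ℝ → ℝ, AEStronglyMeasurable s volume ∧ (∀ x, |s x| ≤ 1) ∧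
      (∀ᵐ x, s x * (y₁ - y₂ : L1) x = |(y₁ - y₂ : L1) x|) ∧
      0 ≤ ∫ x, s x * ((v₁ - v₂ : L1) x + Λ * (y₁ - y₂ : L1) x) := by
  obtain ⟨F₁, z₁, pF₁, pz₁, t₁, b₁, e₁, -⟩ := opA_exists_primitives hf hΛ hCf h₁
  obtain ⟨F₂, z₂, pF₂, pz₂, t₂, b₂, e₂, -⟩ := opA_exists_primitives hf hΛ hCf h₂
  have pF : IsPrimitive (fun x => F₁ x - F₂ x)
      (fun x => deriv f x * (y₁ x - y₂ x) - (v₁ x - v₂ x)) := by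
    convert pF₁.sub pF₂ using 2; ring
  have pz : IsPrimitive (fun x => z₁ x - z₂ x)
      (fun x => (F₁ x - F₂ x) - f x * (y₁ x - y₂ x)) := by
    convert pz₁.sub pz₂ using 2; ring
  have hs : SameSign (fun x => z₁ x - z₂ x) (fun x => y₁ x - y₂ x) := by
    have hm := monotone_Hstar hh
    have key : ∀ x a b : ℝ, Hstar h (σ x ^ 2 * a / 2) < Hstar h (σ x ^ 2 * b / 2) → a ≤ b := by
      intro x a b hab
      by_contra hn
      push Not at hn
      refine absurd (hm ?_) (not_le.2 hab)
      have := mul_le_mul_of_nonneg_left hn.le (sq_nonneg (σ x))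
      linarith
    filter_upwards [e₁, e₂] with x h1 h2
    rw [h1, h2]
    exact ⟨fun h => by linarith [key x (y₂ x) (y₁ x) (by linarith)],
      fun h => by linarith [key x (y₁ x) (y₂ x) (by linarith)]⟩
  obtain ⟨s, hsm, hs1, hsw, hs0⟩ := exists_sign hf hΛ
    ((L1.integrable_coeFn y₁).sub (L1.integrable_coeFn y₂))
    ((L1.integrable_coeFn v₁).sub (L1.integrable_coeFn v₂)) pF pz
    (by simpa using t₁.sub t₂) (by simpa using b₁.sub b₂) hs
  refine ⟨s, hsm, hs1, ?_, ?_⟩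
  · filter_upwards [hsw, Lp.coeFn_sub y₁ y₂] with x h1 h2
    rw [h2]; exact h1
  · refine hs0.trans (le_of_eq (integral_congr_ae ?_))
    filter_upwards [Lp.coeFn_sub y₁ y₂, Lp.coeFn_sub v₁ v₂] with x h1 h2
    rw [h1, h2]

/-- Integration against a function bounded by `1`. -/
theorem exists_dual {s : ℝ → ℝ} (hsm : AEStronglyMeasurable s volume) (hs1 : ∀ x, |s x| ≤ 1) :
    ∃ ξ : StrongDual ℝ L1, (∀ g : L1, ξ g = ∫ x, s x * g x) ∧ ‖ξ‖ ≤ 1 := by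
  have hi : ∀ g : L1, Integrable (fun x => s x * g x) volume := fun g =>
    (L1.integrable_coeFn g).bdd_mul (c := 1) hsm (ae_of_all _ hs1)
  let l : L1 →ₗ[ℝ] ℝ :=
    { toFun := fun g => ∫ x, s x * g x
      map_add' := fun g k => by
        rw [← integral_add (hi g) (hi k)]
        refine integral_congr_ae ?_
        filter_upwards [Lp.coeFn_add g k] with x hx
        rw [hx, Pi.add_apply]; ring
      map_smul' := fun c g => by
        rw [RingHom.id_apply, smul_eq_mul, ← integral_const_mul]
        refine integral_congr_ae ?_
        filter_upwards [Lp.coeFn_smul c g] with x hx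
        rw [hx, Pi.smul_apply, smul_eq_mul]; ring }
  have hl : ∀ g, ‖l g‖ ≤ 1 * ‖g‖ := fun g => by
    rw [one_mul, L1.norm_eq_integral_norm]
    refine (norm_integral_le_integral_norm _).trans
      (integral_mono (hi g).norm (L1.integrable_coeFn g).norm fun x => ?_)
    simp only [norm_mul]
    exact mul_le_of_le_one_left (norm_nonneg _) (hs1 x)
  exact ⟨l.mkContinuous 1 hl, fun g => rfl, l.mkContinuous_norm_le zero_le_one hl⟩

theorem opA_exists_dual (hh : CostHyp h) (hf : ContDiff ℝ 1 f) (hΛ : ∀ x, |deriv f x| ≤ Λ)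
    (hCf : ∀ x, |f x| ≤ Cf) {y₁ y₂ v₁ v₂ : L1} (h₁ : v₁ ∈ opA h f σ y₁) (h₂ : v₂ ∈ opA h f σ y₂) :
    ∃ ξ : StrongDual ℝ L1, ‖ξ‖ ≤ 1 ∧ ξ (y₁ - y₂) = ‖y₁ - y₂‖ ∧
      0 ≤ ξ (v₁ - v₂ + Λ • (y₁ - y₂)) := by
  obtain ⟨s, hsm, hs1, hsw, hs0⟩ := opA_exists_sign hh hf hΛ hCf h₁ h₂
  obtain ⟨ξ, hξ, hξ1⟩ := exists_dual hsm hs1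
  refine ⟨ξ, hξ1, ?_, ?_⟩
  · rw [hξ, L1.norm_eq_integral_norm]
    exact integral_congr_ae hsw
  · rw [hξ]
    refine hs0.trans (le_of_eq (integral_congr_ae ?_))
    filter_upwards [Lp.coeFn_add (v₁ - v₂) (Λ • (y₁ - y₂)), Lp.coeFn_smul Λ (y₁ - y₂)] with x h1 h2
    rw [h1, Pi.add_apply, h2]; rfl

theorem isAccretive_shift (hh : CostHyp h) (hf : ContDiff ℝ 1 f) (hΛ : ∀ x, |deriv f x| ≤ Λ)
    (hCf : ∀ x, |f x| ≤ Cf) : IsAccretive (shift Λ (opA h f σ)) := by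
  rintro y₁ y₂ _ ⟨v₁, h₁, rfl⟩ _ ⟨v₂, h₂, rfl⟩
  obtain ⟨ξ, hξ1, hξ2, hξ3⟩ := opA_exists_dual hh hf hΛ hCf h₁ h₂
  -- `ξ` has norm at most 1 and attains the norm of the difference; scaling by that norm puts it in
  -- the duality map, also when the difference is 0.
  refine ⟨‖y₁ - y₂‖ • ξ, ⟨?_, ?_⟩, ?_⟩
  · rw [smul_apply, hξ2, smul_eq_mul, sq]
  · rw [norm_smul, norm_norm]
    rcases (norm_nonneg (y₁ - y₂)).eq_or_lt with h0 | h0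
    · rw [← h0, zero_mul]
    · have : 1 ≤ ‖ξ‖ := by
        have := ξ.le_opNorm (y₁ - y₂)
        rw [hξ2, norm_norm] at this
        exact (le_mul_iff_one_le_left h0).1 this
      rw [le_antisymm hξ1 this, mul_one]
  · rw [smul_apply, smul_eq_mul]
    refine mul_nonneg (norm_nonneg _) ?_
    have : Λ • y₁ + v₁ - (Λ • y₂ + v₂) = v₁ - v₂ + Λ • (y₁ - y₂) := by
      rw [smul_sub]; abel
    rw [this]; exact hξ3

/-- The functional of `opA_exists_dual` is applied to the difference of the two equations, written
as (v - v' + Λ(y - y')) + (λ - Λ)(y - y'). -/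
theorem norm_sub_le_of_isSol (hh : CostHyp h) (hf : ContDiff ℝ 1 f) (hΛ : ∀ x, |deriv f x| ≤ Λ)
    (hCf : ∀ x, |f x| ≤ Cf) {lam : ℝ} (hlam : Λ < lam) {η η' y y' : L1}
    (hy : IsSol h f σ lam η y) (hy' : IsSol h f σ lam η' y') :
    ‖y - y'‖ ≤ (lam - Λ)⁻¹ * ‖η - η'‖ := by
  obtain ⟨v, hv, rfl⟩ := hy
  obtain ⟨v', hv', rfl⟩ := hy'
  obtain ⟨ξ, hξ1, hξ2, hξ3⟩ := opA_exists_dual hh hf hΛ hCf hv hv'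
  have e : lam • y + v - (lam • y' + v') = (v - v' + Λ • (y - y')) + (lam - Λ) • (y - y') := by
    rw [smul_sub, smul_sub, sub_smul, sub_smul]; abel
  have h1 : (lam - Λ) * ‖y - y'‖ ≤ ‖lam • y + v - (lam • y' + v')‖ := by
    calc (lam - Λ) * ‖y - y'‖ ≤ ξ (lam • y + v - (lam • y' + v')) := by
          rw [e, map_add, map_smul, hξ2, smul_eq_mul]; linarith
      _ ≤ ‖ξ (lam • y + v - (lam • y' + v'))‖ := le_abs_self _
      _ ≤ ‖ξ‖ * ‖lam • y + v - (lam • y' + v')‖ := ξ.le_opNorm _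
      _ ≤ _ := mul_le_of_le_one_left (norm_nonneg _) hξ1
  rw [← div_eq_inv_mul, le_div_iff₀ (by linarith)]
  linarith

theorem isSol_unique (hh : CostHyp h) (hf : ContDiff ℝ 1 f) (hΛ : ∀ x, |deriv f x| ≤ Λ)
    (hCf : ∀ x, |f x| ≤ Cf) {lam : ℝ} (hlam : Λ < lam) {η y y' : L1}
    (hy : IsSol h f σ lam η y) (hy' : IsSol h f σ lam η y') : y = y' := by
  have := norm_sub_le_of_isSol hh hf hΛ hCf hlam hy hy'
  rw [sub_self, norm_zero, mul_zero] at this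
  exact sub_eq_zero.1 (norm_le_zero_iff.1 this)

/-- Solvability for one parameter implies solvability for all smaller ones above `Λ`. -/
theorem exists_isSol_of_le (hh : CostHyp h) (hf : ContDiff ℝ 1 f) (hΛ : ∀ x, |deriv f x| ≤ Λ)
    (hCf : ∀ x, |f x| ≤ Cf) {lam lam₁ : ℝ} (hlam : Λ < lam) (hle : lam ≤ lam₁)
    (hex : ∀ η : L1, ∃ y, IsSol h f σ lam₁ η y) (η : L1) : ∃ y, IsSol h f σ lam η y := by
  choose R hR using hex
  -- A fixed point of `T` solves the equation with parameter `lam`, and the resolvent estimate at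
  -- `lam₁` gives the contraction constant (λ₁ - λ)/(λ₁ - Λ) < 1.
  let T : L1 → L1 := fun y => R (η + (lam₁ - lam) • y)
  have h1 : 0 < lam₁ - Λ := by linarith
  have hK : 0 ≤ (lam₁ - lam) / (lam₁ - Λ) := div_nonneg (by linarith) h1.le
  have hT : ContractingWith (NNReal.mk _ hK) T := by
    refine ⟨?_, LipschitzWith.of_dist_le_mul fun y y' => ?_⟩
    · rw [← NNReal.coe_lt_coe, NNReal.coe_mk, NNReal.coe_one, div_lt_one h1]; linarith
    · have := norm_sub_le_of_isSol hh hf hΛ hCf (by linarith)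
        (hR (η + (lam₁ - lam) • y)) (hR (η + (lam₁ - lam) • y'))
      rw [add_sub_add_left_eq_sub, ← smul_sub, norm_smul, Real.norm_of_nonneg (by linarith)] at this
      rw [dist_eq_norm, dist_eq_norm, NNReal.coe_mk]
      refine this.trans (le_of_eq ?_)
      ring
  obtain ⟨y, hy, -⟩ := hT.exists_fixedPoint 0 (edist_ne_top _ _)
  obtain ⟨v, hv, hvy⟩ := hR (η + (lam₁ - lam) • y)
  have hy' : R (η + (lam₁ - lam) • y) = y := hy
  rw [hy'] at hv hvy
  refine ⟨y, v, hv, ?_⟩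
  rw [sub_smul] at hvy
  have : lam • y + v = (lam₁ • y + v) - (lam₁ • y - lam • y) := by abel
  rw [this, hvy]; abel

end accretive

/-! ### The operator is closed -/

section closed

variable {h f σ : ℝ → ℝ} {Λ Cf Cσ : ℝ}

/-- If this failed, |y| would exceed ‖y‖ almost everywhere on an interval of length 1, and its
integral there would exceed the L¹ norm. -/
theorem exists_abs_le_norm (y : L1) {p : ℝ → Prop} (hp : ∀ᵐ x, p x) (a : ℝ) :
    ∃ t ∈ Icc a (a + 1), |y t| ≤ ‖y‖ ∧ p t := by
  by_contra hn
  push Not at hn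
  have hi := L1.integrable_coeFn y
  have h1 : 0 < ∫ t in a..(a + 1), (|y t| - ‖y‖) := by
    refine IsPrimitive.lt_of_ae_pos (z := fun x => ∫ t in a..x, (|y t| - ‖y‖))
      (isPrimitive_integral (hi.abs.locallyIntegrable.sub continuous_const.locallyIntegrable) a)
      (lt_add_one a) ?_ |> fun h => by simpa using h
    filter_upwards [hp] with t ht hta
    have := hn t (Ioo_subset_Icc_self hta)
    by_contra hle
    simp only [Pi.sub_apply] at hle
    exact this (by linarith) ht
  rw [intervalIntegral.integral_sub hi.abs.intervalIntegrable intervalIntegrable_const,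
    intervalIntegral.integral_const, add_sub_cancel_left, one_smul,
    intervalIntegral.integral_of_le (by linarith)] at h1
  have h2 : ∫ t in Ioc a (a + 1), |y t| ≤ ‖y‖ := by
    rw [L1.norm_eq_integral_norm]
    exact setIntegral_le_integral hi.abs (ae_of_all _ fun _ => abs_nonneg _)
  linarith

/-- On the graph of the operator, `H^*(σ² y / 2)` is controlled in `L^∞` by the graph norm. -/
theorem opA_bound (hh : CostHyp h) (hf : ContDiff ℝ 1 f) (hΛ : ∀ x, |deriv f x| ≤ Λ)
    (hCf : ∀ x, |f x| ≤ Cf) (hCσ : ∀ x, |σ x| ≤ Cσ) (N : ℝ) :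
    ∃ B, ∀ y v : L1, v ∈ opA h f σ y → ‖y‖ ≤ N → ‖v‖ ≤ N →
      ∀ᵐ x, |Hstar h (σ x ^ 2 * y x / 2)| ≤ B := by
  set P := Cσ ^ 2 * N / 2 with hP
  refine ⟨|Hstar h P| + |Hstar h (-P)| + ((Λ * N + N) + Cf * N), fun y v hv hy hvN => ?_⟩
  obtain ⟨F, z, pF, pz, ht, hb, hz, -⟩ := opA_exists_primitives hf hΛ hCf hv
  have iy := L1.integrable_coeFn y
  have iv := L1.integrable_coeFn v
  have hΛ0 : 0 ≤ Λ := (abs_nonneg _).trans (hΛ 0)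
  have hCf0 : 0 ≤ Cf := (abs_nonneg _).trans (hCf 0)
  have hdf : Continuous (deriv f) := hf.continuous_deriv (by norm_num)
  have hfy : Integrable (fun x => f x * y x) volume :=
    iy.bdd_mul (c := Cf) hf.continuous.aestronglyMeasurable (ae_of_all _ hCf)
  have hfy' : Integrable (fun x => deriv f x * y x) volume :=
    iy.bdd_mul (c := Λ) hdf.aestronglyMeasurable (ae_of_all _ hΛ)
  have habs : ∀ {g : ℝ → ℝ} (_ : Integrable g volume) (a b : ℝ),
      |∫ x in a..b, g x| ≤ ∫ x, |g x| := fun hg a b =>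
    (intervalIntegral.norm_integral_le_integral_norm_uIoc).trans
      (setIntegral_le_integral hg.norm (ae_of_all _ fun _ => norm_nonneg _))
  have hG : ∫ x, |deriv f x * y x - v x| ≤ Λ * N + N := by
    calc ∫ x, |deriv f x * y x - v x| ≤ ∫ x, (Λ * ‖y x‖ + ‖v x‖) := by
          refine integral_mono (hfy'.sub iv).abs ((iy.norm.const_mul _).add iv.norm) fun x => ?_
          refine (abs_sub _ _).trans (add_le_add ?_ le_rfl)
          rw [abs_mul]
          exact mul_le_mul_of_nonneg_right (hΛ x) (abs_nonneg _)
      _ = Λ * ‖y‖ + ‖v‖ := by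
          rw [integral_add (iy.norm.const_mul _) iv.norm, integral_const_mul,
            ← L1.norm_eq_integral_norm, ← L1.norm_eq_integral_norm]
      _ ≤ _ := add_le_add (mul_le_mul_of_nonneg_left hy hΛ0) hvN
  have hfy1 : ∫ x, |f x * y x| ≤ Cf * N := by
    calc ∫ x, |f x * y x| ≤ ∫ x, Cf * ‖y x‖ := by
          refine integral_mono hfy.abs (iy.norm.const_mul _) fun x => ?_
          simp only [abs_mul]
          exact mul_le_mul_of_nonneg_right (hCf x) (abs_nonneg _)
      _ = Cf * ‖y‖ := by rw [integral_const_mul, ← L1.norm_eq_integral_norm]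
      _ ≤ _ := mul_le_mul_of_nonneg_left hy hCf0
  -- The flux vanishes at infinity, so it is bounded by the L¹ norm of its derivative.
  have hF : ∀ x, |F x| ≤ Λ * N + N := by
    intro x
    have h1 : Tendsto (fun b => |F b - F x|) atTop (𝓝 |0 - F x|) := (ht.sub_const _).abs
    rw [zero_sub, abs_neg] at h1
    refine le_of_tendsto h1 (Eventually.of_forall fun b => ?_)
    rw [pF.sub_eq]
    exact (habs (hfy'.sub iv) x b).trans hG
  have hz' : ∀ x, |z x| ≤ |Hstar h P| + |Hstar h (-P)| + ((Λ * N + N) + Cf * N) := by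
    intro x
    -- Within distance 1 of `x` there is a point where `y` is bounded by its norm, hence where `z`
    -- is controlled; the bounds on `F` and on ∫ |f y| carry this control over to `x`.
    obtain ⟨t, htI, hty, htz⟩ := exists_abs_le_norm y hz x
    have h1 : |z t| ≤ |Hstar h P| + |Hstar h (-P)| := by
      rw [htz]
      have hσ : σ t ^ 2 ≤ Cσ ^ 2 := sq_le_sq' (neg_le_of_abs_le (hCσ t)) (le_of_abs_le (hCσ t))
      have h2 : |σ t ^ 2 * y t / 2| ≤ P := by
        rw [abs_div, abs_mul, abs_of_nonneg (sq_nonneg (σ t)), abs_of_pos (by norm_num : (0:ℝ) < 2),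
          hP]
        have := mul_le_mul hσ (hty.trans hy) (abs_nonneg _) (sq_nonneg Cσ)
        linarith
      have h3 := monotone_Hstar hh (le_of_abs_le h2)
      have h4 := monotone_Hstar hh (neg_le_of_abs_le h2)
      rw [abs_le]
      constructor
      · linarith [neg_abs_le (Hstar h (-P)), abs_nonneg (Hstar h P)]
      · linarith [le_abs_self (Hstar h P), abs_nonneg (Hstar h (-P))]
    have h2 : |z t - z x| ≤ (Λ * N + N) + Cf * N := by
      rw [pz.sub_eq, intervalIntegral.integral_sub (pF.continuous.intervalIntegrable _ _)
        hfy.intervalIntegrable]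
      refine (abs_sub _ _).trans (add_le_add ?_ ((habs hfy x t).trans hfy1))
      have h3 := intervalIntegral.norm_integral_le_of_norm_le_const (a := x) (b := t)
        (f := F) (C := Λ * N + N) fun u _ => hF u
      refine h3.trans (mul_le_of_le_one_right ((abs_nonneg _).trans (hF 0)) ?_)
      rw [abs_le]; constructor <;> linarith [htI.1, htI.2]
    have h3 : |z x| ≤ |z t| + |z t - z x| := by
      have := abs_sub (z t) (z t - z x)
      rwa [sub_sub_cancel] at this
    linarith
  filter_upwards [hz] with x hx
  rw [← hx]; exact hz' x

/-- Along a subsequence y_n → y almost everywhere, so the nonlinear terms converge almost everywhere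
by continuity. The uniform bound of `opA_bound` on graph-norm bounded sets allows dominated
convergence in the weak formulation. -/
theorem opA_closed (hh : CostHyp h) (hf : ContDiff ℝ 1 f) (hΛ : ∀ x, |deriv f x| ≤ Λ)
    (hCf : ∀ x, |f x| ≤ Cf) (hσ : Continuous σ) (hCσ : ∀ x, |σ x| ≤ Cσ)
    {yn vn : ℕ → L1} {y v : L1} (hmem : ∀ n, vn n ∈ opA h f σ (yn n))
    (hy : Tendsto yn atTop (𝓝 y)) (hv : Tendsto vn atTop (𝓝 v)) : v ∈ opA h f σ y := by
  obtain ⟨N₁, hN₁⟩ := (Metric.isBounded_range_of_tendsto _ hy).exists_norm_le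
  obtain ⟨N₂, hN₂⟩ := (Metric.isBounded_range_of_tendsto _ hv).exists_norm_le
  obtain ⟨B, hB⟩ := opA_bound (h := h) hh hf hΛ hCf hCσ (max N₁ N₂)
  have hB' : ∀ n, ∀ᵐ x, |Hstar h (σ x ^ 2 * yn n x / 2)| ≤ B := fun n =>
    hB _ _ (hmem n) ((hN₁ _ ⟨n, rfl⟩).trans (le_max_left _ _))
      ((hN₂ _ ⟨n, rfl⟩).trans (le_max_right _ _))
  obtain ⟨ns, hns, hae⟩ := (tendstoInMeasure_of_tendsto_Lp hy).exists_seq_tendsto_ae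
  have hjc := continuous_Hstar hh
  have hconv : ∀ᵐ x, Tendsto (fun n => Hstar h (σ x ^ 2 * yn (ns n) x / 2)) atTop
      (𝓝 (Hstar h (σ x ^ 2 * y x / 2))) := by
    filter_upwards [hae] with x hx
    exact (hjc.tendsto _).comp ((hx.const_mul _).div_const _)
  have hmeas : ∀ y : L1, AEStronglyMeasurable (fun x => Hstar h (σ x ^ 2 * y x / 2)) volume :=
    fun y => hjc.comp_aestronglyMeasurable
      ((((hσ.pow 2).aestronglyMeasurable).mul (Lp.aestronglyMeasurable y)).mul_const 2⁻¹ |>.congr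
        (ae_of_all _ fun x => by simp [div_eq_mul_inv]))
  have hall : ∀ᵐ x, ∀ n, |Hstar h (σ x ^ 2 * yn n x / 2)| ≤ B := ae_all_iff.2 hB'
  refine ⟨memLp_top_of_bound (hmeas y) B ?_, fun φ => ?_⟩
  · filter_upwards [hconv, hall] with x h1 h2
    exact le_of_tendsto h1.norm (Eventually.of_forall fun n => h2 _)
  · simp only [distDeriv2, distMulDeriv, sub_neg_eq_add]
    have hφ : ContDiff ℝ (⊤ : ℕ∞) φ := φ.contDiff
    have hφc : HasCompactSupport φ := φ.hasCompactSupport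
    have hφ' : ContDiff ℝ (⊤ : ℕ∞) (deriv φ) := (contDiff_infty_iff_deriv.1 hφ).2
    have hφ'' : ContDiff ℝ (⊤ : ℕ∞) (deriv (deriv φ)) := (contDiff_infty_iff_deriv.1 hφ').2
    -- pairing of an `L¹`-convergent sequence with a bounded function
    have pair : ∀ {un : ℕ → L1} {u : L1} (_ : Tendsto un atTop (𝓝 u)) {ψ : ℝ → ℝ}
        (_ : Continuous ψ) (_ : HasCompactSupport ψ),
        Tendsto (fun n => ∫ x, un n x * ψ x) atTop (𝓝 (∫ x, u x * ψ x)) := by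
      intro un u hu ψ hψ hψc
      obtain ⟨C, hC⟩ := hψc.exists_bound_of_continuous hψ
      have hC0 : 0 ≤ C := (norm_nonneg _).trans (hC 0)
      have hi : ∀ g : L1, Integrable (fun x => g x * ψ x) volume := fun g =>
        (L1.integrable_coeFn g).mul_bdd (c := C) hψ.aestronglyMeasurable (ae_of_all _ hC)
      rw [tendsto_iff_norm_sub_tendsto_zero]
      have h1 : Tendsto (fun n => C * ‖un n - u‖) atTop (𝓝 0) := by
        have := (tendsto_iff_norm_sub_tendsto_zero.1 hu).const_mul C
        rwa [mul_zero] at this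
      refine squeeze_zero (fun _ => norm_nonneg _) (fun n => ?_) h1
      rw [← integral_sub (hi _) (hi _), L1.norm_eq_integral_norm, ← integral_const_mul]
      refine norm_integral_le_of_norm_le ((L1.integrable_coeFn _).norm.const_mul _) ?_
      filter_upwards [Lp.coeFn_sub (un n) u] with x hx
      rw [hx, Pi.sub_apply, ← sub_mul, norm_mul, mul_comm]
      exact mul_le_mul_of_nonneg_right (hC x) (norm_nonneg _)
    have l1 := pair (hv.comp hns.tendsto_atTop) hφ.continuous hφc
    have hfφ : ContDiff ℝ 1 (fun t => f t * φ t) := hf.mul (hφ.of_le (by simp))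
    have l2 := pair (hy.comp hns.tendsto_atTop) (hfφ.continuous_deriv (by norm_num))
      (HasCompactSupport.deriv (hφc.mul_left))
    have l3 : Tendsto (fun n => ∫ x, Hstar h (σ x ^ 2 * yn (ns n) x / 2) * deriv (deriv φ) x) atTop
        (𝓝 (∫ x, Hstar h (σ x ^ 2 * y x / 2) * deriv (deriv φ) x)) := by
      refine tendsto_integral_of_dominated_convergence (fun x => B * ‖deriv (deriv φ) x‖)
        (fun n => (hmeas _).mul hφ''.continuous.aestronglyMeasurable) ?_ (fun n => ?_) ?_
      · exact (hφ''.continuous.integrable_of_hasCompactSupport hφc.deriv.deriv).norm.const_mul B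
      · filter_upwards [hall] with x hx
        rw [norm_mul]
        exact mul_le_mul_of_nonneg_right (hx _) (norm_nonneg _)
      · filter_upwards [hconv] with x hx
        exact hx.mul_const _
    refine tendsto_nhds_unique l1 ?_
    have := l3.neg.add l2
    refine this.congr fun n => ?_
    exact (opA_weak (hmem (ns n)) hφ hφc).symm

/-- It suffices to solve the equation for continuous right-hand sides of compact support. -/
theorem exists_isSol_of_dense (hh : CostHyp h) (hf : ContDiff ℝ 1 f) (hΛ : ∀ x, |deriv f x| ≤ Λ)
    (hCf : ∀ x, |f x| ≤ Cf) (hσ : Continuous σ) (hCσ : ∀ x, |σ x| ≤ Cσ)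
    {lam : ℝ} (hlam : Λ < lam)
    (hex : ∀ (g : ℝ → ℝ) (hg : Integrable g volume), Continuous g → HasCompactSupport g →
      ∃ y, IsSol h f σ lam hg.toL1 y) (η : L1) : ∃ y, IsSol h f σ lam η y := by
  have hseq : ∀ n : ℕ, ∃ g : ℝ → ℝ, ∃ hg : Integrable g volume, Continuous g ∧
      HasCompactSupport g ∧ ‖η - hg.toL1‖ ≤ 1 / ((n : ℝ) + 1) := by
    intro n
    obtain ⟨g, hgc, hgd, hg, hgi⟩ :=
      (L1.integrable_coeFn η).exists_hasCompactSupport_integral_sub_le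
        (ε := 1 / ((n : ℝ) + 1)) Nat.one_div_pos_of_nat
    refine ⟨g, hgi, hg, hgc, ?_⟩
    rw [L1.norm_eq_integral_norm]
    refine le_trans (le_of_eq (integral_congr_ae ?_)) hgd
    filter_upwards [Lp.coeFn_sub η hgi.toL1, hgi.coeFn_toL1] with x h1 h2
    rw [h1, Pi.sub_apply, h2]
  choose g hgi hgcont hgc hgn using hseq
  set ηn : ℕ → L1 := fun n => (hgi n).toL1 with hηn
  have hη : Tendsto ηn atTop (𝓝 η) := by
    rw [tendsto_iff_norm_sub_tendsto_zero]
    refine squeeze_zero (fun _ => norm_nonneg _) (fun n => ?_)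
      (tendsto_one_div_add_atTop_nhds_zero_nat (𝕜 := ℝ))
    rw [norm_sub_rev]; exact hgn n
  choose yn hyn using fun n => hex (g n) (hgi n) (hgcont n) (hgc n)
  have hcau : CauchySeq yn := by
    have h0 : 0 ≤ (lam - Λ)⁻¹ := inv_nonneg.2 (by linarith)
    have h1 : ∀ m n, dist (yn m) (yn n) ≤ (lam - Λ)⁻¹ * dist (ηn m) (ηn n) := fun m n => by
      rw [dist_eq_norm, dist_eq_norm]
      exact norm_sub_le_of_isSol hh hf hΛ hCf hlam (hyn m) (hyn n)
    have h2 := hη.cauchySeq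
    rw [cauchySeq_iff_tendsto_dist_atTop_0] at h2 ⊢
    refine squeeze_zero (fun _ => dist_nonneg) (fun p => h1 p.1 p.2) ?_
    simpa using h2.const_mul (lam - Λ)⁻¹
  obtain ⟨y, hy⟩ := cauchySeq_tendsto_of_complete hcau
  choose vn hvn hvn' using hyn
  have hv : Tendsto vn atTop (𝓝 (η - lam • y)) := by
    have : vn = fun n => ηn n - lam • yn n := by
      funext n; rw [hηn]; simp only [← hvn' n]; abel
    rw [this]
    exact hη.sub (hy.const_smul lam)
  exact ⟨y, _, opA_closed hh hf hΛ hCf hσ hCσ hvn hy hv, by abel⟩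

end closed

/-! ### The regularized boundary value problem on a bounded interval -/

/-- The boundary value problem `F' = m P(z) - η`, `z' = F - k P(z)`, `z (±R) = 0`. -/
structure IsBVP (P m k η : ℝ → ℝ) (R : ℝ) (F z : ℝ → ℝ) : Prop where
  contF : Continuous F
  contz : Continuous z
  derivF : ∀ x ∈ Ioo (-R) R, HasDerivAt F (m x * P (z x) - η x) x
  derivz : ∀ x ∈ Ioo (-R) R, HasDerivAt z (F x - k x * P (z x)) x
  left : z (-R) = 0
  right : z R = 0

theorem integral_eq_sub_of_Ioo {F G : ℝ → ℝ} {R a b : ℝ} (hF : Continuous F) (hG : Continuous G)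
    (h : ∀ x ∈ Ioo (-R) R, HasDerivAt F (G x) x) (ha : a ∈ Icc (-R) R) (hb : b ∈ Icc (-R) R) :
    F b - F a = ∫ x in a..b, G x := by
  have key : ∀ a b, a ∈ Icc (-R) R → b ∈ Icc (-R) R → a ≤ b → ∫ x in a..b, G x = F b - F a :=
    fun a b ha hb hab => intervalIntegral.integral_eq_sub_of_hasDerivAt_of_le hab hF.continuousOn
      (fun x hx => h x ⟨ha.1.trans_lt hx.1, hx.2.trans_le hb.2⟩) (hG.intervalIntegrable _ _)
  rcases le_total a b with hab | hab
  · exact (key a b ha hb hab).symm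
  · rw [intervalIntegral.integral_symm, key b a hb ha hab]; ring

theorem exists_bound_Icc {g : ℝ → ℝ} (hg : Continuous g) (R : ℝ) :
    ∃ C, 0 ≤ C ∧ ∀ x ∈ Icc (-R) R, |g x| ≤ C := by
  obtain ⟨C, hC⟩ := (isCompact_Icc (a := -R) (b := R)).exists_bound_of_continuousOn hg.continuousOn
  exact ⟨max C 0, le_max_right _ _, fun x hx => (hC x hx).trans (le_max_left _ _)⟩

/-- Shooting: start from F(-R) = s, z(-R) = 0. As `P` is bounded, z(R) is 2Rs up to an error
independent of s, so it changes sign between s = -S and s = S; continuous dependence on s and the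
intermediate value theorem finish. -/
theorem exists_isBVP {P m k η : ℝ → ℝ} {K : NNReal} {B R : ℝ} (hP : LipschitzWith K P)
    (hPB : ∀ t, |P t| ≤ B) (hm : Continuous m) (hk : Continuous k) (hη : Continuous η)
    (hR : 0 < R) : ∃ F z, IsBVP P m k η R F z := by
  obtain ⟨Cm, hCm0, hCm⟩ := exists_bound_Icc hm R
  obtain ⟨Ck, hCk0, hCk⟩ := exists_bound_Icc hk R
  obtain ⟨Cη, hCη0, hCη⟩ := exists_bound_Icc hη R
  have hB0 : 0 ≤ B := (abs_nonneg _).trans (hPB 0)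
  set C₁ : ℝ := Cm * B + Cη + 1 with hC₁
  set C₂ : ℝ := Ck * B with hC₂
  have hC₁0 : 0 < C₁ := by positivity
  have hC₂0 : 0 ≤ C₂ := by positivity
  have b₁ : ∀ t ∈ Icc (-R) R, ∀ u, |m t * P u - η t| ≤ C₁ := fun t ht u => by
    have h1 : |m t * P u| ≤ Cm * B := by
      rw [abs_mul]; exact mul_le_mul (hCm t ht) (hPB u) (abs_nonneg _) hCm0
    have := abs_sub (m t * P u) (η t)
    linarith [hCη t ht]
  have b₂ : ∀ t ∈ Icc (-R) R, ∀ u, |k t * P u| ≤ C₂ := fun t ht u => by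
    rw [abs_mul]; exact mul_le_mul (hCk t ht) (hPB u) (abs_nonneg _) hCk0
  -- `S` is just above the error of z(R)/(2R) relative to s; `a` is the radius that trajectories
  -- starting within `S` cannot leave in time 2R at speed `C₁`.
  set S : ℝ := C₁ * (2 * R) + C₂ + 1 with hS
  have hS0 : 0 < S := by positivity
  set a : ℝ := S + C₁ * (2 * R) with ha
  have ha0 : 0 < a := by positivity
  -- The speed of z grows with `a`, which would make the choice of `a` circular. The second unknown
  -- is therefore μ z, with μ such that its speed on the ball is at most `C₁` as well.
  set μ : ℝ := C₁ / (a + C₂) with hμ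
  have hμ0 : 0 < μ := by positivity
  let v : ℝ → ℝ × ℝ → ℝ × ℝ := fun t p =>
    (m t * P (p.2 / μ) - η t, μ * (p.1 - k t * P (p.2 / μ)))
  have hPμ : ∀ x y : ℝ, |P (x / μ) - P (y / μ)| ≤ K / μ * |x - y| := fun x y => by
    have := hP.dist_le_mul (x / μ) (y / μ)
    rw [Real.dist_eq, Real.dist_eq, ← sub_div, abs_div, abs_of_pos hμ0] at this
    refine this.trans (le_of_eq ?_)
    ring
  have hK0 : (0 : ℝ) ≤ K / μ := div_nonneg K.2 hμ0.le
  set L : ℝ := Cm * (K / μ) + μ * (1 + Ck * (K / μ)) with hL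
  have hL0 : 0 ≤ L := by positivity
  have hPL : IsPicardLindelof v (tmin := -R) (tmax := R) ⟨-R, by constructor <;> linarith⟩
      ((0 : ℝ), (0 : ℝ)) (Real.toNNReal a) (Real.toNNReal S) (Real.toNNReal C₁)
      (Real.toNNReal L) := by
    refine ⟨fun t ht => ?_, fun p _ => ?_, fun t ht p hp => ?_, ?_⟩
    · refine (LipschitzWith.of_dist_le_mul fun p q => ?_).lipschitzOnWith
      rw [Real.coe_toNNReal _ hL0]
      have hd1 : |p.1 - q.1| ≤ dist p q := by
        rw [← Real.dist_eq]; exact le_max_left _ _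
      have hd2 : |p.2 - q.2| ≤ dist p q := by
        rw [← Real.dist_eq]; exact le_max_right _ _
      have hd : 0 ≤ dist p q := dist_nonneg
      have h3 : |P (p.2 / μ) - P (q.2 / μ)| ≤ K / μ * dist p q :=
        (hPμ _ _).trans (mul_le_mul_of_nonneg_left hd2 hK0)
      refine max_le ?_ ?_
      · rw [Real.dist_eq]
        have e : m t * P (p.2 / μ) - η t - (m t * P (q.2 / μ) - η t) =
          m t * (P (p.2 / μ) - P (q.2 / μ)) := by ring
        simp only [v]
        rw [e, abs_mul]
        have h4 := mul_le_mul (hCm t ht) h3 (abs_nonneg _) hCm0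
        have h5 : 0 ≤ μ * (1 + Ck * (K / μ)) * dist p q := by positivity
        rw [hL, add_mul]
        linarith
      · rw [Real.dist_eq]
        have e : μ * (p.1 - k t * P (p.2 / μ)) - μ * (q.1 - k t * P (q.2 / μ)) =
          μ * ((p.1 - q.1) - k t * (P (p.2 / μ) - P (q.2 / μ))) := by ring
        simp only [v]
        rw [e, abs_mul, abs_of_pos hμ0]
        have h4 := mul_le_mul (hCk t ht) h3 (abs_nonneg _) hCk0
        have h5 := abs_sub (p.1 - q.1) (k t * (P (p.2 / μ) - P (q.2 / μ)))
        rw [abs_mul] at h5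
        have h6 : |(p.1 - q.1) - k t * (P (p.2 / μ) - P (q.2 / μ))| ≤
            (1 + Ck * (K / μ)) * dist p q := by
          rw [add_mul, one_mul, mul_assoc]; linarith
        have h7 := mul_le_mul_of_nonneg_left h6 hμ0.le
        have h8 : 0 ≤ Cm * (K / μ) * dist p q := by positivity
        rw [hL, add_mul]
        linarith
    · refine Continuous.continuousOn ?_
      exact ((hm.mul continuous_const).sub hη).prodMk
        (continuous_const.mul (continuous_const.sub (hk.mul continuous_const)))
    · rw [Real.coe_toNNReal _ hC₁0.le]
      rw [Real.coe_toNNReal _ ha0.le, mem_closedBall_iff_norm] at hp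
      have hp1 : |p.1| ≤ a := by simpa using (norm_fst_le (p - ((0 : ℝ), (0 : ℝ)))).trans hp
      refine max_le (b₁ t ht _) ?_
      simp only [v, Real.norm_eq_abs]
      rw [abs_mul, abs_of_pos hμ0]
      have h1 : |p.1 - k t * P (p.2 / μ)| ≤ a + C₂ :=
        (abs_sub _ _).trans (add_le_add hp1 (b₂ t ht _))
      calc μ * |p.1 - k t * P (p.2 / μ)| ≤ μ * (a + C₂) := mul_le_mul_of_nonneg_left h1 hμ0.le
        _ = C₁ := by rw [hμ]; field_simp
    · rw [Real.coe_toNNReal _ hC₁0.le, Real.coe_toNNReal _ ha0.le, Real.coe_toNNReal _ hS0.le]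
      simp only [sub_neg_eq_add, sub_self]
      rw [max_eq_left (by linarith), ha]
      linarith
  obtain ⟨α, hα, L', hαL⟩ := hPL.exists_forall_mem_closedBall_eq_hasDerivWithinAt_lipschitzOnWith
  rw [Real.coe_toNNReal _ hS0.le] at hα hαL
  have hball : ∀ s ∈ Icc (-S) S, (s, (0 : ℝ)) ∈ Metric.closedBall ((0 : ℝ), (0 : ℝ)) S := by
    intro s hs
    rw [mem_closedBall_iff_norm, Prod.norm_def]
    simp [abs_le, hs.1, hs.2]
  have hRm : -R ∈ Icc (-R) R := ⟨le_rfl, by linarith⟩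
  have hRp : R ∈ Icc (-R) R := ⟨by linarith, le_rfl⟩
  -- continuous extension of the trajectories
  obtain ⟨ext, hext, hextc⟩ : ∃ ext : (ℝ → ℝ) → ℝ → ℝ, (∀ g, ∀ x ∈ Icc (-R) R, ext g x = g x) ∧
      ∀ g, ContinuousOn g (Icc (-R) R) → Continuous (ext g) :=
    ⟨fun g => IccExtend (show -R ≤ R by linarith) (fun x => g x),
      fun g x hx => IccExtend_of_mem _ _ hx,
      fun g hg => (continuousOn_iff_continuous_domRestrict.1 hg).Icc_extend'⟩
  have hsol : ∀ s ∈ Icc (-S) S, ∃ F z, Continuous F ∧ Continuous z ∧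
      (∀ x ∈ Ioo (-R) R, HasDerivAt F (m x * P (z x) - η x) x) ∧
      (∀ x ∈ Ioo (-R) R, HasDerivAt z (F x - k x * P (z x)) x) ∧ F (-R) = s ∧ z (-R) = 0 ∧
      z R = (α (s, 0) R).2 / μ := by
    intro s hs
    obtain ⟨h0, hd⟩ := hα _ (hball s hs)
    have hcont : ContinuousOn (α (s, 0)) (Icc (-R) R) := fun x hx => (hd x hx).continuousWithinAt
    have hd' : ∀ x ∈ Ioo (-R) R, HasDerivAt (α (s, 0)) (v x (α (s, 0) x)) x := fun x hx =>
      (hd x (Ioo_subset_Icc_self hx)).hasDerivAt (Icc_mem_nhds hx.1 hx.2)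
    have hev : ∀ g : ℝ → ℝ, ∀ x ∈ Ioo (-R) R, ext g =ᶠ[𝓝 x] g := fun g x hx => by
      filter_upwards [Icc_mem_nhds hx.1 hx.2] with y hy using hext g y hy
    refine ⟨ext fun x => (α (s, 0) x).1, ext fun x => (α (s, 0) x).2 / μ, ?_, ?_, ?_, ?_, ?_, ?_,
      ?_⟩
    · exact hextc _ hcont.fst
    · exact hextc _ (hcont.snd.div_const μ)
    · intro x hx
      rw [hext _ x (Ioo_subset_Icc_self hx)]
      have h1 : HasDerivAt (fun y => (α (s, 0) y).1) (v x (α (s, 0) x)).1 x :=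
        (ContinuousLinearMap.fst ℝ ℝ ℝ).hasFDerivAt.comp_hasDerivAt x (hd' x hx)
      exact h1.congr_of_eventuallyEq (hev _ x hx)
    · intro x hx
      rw [hext _ x (Ioo_subset_Icc_self hx), hext _ x (Ioo_subset_Icc_self hx)]
      refine HasDerivAt.congr_of_eventuallyEq ?_ (hev _ x hx)
      have h1 : HasDerivAt (fun y => (α (s, 0) y).2) (v x (α (s, 0) x)).2 x :=
        (ContinuousLinearMap.snd ℝ ℝ ℝ).hasFDerivAt.comp_hasDerivAt x (hd' x hx)
      have := h1.div_const μ
      simp only [v] at this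
      rwa [mul_div_cancel_left₀ _ hμ0.ne'] at this
    · rw [hext _ _ hRm]
      exact congrArg Prod.fst h0
    · rw [hext _ _ hRm]
      have : (α (s, 0) (-R)).2 = 0 := congrArg Prod.snd h0
      rw [this, zero_div]
    · rw [hext _ _ hRp]
  -- the sign of the end value
  have hend : ∀ s ∈ Icc (-S) S,
      |(α (s, 0) R).2 / μ - 2 * R * s| ≤ (C₁ * (2 * R) + C₂) * (2 * R) := by
    intro s hs
    obtain ⟨F, z, hFc, hzc, hF, hz, hF0, hz0, hzR⟩ := hsol s hs
    have hPz : Continuous fun x => P (z x) := hP.continuous.comp hzc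
    have h1 : ∀ x ∈ Icc (-R) R, |F x - s| ≤ C₁ * (2 * R) := by
      intro x hx
      have h2 := integral_eq_sub_of_Ioo hFc ((hm.mul hPz).sub hη) hF hRm hx
      rw [← hF0, h2]
      have h3 := intervalIntegral.norm_integral_le_of_norm_le_const (a := -R) (b := x)
        (f := fun x => m x * P (z x) - η x) (C := C₁) fun u hu => by
          rw [uIoc_of_le hx.1] at hu
          exact b₁ u ⟨hu.1.le, hu.2.trans hx.2⟩ _
      refine h3.trans (mul_le_mul_of_nonneg_left ?_ hC₁0.le)
      rw [abs_of_nonneg (by linarith [hx.1])]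
      linarith [hx.2]
    have h2 : z R - z (-R) = ∫ x in (-R)..R, (F x - k x * P (z x)) :=
      integral_eq_sub_of_Ioo hzc (hFc.sub (hk.mul hPz)) hz hRm hRp
    rw [hz0, sub_zero, hzR] at h2
    have h3 : (α (s, 0) R).2 / μ - 2 * R * s = ∫ x in (-R)..R, (F x - k x * P (z x) - s) := by
      rw [intervalIntegral.integral_sub ((hFc.fun_sub (hk.fun_mul hPz)).intervalIntegrable _ _)
        intervalIntegrable_const, intervalIntegral.integral_const, h2, smul_eq_mul]
      ring
    rw [h3]
    have h4 := intervalIntegral.norm_integral_le_of_norm_le_const (a := -R) (b := R)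
        (f := fun x => F x - k x * P (z x) - s) (C := C₁ * (2 * R) + C₂) fun u hu => by
          rw [uIoc_of_le (by linarith)] at hu
          have hu' : u ∈ Icc (-R) R := ⟨hu.1.le, hu.2⟩
          have e : F u - k u * P (z u) - s = (F u - s) - k u * P (z u) := by ring
          rw [e]
          exact (abs_sub _ _).trans (add_le_add (h1 u hu') (b₂ u hu' _))
    have h5 : |R - -R| = 2 * R := by rw [abs_of_pos (by linarith)]; ring
    rwa [h5] at h4
  have hSm : -S ∈ Icc (-S) S := ⟨le_rfl, by linarith⟩
  have hSp : S ∈ Icc (-S) S := ⟨by linarith, le_rfl⟩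
  have hcont : ContinuousOn (fun s => (α (s, 0) R).2 / μ) (Icc (-S) S) := by
    have h1 : ContinuousOn (fun s : ℝ => α (s, 0) R) (Icc (-S) S) :=
      (hαL R hRp).continuousOn.comp (Continuous.continuousOn (by fun_prop)) hball
    exact h1.snd.div_const μ
  have hlo : (α (-S, 0) R).2 / μ ≤ 0 := by
    have := le_of_abs_le (hend _ hSm)
    nlinarith
  have hhi : 0 ≤ (α (S, 0) R).2 / μ := by
    have := neg_le_of_abs_le (hend _ hSp)
    nlinarith
  obtain ⟨s, hs, hs0⟩ := intermediate_value_Icc (show -S ≤ S by linarith) hcont ⟨hlo, hhi⟩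
  obtain ⟨F, z, hFc, hzc, hF, hz, -, hz0, hzR⟩ := hsol s hs
  exact ⟨F, z, hFc, hzc, hF, hz, hz0, hzR.trans hs0⟩

namespace IsBVP

variable {P m k η F z : ℝ → ℝ} {R : ℝ}

theorem neg (h : IsBVP P m k η R F z) :
    IsBVP (fun t => -P (-t)) m k (fun x => -η x) R (fun x => -F x) (fun x => -z x) where
  contF := h.contF.neg
  contz := h.contz.neg
  derivF := fun x hx => by
    refine (h.derivF x hx).fun_neg.congr_deriv ?_
    rw [neg_neg]; ring
  derivz := fun x hx => by
    refine (h.derivz x hx).fun_neg.congr_deriv ?_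
    rw [neg_neg]; ring
  left := by rw [h.left, neg_zero]
  right := by rw [h.right, neg_zero]

/-- The maximum principle. -/
theorem le_of_coeff {K : NNReal} {Ck c B : ℝ} (h : IsBVP P m k η R F z)
    (hP : LipschitzWith K P) (hPm : Monotone P) (hP0 : P 0 = 0) (hk : Differentiable ℝ k)
    (hCk : ∀ x, |k x| ≤ Ck) (hc : 0 < c) (hmk : ∀ x, c ≤ m x - deriv k x) (hB : 0 ≤ B)
    (hη : ∀ x, η x ≤ c * B) {x : ℝ} (hx : x ∈ Icc (-R) R) : P (z x) ≤ B := by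
  by_contra hn
  push Not at hn
  obtain ⟨x₀, hx₀, hmax⟩ := isCompact_Icc.exists_isMaxOn ⟨x, hx⟩ h.contz.continuousOn
  set q := P (z x₀) with hq
  have hqB : B < q := hn.trans_le (hPm (hmax hx))
  have hz0 : 0 < z x₀ := by
    by_contra hneg
    have := hPm (not_lt.1 hneg)
    rw [hP0] at this
    linarith
  have hxI : x₀ ∈ Ioo (-R) R := by
    refine ⟨lt_of_le_of_ne hx₀.1 fun he => ?_, lt_of_le_of_ne hx₀.2 fun he => ?_⟩
    · rw [← he, h.left] at hz0; exact lt_irrefl _ hz0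
    · rw [he, h.right] at hz0; exact lt_irrefl _ hz0
  have hF0 : F x₀ - k x₀ * q = 0 :=
    (hmax.isLocalMax (Icc_mem_nhds hxI.1 hxI.2)).hasDerivAt_eq_zero (h.derivz x₀ hxI)
  -- With q frozen at its value at the maximum, F - k q vanishes at x₀ and has derivative (m - k') q
  -- - η ≥ c q - c B > 0 there, so it is positive just to the right.
  have hD : HasDerivAt (fun x => F x - k x * q) (m x₀ * q - η x₀ - deriv k x₀ * q) x₀ :=
    (h.derivF x₀ hxI).sub ((hk x₀).hasDerivAt.mul_const q)
  have hDpos : 0 < m x₀ * q - η x₀ - deriv k x₀ * q := by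
    have h1 := mul_le_mul_of_nonneg_right (hmk x₀) (hB.trans hqB.le)
    have h2 := mul_lt_mul_of_pos_left hqB hc
    have h3 := hη x₀
    linarith
  have hev : ∀ᶠ y in 𝓝[>] x₀, 0 < F y - k y * q := by
    have h1 := (hasDerivAt_iff_tendsto_slope.1 hD).mono_left
      (nhdsWithin_mono x₀ (fun y (hy : y ∈ Ioi x₀) => ne_of_gt hy) : 𝓝[>] x₀ ≤ 𝓝[≠] x₀)
    filter_upwards [h1.eventually (lt_mem_nhds hDpos), self_mem_nhdsWithin] with y hy1 hy2
    have hy2 : x₀ < y := hy2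
    rw [slope_def_field, hF0, sub_zero] at hy1
    exact (div_pos_iff_of_pos_right (sub_pos.2 hy2)).1 hy1
  obtain ⟨d, hd, hdI⟩ := mem_nhdsGT_iff_exists_Ioc_subset.1 (hev.and (Ioo_mem_nhdsGT hxI.2))
  have hd : x₀ < d := hd
  set C : ℝ := Ck * K with hC
  have hCk0 : 0 ≤ Ck := (abs_nonneg _).trans (hCk 0)
  -- Gronwall argument: z' = (F - k q) + k (q - P(z)) > -C (z x₀ - z), so the weighted gap decreases
  -- strictly from 0 and z exceeds its maximum.
  have hanti : StrictAntiOn (fun y => (z x₀ - z y) * Real.exp (-(C * y))) (Icc x₀ d) := by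
    have hexp : ∀ y, HasDerivAt (fun y => Real.exp (-(C * y))) (Real.exp (-(C * y)) * (-C)) y :=
      fun y => by
        have := ((hasDerivAt_id y).const_mul C).neg.exp
        simpa using this
    refine strictAntiOn_of_hasDerivWithinAt_neg (convex_Icc _ _)
      (f' := fun y => (-(F y - k y * P (z y))) * Real.exp (-(C * y)) +
        (z x₀ - z y) * (Real.exp (-(C * y)) * (-C))) ?_ ?_ ?_
    · exact ((continuous_const.sub h.contz).mul (by fun_prop)).continuousOn
    · intro y hy
      rw [interior_Icc] at hy
      have hyI := (hdI (Ioo_subset_Ioc_self hy)).2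
      exact (((h.derivz y ⟨hxI.1.trans hyI.1, hyI.2⟩).const_sub (z x₀)).mul
        (hexp y)).hasDerivWithinAt
    · intro y hy
      rw [interior_Icc] at hy
      have hyI := hdI (Ioo_subset_Ioc_self hy)
      have h1 : 0 < F y - k y * q := hyI.1
      have h2 : z y ≤ z x₀ := hmax ⟨(hxI.1.trans hyI.2.1).le, hyI.2.2.le⟩
      have h3 : |q - P (z y)| ≤ K * (z x₀ - z y) := by
        have := hP.dist_le_mul (z x₀) (z y)
        rwa [Real.dist_eq, Real.dist_eq, abs_of_nonneg (sub_nonneg.2 h2)] at this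
      have h4 : |k y * (q - P (z y))| ≤ Ck * (K * (z x₀ - z y)) := by
        rw [abs_mul]; exact mul_le_mul (hCk y) h3 (abs_nonneg _) hCk0
      have h5 := neg_le_of_abs_le h4
      have h6 : (-(F y - k y * P (z y))) * Real.exp (-(C * y)) +
        (z x₀ - z y) * (Real.exp (-(C * y)) * (-C)) =
        (-(F y - k y * q) - k y * (q - P (z y)) - C * (z x₀ - z y)) * Real.exp (-(C * y)) := by
          ring
      rw [h6]
      refine mul_neg_of_neg_of_pos ?_ (Real.exp_pos _)
      rw [hC]
      linarith
  have h1 := hanti ⟨le_rfl, hd.le⟩ ⟨hd.le, le_rfl⟩ hd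
  have h2 : z d ≤ z x₀ := by
    have := (hdI ⟨hd, le_rfl⟩).2
    exact hmax ⟨(hxI.1.trans this.1).le, this.2.le⟩
  simp only [sub_self, zero_mul] at h1
  nlinarith [Real.exp_pos (-(C * d))]

theorem abs_le_of_coeff {K : NNReal} {Ck c B : ℝ} (h : IsBVP P m k η R F z)
    (hP : LipschitzWith K P) (hPm : Monotone P) (hP0 : P 0 = 0) (hk : Differentiable ℝ k)
    (hCk : ∀ x, |k x| ≤ Ck) (hc : 0 < c) (hmk : ∀ x, c ≤ m x - deriv k x) (hB : 0 ≤ B)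
    (hη : ∀ x, |η x| ≤ c * B) {x : ℝ} (hx : x ∈ Icc (-R) R) : |P (z x)| ≤ B := by
  have h1 := h.le_of_coeff hP hPm hP0 hk hCk hc hmk hB (fun x => (le_abs_self _).trans (hη x)) hx
  have hP' : LipschitzWith K fun t => -P (-t) := by
    refine LipschitzWith.of_dist_le_mul fun s t => ?_
    have := hP.dist_le_mul (-s) (-t)
    rw [dist_neg_neg] at this ⊢
    exact this
  have h2 := h.neg.le_of_coeff hP' (fun s t hst => neg_le_neg (hPm (neg_le_neg hst)))
    (by simp [hP0]) hk hCk hc hmk hB (fun x => (neg_le_abs _).trans (hη x)) hx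
  rw [neg_neg] at h2
  rw [abs_le]
  constructor <;> linarith

/-- The `L¹` estimate. -/
theorem integral_abs_le {K : NNReal} (h : IsBVP P m k η R F z) (hR : 0 < R)
    (hP : LipschitzWith K P) (hPm : Monotone P) (hP0 : P 0 = 0) (hm : Continuous m)
    (hk : Continuous k) (hη : Continuous η) :
    ∫ x in (-R)..R, m x * |P (z x)| ≤ ∫ x in (-R)..R, |η x| := by
  have hPz : Continuous fun x => P (z x) := hP.continuous.comp h.contz
  have hFc := h.contF
  have hzc := h.contz
  obtain ⟨C, hC0, hC⟩ := exists_bound_Icc (hk.mul hFc) R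
  have hPK : ∀ t, |P t| ≤ K * |t| := fun t => by
    have := hP.dist_le_mul t 0
    rwa [hP0, Real.dist_eq, Real.dist_eq, sub_zero, sub_zero] at this
  set u : ℝ → ℝ := fun x => m x * P (z x) - η x with hu
  have huc : Continuous u := (hm.mul hPz).sub hη
  -- The equation for F' is tested with arctan(n z), a smooth multiple of the sign of z that
  -- vanishes at ±R. `E` bounds the bad part of the integrated-by-parts term: z' F = F² - k F P(z) ≥
  -- -C K |z|, and n|z|/(1 + n² z²) is at most 1 and tends to 0.
  let A : ℕ → ℝ → ℝ := fun n x => Real.arctan (n * z x) * u x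
  let E : ℕ → ℝ → ℝ := fun n x => (C * K) * (n * |z x| / (1 + (n * z x) ^ 2))
  have hAc : ∀ n, Continuous (A n) := fun n =>
    (Real.continuous_arctan.comp (continuous_const.mul hzc)).mul huc
  have hpos : ∀ (n : ℕ) x, 0 < 1 + ((n : ℝ) * z x) ^ 2 := fun n x => by positivity
  have hEc : ∀ n, Continuous (E n) := fun n =>
    continuous_const.mul ((continuous_const.mul hzc.abs).div₀ (by fun_prop)
      fun x => (hpos n x).ne')
  have hle : ∀ n, ∫ x in (-R)..R, A n x ≤ ∫ x in (-R)..R, E n x := by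
    intro n
    let D : ℝ → ℝ := fun x => 1 / (1 + (n * z x) ^ 2) * (n * (F x - k x * P (z x))) * F x
    have hDc : Continuous D :=
      ((continuous_const.div₀ (by fun_prop) fun x => (hpos n x).ne').mul
        (continuous_const.mul (hFc.sub (hk.mul hPz)))).mul hFc
    have h1 := integral_eq_sub_of_Ioo (F := fun x => Real.arctan (n * z x) * F x)
      (G := fun x => D x + A n x) (R := R) (a := -R) (b := R)
      ((Real.continuous_arctan.comp (continuous_const.mul hzc)).mul hFc) (hDc.add (hAc n))
      (fun x hx => ((h.derivz x hx).const_mul (n : ℝ)).arctan.mul (h.derivF x hx))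
      ⟨le_rfl, by linarith⟩ ⟨by linarith, le_rfl⟩
    rw [h.left, h.right, mul_zero, Real.arctan_zero, zero_mul, zero_mul, sub_zero,
      intervalIntegral.integral_add (hDc.intervalIntegrable _ _)
      ((hAc n).intervalIntegrable _ _)] at h1
    have h2 : ∫ x in (-R)..R, -E n x ≤ ∫ x in (-R)..R, D x := by
      refine intervalIntegral.integral_mono_on (by linarith)
        ((hEc n).neg.intervalIntegrable _ _) (hDc.intervalIntegrable _ _) fun x hx => ?_
      have h3 : |(k x * F x) * P (z x)| ≤ C * (K * |z x|) := by
        rw [abs_mul]; exact mul_le_mul (hC x hx) (hPK _) (abs_nonneg _) hC0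
      have h4 : D x = (n / (1 + (n * z x) ^ 2)) * (F x ^ 2 - (k x * F x) * P (z x)) := by
        simp only [D]; field_simp
      have h5 : -E n x = (n / (1 + (n * z x) ^ 2)) * (-(C * (K * |z x|))) := by
        simp only [E]; field_simp
      rw [h4, h5]
      refine mul_le_mul_of_nonneg_left ?_ (div_nonneg (Nat.cast_nonneg n) (hpos n x).le)
      linarith [sq_nonneg (F x), le_of_abs_le h3]
    rw [intervalIntegral.integral_neg] at h2
    linarith
  have hAlim : Tendsto (fun n => ∫ x in (-R)..R, A n x) atTop
      (𝓝 (∫ x in (-R)..R, (Real.pi / 2 * SignType.sign (z x)) * u x)) := by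
    refine intervalIntegral.tendsto_integral_filter_of_dominated_convergence
      (fun x => Real.pi / 2 * |u x|) (Eventually.of_forall fun n =>
        (hAc n).aestronglyMeasurable) (Eventually.of_forall fun n => ae_of_all _ fun x _ => ?_)
      ((continuous_const.mul huc.abs).intervalIntegrable _ _) (ae_of_all _ fun x _ => ?_)
    · simp only [A, norm_mul, Real.norm_eq_abs]
      refine mul_le_mul_of_nonneg_right ?_ (abs_nonneg _)
      rw [abs_le]
      exact ⟨(Real.neg_pi_div_two_lt_arctan _).le, (Real.arctan_lt_pi_div_two _).le⟩
    · refine Tendsto.mul_const _ ?_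
      rcases lt_trichotomy (z x) 0 with hz | hz | hz
      · rw [sign_neg hz]
        have h1 : Tendsto (fun n : ℕ => (n : ℝ) * z x) atTop atBot :=
          tendsto_natCast_atTop_atTop.atTop_mul_const_of_neg hz
        have h2 := (Real.tendsto_arctan_atBot.mono_right nhdsWithin_le_nhds).comp h1
        simpa [Function.comp_def] using h2
      · simp [hz]
      · rw [sign_pos hz]
        have h1 : Tendsto (fun n : ℕ => (n : ℝ) * z x) atTop atTop :=
          tendsto_natCast_atTop_atTop.atTop_mul_const hz
        have h2 := (Real.tendsto_arctan_atTop.mono_right nhdsWithin_le_nhds).comp h1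
        simpa [Function.comp_def] using h2
  have hElim : Tendsto (fun n => ∫ x in (-R)..R, E n x) atTop (𝓝 0) := by
    have h0 : ∫ _ in (-R)..R, (0 : ℝ) = 0 := intervalIntegral.integral_zero
    rw [← h0]
    refine intervalIntegral.tendsto_integral_filter_of_dominated_convergence
      (fun _ => C * K) (Eventually.of_forall fun n =>
        (hEc n).aestronglyMeasurable) (Eventually.of_forall fun n => ae_of_all _ fun x _ => ?_)
      intervalIntegrable_const (ae_of_all _ fun x _ => ?_)
    · have h1 : (n : ℝ) * |z x| / (1 + (n * z x) ^ 2) ≤ 1 := by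
        rw [div_le_one (hpos n x)]
        have : (n * z x) ^ 2 = (n * |z x|) ^ 2 := by rw [mul_pow, mul_pow, sq_abs]
        rw [this]
        nlinarith [sq_nonneg ((n : ℝ) * |z x| - 1)]
      have h2 : 0 ≤ (n : ℝ) * |z x| / (1 + (n * z x) ^ 2) :=
        div_nonneg (by positivity) (hpos n x).le
      have h3 : 0 ≤ C * K := mul_nonneg hC0 K.2
      simp only [E]
      rw [Real.norm_of_nonneg (mul_nonneg h3 h2)]
      exact mul_le_of_le_one_right h3 h1
    · rw [← mul_zero (C * (K : ℝ))]
      refine Tendsto.const_mul _ ?_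
      rcases eq_or_ne (z x) 0 with hz | hz
      · simp [hz]
      · have hz' : 0 < |z x| := abs_pos.2 hz
        refine squeeze_zero' (Eventually.of_forall fun n => div_nonneg (by positivity)
          (hpos n x).le) (g := fun n : ℕ => 1 / ((n : ℝ) * |z x|)) ?_ ?_
        · filter_upwards [eventually_gt_atTop 0] with n hn
          have hn' : (0 : ℝ) < n := by exact_mod_cast hn
          rw [div_le_div_iff₀ (hpos n x) (by positivity)]
          have : (n * z x) ^ 2 = (n * |z x|) ^ 2 := by rw [mul_pow, mul_pow, sq_abs]
          rw [this]; nlinarith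
        · have h1 : Tendsto (fun n : ℕ => (n : ℝ) * |z x|) atTop atTop :=
            tendsto_natCast_atTop_atTop.atTop_mul_const hz'
          exact tendsto_const_nhds.div_atTop h1
  have hfin := le_of_tendsto_of_tendsto' hAlim hElim hle
  have hsg : ∀ x, (SignType.sign (z x) : ℝ) * P (z x) = |P (z x)| := by
    intro x
    rcases lt_trichotomy (z x) 0 with hz | hz | hz
    · have : P (z x) ≤ 0 := hP0 ▸ hPm hz.le
      rw [sign_neg hz, abs_of_nonpos this]; simp
    · simp [hz, hP0]
    · have : 0 ≤ P (z x) := hP0 ▸ hPm hz.le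
      rw [sign_pos hz, abs_of_nonneg this]; simp
  have hmi : Continuous fun x => m x * |P (z x)| := hm.mul hPz.abs
  have h1 : ∫ x in (-R)..R, (m x * |P (z x)| - |η x|) ≤
      ∫ x in (-R)..R, (SignType.sign (z x) : ℝ) * u x := by
    have hsm : Measurable fun x => (SignType.sign (z x) : ℝ) := by
      have : (fun x => (SignType.sign (z x) : ℝ)) = fun x =>
          {x | 0 < z x}.indicator (fun _ => (1 : ℝ)) x - {x | z x < 0}.indicator (fun _ => 1) x := by
        funext x
        rcases lt_trichotomy (z x) 0 with hz | hz | hz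
        · simp [indicator, sign_neg hz, hz, not_lt.2 hz.le]
        · simp [indicator, hz]
        · simp [indicator, sign_pos hz, hz, not_lt.2 hz.le]
      rw [this]
      exact (measurable_const.indicator (isOpen_lt continuous_const hzc).measurableSet).sub
        (measurable_const.indicator (isOpen_lt hzc continuous_const).measurableSet)
    have hs1 : ∀ x, |(SignType.sign (z x) : ℝ)| ≤ 1 := by
      intro x
      rcases lt_trichotomy (z x) 0 with hz | hz | hz
      · simp [sign_neg hz]
      · simp [hz]
      · simp [sign_pos hz]
    refine intervalIntegral.integral_mono_on (by linarith)
      ((hmi.sub hη.abs).intervalIntegrable _ _) ?_ fun x _ => ?_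
    · refine (huc.abs.intervalIntegrable (-R) R).mono_fun
        (hsm.aestronglyMeasurable.mul huc.aestronglyMeasurable) (ae_of_all _ fun x => ?_)
      simp only [norm_mul, Real.norm_eq_abs, abs_abs]
      exact mul_le_of_le_one_left (abs_nonneg _) (hs1 x)
    · have e : (SignType.sign (z x) : ℝ) * u x =
          m x * |P (z x)| - (SignType.sign (z x) : ℝ) * η x := by
        rw [← hsg x, hu]; ring
      rw [e]
      have : (SignType.sign (z x) : ℝ) * η x ≤ |η x| := by
        refine (le_abs_self _).trans ?_
        rw [abs_mul]; exact mul_le_of_le_one_left (abs_nonneg _) (hs1 x)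
      linarith
  have h2 : ∫ x in (-R)..R, (SignType.sign (z x) : ℝ) * u x ≤ 0 := by
    simp_rw [mul_assoc] at hfin
    rw [intervalIntegral.integral_const_mul] at hfin
    by_contra hn
    push Not at hn
    have := mul_pos (show 0 < Real.pi / 2 by positivity) hn
    linarith
  rw [intervalIntegral.integral_sub (hmi.intervalIntegrable _ _)
    (hη.abs.intervalIntegrable _ _)] at h1
  linarith

end IsBVP

/-! ### A regularized inverse of a monotone function -/

/-- Adding ε p makes the function strongly monotone, with an ε⁻¹-Lipschitz inverse. The inverse is
truncated at ±(B + 1), strictly beyond `B`, so that |P t| ≤ B certifies that the truncation is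
inactive. -/
theorem exists_regularized_inverse {j : ℝ → ℝ} (hj : Monotone j) (hjc : Continuous j) {ε : ℝ}
    (hε : 0 < ε) {B : ℝ} (hB : 0 ≤ B) :
    ∃ (P : ℝ → ℝ) (K : NNReal), LipschitzWith K P ∧ Monotone P ∧ P 0 = 0 ∧
      (∀ t, |P t| ≤ B + 1) ∧ ∀ t, |P t| ≤ B → j (P t) - j 0 + ε * P t = t := by
  set g : ℝ → ℝ := fun p => j p - j 0 + ε * p with hg
  have hgc : Continuous g := by fun_prop
  have hstep : ∀ p q, p ≤ q → ε * (q - p) ≤ g q - g p := fun p q hpq => by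
    have := hj hpq
    simp only [hg]; linarith
  have hgm : StrictMono g := fun p q hpq => by
    have := hstep p q hpq.le
    nlinarith [mul_pos hε (sub_pos.2 hpq)]
  have hg0 : g 0 = 0 := by simp [hg]
  have hgs : Function.Surjective g := by
    refine hgc.surjective ?_ ?_
    · refine tendsto_atTop_mono' _ ?_ (tendsto_id.const_mul_atTop hε)
      filter_upwards [eventually_ge_atTop 0] with p hp
      have := hstep 0 p hp
      simp only [id]; linarith
    · refine tendsto_atBot_mono' _ ?_ (tendsto_id.const_mul_atBot hε)
      filter_upwards [eventually_le_atBot 0] with p hp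
      have := hstep p 0 hp
      simp only [id]; linarith
  let e := hgm.orderIsoOfSurjective g hgs
  have he : ∀ t, g (e.symm t) = t := fun t => e.apply_symm_apply t
  have hlip : LipschitzWith (NNReal.mk ε⁻¹ (by positivity)) e.symm := by
    refine LipschitzWith.of_dist_le_mul fun s t => ?_
    have key : ∀ s t, s ≤ t → |e.symm s - e.symm t| ≤ ε⁻¹ * |s - t| := fun s t hst => by
      have h1 : e.symm s ≤ e.symm t := e.symm.monotone hst
      have h2 := hstep _ _ h1
      rw [he, he] at h2
      rw [abs_sub_comm, abs_of_nonneg (sub_nonneg.2 h1), abs_sub_comm,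
        abs_of_nonneg (sub_nonneg.2 hst), inv_mul_eq_div, le_div_iff₀ hε]
      linarith
    rw [Real.dist_eq, Real.dist_eq]
    rcases le_total s t with h | h
    · exact key s t h
    · rw [abs_sub_comm, abs_sub_comm s]; exact key t s h
  refine ⟨fun t => max (-(B + 1)) (min (B + 1) (e.symm t)), _, (hlip.const_min _).const_max _,
    fun s t hst => max_le_max le_rfl (min_le_min le_rfl (e.symm.monotone hst)), ?_, fun t => ?_,
    fun t ht => ?_⟩
  · have : e.symm 0 = 0 := hgm.injective ((he 0).trans hg0.symm)
    simp only [this]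
    rw [min_eq_right (by linarith), max_eq_right (by linarith)]
  · exact abs_le.2 ⟨le_max_left _ _, max_le (by linarith) (min_le_left _ _)⟩
  · have h1 : -B ≤ max (-(B + 1)) (min (B + 1) (e.symm t)) ∧
        max (-(B + 1)) (min (B + 1) (e.symm t)) ≤ B := abs_le.1 ht
    have : max (-(B + 1)) (min (B + 1) (e.symm t)) = e.symm t := by
      rcases le_total (B + 1) (e.symm t) with h | h
      · rw [min_eq_left h, max_eq_right (by linarith)] at h1; linarith
      · rw [min_eq_right h] at h1 ⊢
        rcases le_total (-(B + 1)) (e.symm t) with h' | h'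
        · rw [max_eq_right h']
        · rw [max_eq_left h'] at h1; linarith
    simp only [this]
    exact he t

/-! ### Weak compactness of bounded sequences with bounded integrals -/

theorem memLp_two_of_bounded {u : ℝ → ℝ} {M : ℝ} (hu : Integrable u volume)
    (hM : ∀ x, |u x| ≤ M) : MemLp u 2 volume ∧ ∫ x, u x ^ 2 ≤ M * ∫ x, |u x| := by
  have hle : ∀ x, u x ^ 2 ≤ M * |u x| := fun x => by
    rw [← sq_abs, sq]; exact mul_le_mul_of_nonneg_right (hM x) (abs_nonneg _)
  have hi : Integrable (fun x => M * |u x|) volume := hu.abs.const_mul M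
  have hs : Integrable (fun x => u x ^ 2) volume :=
    hi.mono' (hu.aestronglyMeasurable.pow 2) (ae_of_all _ fun x => by
      rw [Real.norm_of_nonneg (sq_nonneg _)]; exact hle x)
  refine ⟨(memLp_two_iff_integrable_sq hu.aestronglyMeasurable).2 hs, ?_⟩
  rw [← integral_const_mul]
  exact integral_mono hs hi hle

/-- Pairing with the sign of `y` on [-N, N], an L² function, bounds the L¹ norm of `y` there by `C`
uniformly in N. -/
theorem integrable_of_weak_limit {u : ℕ → ℝ → ℝ} {y : ℝ → ℝ} {C : ℝ}
    (hu : ∀ n, Integrable (u n) volume) (hC : ∀ n, ∫ x, |u n x| ≤ C) (hy : MemLp y 2 volume)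
    (hlim : ∀ g : ℝ → ℝ, MemLp g 2 volume →
      Tendsto (fun n => ∫ x, u n x * g x) atTop (𝓝 (∫ x, y x * g x))) :
    Integrable y volume := by
  have hcov : AECover (volume : Measure ℝ) atTop fun N : ℕ => Ioc (-(N : ℝ)) N :=
    aecover_Ioc (tendsto_neg_atTop_atBot.comp tendsto_natCast_atTop_atTop)
      tendsto_natCast_atTop_atTop
  refine hcov.integrable_of_integral_norm_bounded C
    (fun N => (hy.locallyIntegrable (by norm_num)).integrableOn_isCompact isCompact_Icc |>.mono_set
      Ioc_subset_Icc_self) (Eventually.of_forall fun N => ?_)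
  have hym := hy.aestronglyMeasurable.aemeasurable
  set s : ℝ → ℝ := fun x => if 0 ≤ hym.mk y x then 1 else -1 with hs
  have hsm : Measurable s :=
    Measurable.ite (measurableSet_le measurable_const hym.measurable_mk) measurable_const
      measurable_const
  have hs1 : ∀ x, |s x| ≤ 1 := fun x => by simp only [hs]; split_ifs <;> simp
  have hsb : MemLp s ∞ (volume.restrict (Ioc (-(N : ℝ)) N)) :=
    memLp_top_of_bound hsm.aestronglyMeasurable 1 (ae_of_all _ hs1)
  have hg : MemLp ((Ioc (-(N : ℝ)) N).indicator s) 2 volume :=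
    (memLp_indicator_iff_restrict measurableSet_Ioc).2 (hsb.mono_exponent le_top)
  have hg1 : ∀ x, |(Ioc (-(N : ℝ)) N).indicator s x| ≤ 1 := fun x => by
    by_cases hx : x ∈ Ioc (-(N : ℝ)) N
    · rw [indicator_of_mem hx]; exact hs1 x
    · rw [indicator_of_notMem hx]; simp
  have heq : ∫ x in Ioc (-(N : ℝ)) N, ‖y x‖ = ∫ x, y x * (Ioc (-(N : ℝ)) N).indicator s x := by
    rw [← integral_indicator measurableSet_Ioc]
    refine integral_congr_ae ?_
    filter_upwards [hym.ae_eq_mk] with x hx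
    by_cases hxm : x ∈ Ioc (-(N : ℝ)) N
    · rw [indicator_of_mem hxm, indicator_of_mem hxm, Real.norm_eq_abs]
      simp only [hs, ← hx]
      split_ifs with h0
      · rw [abs_of_nonneg h0, mul_one]
      · rw [abs_of_neg (not_le.1 h0)]; ring
    · rw [indicator_of_notMem hxm, indicator_of_notMem hxm, mul_zero]
  rw [heq]
  refine le_of_tendsto' (hlim _ hg) fun n => le_trans ?_ (hC n)
  refine (Real.le_norm_self _).trans ((norm_integral_le_integral_norm _).trans ?_)
  refine integral_mono_of_nonneg (ae_of_all _ fun x => norm_nonneg _) (hu n).abs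
    (ae_of_all _ fun x => ?_)
  simp only [norm_mul, Real.norm_eq_abs]
  exact mul_le_of_le_one_right (abs_nonneg _) (hg1 x)

/-- Uniform sup and L¹ bounds give an L² bound √(M C); the sequential Banach–Alaoglu theorem and the
Riesz representation produce the limit. -/
theorem exists_weak_limit {u : ℕ → ℝ → ℝ} {M C : ℝ} (hu : ∀ n, Integrable (u n) volume)
    (hM : ∀ n x, |u n x| ≤ M) (hC : ∀ n, ∫ x, |u n x| ≤ C) :
    ∃ y : ℝ → ℝ, Integrable y volume ∧ MemLp y 2 volume ∧ ∃ φ : ℕ → ℕ, StrictMono φ ∧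
      ∀ g : ℝ → ℝ, MemLp g 2 volume →
        Tendsto (fun n => ∫ x, u (φ n) x * g x) atTop (𝓝 (∫ x, y x * g x)) := by
  have hM0 : 0 ≤ M := (abs_nonneg _).trans (hM 0 0)
  have hL : ∀ n, MemLp (u n) 2 volume := fun n => (memLp_two_of_bounded (hu n) (hM n)).1
  have : Fact ((2 : ℝ≥0∞) ≠ ∞) := ⟨ENNReal.ofNat_ne_top⟩
  let E := Lp ℝ 2 (volume : Measure ℝ)
  have hinner : ∀ (a b : ℝ → ℝ) (ha : MemLp a 2 volume) (hb : MemLp b 2 volume),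
      inner ℝ (ha.toLp a) (hb.toLp b) = ∫ x, a x * b x := fun a b ha hb => by
    rw [L2.inner_def]
    refine integral_congr_ae ?_
    filter_upwards [ha.coeFn_toLp, hb.coeFn_toLp] with x h1 h2
    rw [h1, h2]; simp [mul_comm]
  have hnorm : ∀ n, ‖(hL n).toLp (u n)‖ ≤ Real.sqrt (M * C) := fun n => by
    refine Real.le_sqrt_of_sq_le ?_
    rw [← real_inner_self_eq_norm_sq, hinner]
    have h1 := (memLp_two_of_bounded (hu n) (hM n)).2
    simp only [← sq]
    exact h1.trans (mul_le_mul_of_nonneg_left (hC n) hM0)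
  let T : ℕ → WeakDual ℝ E := fun n =>
    StrongDual.toWeakDual (InnerProductSpace.toDual ℝ E ((hL n).toLp (u n)))
  obtain ⟨ℓ, -, φ, hφ, hlim⟩ := WeakDual.isSeqCompact_closedBall ℝ E 0 (Real.sqrt (M * C))
    (x := T) (fun n => by
      simp only [mem_preimage, Metric.mem_closedBall, dist_zero_right]
      exact ((InnerProductSpace.toDual ℝ E).norm_map _).trans_le (hnorm n))
  set Y : E := (InnerProductSpace.toDual ℝ E).symm (WeakDual.toStrongDual ℓ) with hY
  have hYm : MemLp Y 2 volume := Lp.memLp Y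
  have key : ∀ g : ℝ → ℝ, MemLp g 2 volume →
      Tendsto (fun n => ∫ x, u (φ n) x * g x) atTop (𝓝 (∫ x, Y x * g x)) := fun g hg => by
    have h1 := ((WeakDual.eval_continuous (hg.toLp g)).tendsto ℓ).comp hlim
    have h2 : ℓ (hg.toLp g) = ∫ x, Y x * g x := by
      rw [← hinner _ _ hYm hg, Lp.toLp_coeFn, hY, InnerProductSpace.toDual_symm_apply]
      rfl
    rw [← h2]
    refine h1.congr fun n => ?_
    rw [← hinner _ _ (hL (φ n)) hg]
    rfl
  exact ⟨Y, integrable_of_weak_limit (fun n => hu (φ n)) (fun n => hC (φ n)) hYm key, hYm, φ, hφ,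
    key⟩

/-! ### Passage to the limit in the approximate problems -/

/-- A solution `y` on `[-R, R]`, extended by zero, of `w y - F' = η`, `z' = F - f y`,
`z = j(s y) - j(0) + ε s y`, with bounds. -/
structure IsApprox (j s w f η : ℝ → ℝ) (B C R ε : ℝ) (y F z : ℝ → ℝ) : Prop where
  integrable : Integrable y volume
  bound : ∀ x, |s x * y x| ≤ B
  integral_le : ∫ x, |y x| ≤ C
  contF : Continuous F
  contz : Continuous z
  F_sub : ∀ a ∈ Icc (-R) R, ∀ b ∈ Icc (-R) R, F b - F a = ∫ x in a..b, (w x * y x - η x)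
  z_sub : ∀ a ∈ Icc (-R) R, ∀ b ∈ Icc (-R) R, z b - z a = ∫ x in a..b, (F x - f x * y x)
  z_eq : ∀ x ∈ Icc (-R) R, z x = j (s x * y x) - j 0 + ε * (s x * y x)

/-- The unknown is p = s y = P(z), which turns the coefficients into m = w / s and k = f / s. The
maximum principle with c = 1 gives |p| ≤ B, so `P` acts as the untruncated inverse along the
solution. -/
theorem exists_isApprox {j s w f η : ℝ → ℝ} {Ck δ B R ε : ℝ} (hj : Monotone j)
    (hjc : Continuous j) (hs : Continuous s) (hs0 : ∀ x, 0 < s x) (hw : Continuous w)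
    (hδ : 0 < δ) (hwδ : ∀ x, δ ≤ w x) (hη : Continuous η)
    (hηi : Integrable η volume) (hk : Differentiable ℝ fun x => f x / s x)
    (hCk : ∀ x, |f x / s x| ≤ Ck) (hmk : ∀ x, 1 ≤ w x / s x - deriv (fun x => f x / s x) x)
    (hB : 0 ≤ B) (hηB : ∀ x, |η x| ≤ B) (hR : 0 < R) (hε : 0 < ε) :
    ∃ y F z, IsApprox j s w f η B ((∫ x, |η x|) / δ) R ε y F z := by
  obtain ⟨P, K, hP, hPm, hP0, hPB, hPj⟩ := exists_regularized_inverse hj hjc hε hB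
  have hs' : ∀ x, s x ≠ 0 := fun x => (hs0 x).ne'
  have hmc : Continuous fun x => w x / s x := hw.div hs hs'
  obtain ⟨F, z, h⟩ := exists_isBVP hP hPB hmc hk.continuous hη hR
  have hbd : ∀ x ∈ Icc (-R) R, |P (z x)| ≤ B := fun x hx =>
    h.abs_le_of_coeff hP hPm hP0 hk hCk one_pos hmk hB (by simpa using hηB) hx
  have hL1 := h.integral_abs_le hR hP hPm hP0 hmc hk.continuous hη
  have hp : Continuous fun x => P (z x) := hP.continuous.comp h.contz
  have hF := h.contF
  have hz := h.contz
  set g : ℝ → ℝ := fun x => P (z x) / s x with hg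
  have hgc : Continuous g := hp.div hs hs'
  have hyg : ∀ x ∈ Icc (-R) R, (Icc (-R) R).indicator g x = g x := fun x hx =>
    indicator_of_mem hx g
  have hsg : ∀ x, s x * g x = P (z x) := fun x => by simp only [hg]; field_simp [hs' x]
  refine ⟨(Icc (-R) R).indicator g, F, z,
    (integrable_indicator_iff measurableSet_Icc).2 hgc.continuousOn.integrableOn_Icc,
    fun x => ?_, ?_, hF, hz, fun a ha b hb => ?_, fun a ha b hb => ?_, fun x hx => ?_⟩
  · by_cases hx : x ∈ Icc (-R) R
    · rw [hyg x hx, hsg]; exact hbd x hx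
    · rw [indicator_of_notMem hx]; simpa using hB
  · rw [le_div_iff₀ hδ]
    have h1 : ∫ x, |(Icc (-R) R).indicator g x| = ∫ x in (-R)..R, |g x| := by
      rw [intervalIntegral.integral_of_le (by linarith), ← integral_Icc_eq_integral_Ioc,
        ← integral_indicator measurableSet_Icc]
      refine integral_congr_ae (ae_of_all _ fun x => ?_)
      by_cases hx : x ∈ Icc (-R) R
      · simp only [indicator_of_mem hx]
      · simp only [indicator_of_notMem hx, abs_zero]
    have h2 : (∫ x in (-R)..R, |g x|) * δ ≤ ∫ x in (-R)..R, w x / s x * |P (z x)| := by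
      rw [← intervalIntegral.integral_mul_const]
      refine intervalIntegral.integral_mono_on (by linarith)
        ((hgc.abs.mul continuous_const).intervalIntegrable _ _)
        ((hmc.mul hp.abs).intervalIntegrable _ _) fun x _ => ?_
      have : w x / s x * |P (z x)| = |g x| * w x := by
        simp only [hg]; rw [abs_div, abs_of_pos (hs0 x)]; ring
      rw [this]
      exact mul_le_mul_of_nonneg_left (hwδ x) (abs_nonneg _)
    have h3 : ∫ x in (-R)..R, |η x| ≤ ∫ x, |η x| := by
      rw [intervalIntegral.integral_of_le (by linarith)]
      exact setIntegral_le_integral hηi.abs (ae_of_all _ fun x => abs_nonneg _)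
    rw [h1]; linarith
  · have hc : Continuous fun x => w x / s x * P (z x) - η x := (hmc.mul hp).sub hη
    rw [integral_eq_sub_of_Ioo hF hc h.derivF ha hb]
    refine intervalIntegral.integral_congr fun x hx => ?_
    rw [hyg x (uIcc_subset_Icc ha hb hx)]
    simp only [hg]; ring
  · have hkc := hk.continuous
    have hc : Continuous fun x => F x - f x / s x * P (z x) := hF.sub (hkc.mul hp)
    rw [integral_eq_sub_of_Ioo hz hc h.derivz ha hb]
    refine intervalIntegral.integral_congr fun x hx => ?_
    rw [hyg x (uIcc_subset_Icc ha hb hx)]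
    simp only [hg]; ring
  · rw [hyg x hx, hsg]
    exact (hPj (z x) (hbd x hx)).symm

theorem memLp_two_indicator {q : ℝ → ℝ} {E : Set ℝ} {N : ℝ} (hE : MeasurableSet E)
    (hEN : E ⊆ Icc (-N) N) (hq : Continuous q) : MemLp (E.indicator q) 2 volume := by
  obtain ⟨C, hC0, hC⟩ := exists_bound_Icc hq N
  rw [memLp_indicator_iff_restrict hE]
  have : IsFiniteMeasure (volume.restrict E) :=
    isFiniteMeasure_restrict.2 ((measure_mono hEN).trans_lt measure_Icc_lt_top).ne
  exact MemLp.of_bound hq.aestronglyMeasurable C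
    ((ae_restrict_iff' hE).2 (ae_of_all _ fun x hx => hC x (hEN hx)))

theorem tendsto_setIntegral_mul {u : ℕ → ℝ → ℝ} {y q : ℝ → ℝ} {E : Set ℝ} {N : ℝ}
    (hlim : ∀ g : ℝ → ℝ, MemLp g 2 volume →
      Tendsto (fun n => ∫ x, u n x * g x) atTop (𝓝 (∫ x, y x * g x)))
    (hE : MeasurableSet E) (hEN : E ⊆ Icc (-N) N) (hq : Continuous q) :
    Tendsto (fun n => ∫ x in E, q x * u n x) atTop (𝓝 (∫ x in E, q x * y x)) := by
  have key : ∀ v : ℝ → ℝ, ∫ x in E, q x * v x = ∫ x, v x * E.indicator q x := fun v => by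
    rw [← integral_indicator hE]
    refine integral_congr_ae (ae_of_all _ fun x => ?_)
    by_cases hx : x ∈ E
    · simp only [indicator_of_mem hx, mul_comm]
    · simp only [indicator_of_notMem hx, mul_zero]
  simp only [key]
  exact hlim _ (memLp_two_indicator hE hEN hq)

theorem tendsto_intervalIntegral_mul {u : ℕ → ℝ → ℝ} {y q : ℝ → ℝ}
    (hlim : ∀ g : ℝ → ℝ, MemLp g 2 volume →
      Tendsto (fun n => ∫ x, u n x * g x) atTop (𝓝 (∫ x, y x * g x)))
    (hq : Continuous q) (a b : ℝ) :
    Tendsto (fun n => ∫ x in a..b, q x * u n x) atTop (𝓝 (∫ x in a..b, q x * y x)) := by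
  simp only [intervalIntegral.intervalIntegral_eq_integral_uIoc]
  refine (tendsto_setIntegral_mul hlim measurableSet_uIoc (N := max |a| |b|) ?_ hq).const_smul _
  intro x hx
  have h1 := uIoc_subset_uIcc hx
  refine uIcc_subset_Icc ?_ ?_ h1
  · exact abs_le.1 (le_max_left _ _)
  · exact abs_le.1 (le_max_right _ _)

/-- Maximality of the graph of a continuous monotone function. -/
theorem eq_of_forall_mul_nonneg {j : ℝ → ℝ} (hj : Continuous j) {a p : ℝ}
    (h : ∀ q : ℝ, 0 ≤ (a - j q) * (p - q)) : a = j p := by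
  refine le_antisymm ?_ ?_
  · refine ge_of_tendsto ((hj.tendsto p).mono_left (nhdsWithin_le_nhds (s := Ioi p))) ?_
    filter_upwards [self_mem_nhdsWithin] with q hq
    have hq' : p < q := hq
    by_contra hlt
    nlinarith [h q, mul_pos (sub_pos.2 (not_le.1 hlt)) (sub_pos.2 hq')]
  · refine le_of_tendsto ((hj.tendsto p).mono_left (nhdsWithin_le_nhds (s := Iio p))) ?_
    filter_upwards [self_mem_nhdsWithin] with q hq
    have hq' : q < p := hq
    by_contra hlt
    nlinarith [h q, mul_pos (sub_pos.2 (not_le.1 hlt)) (sub_pos.2 hq')]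

namespace IsApprox

variable {j s w f η : ℝ → ℝ} {B C R ε : ℝ} {y F z : ℝ → ℝ}

theorem abs_z_le (h : IsApprox j s w f η B C R ε y F z) (hj : Monotone j) (hε : 0 < ε)
    (hε1 : ε ≤ 1) {x : ℝ} (hx : x ∈ Icc (-R) R) : |z x| ≤ |j B| + |j (-B)| + |j 0| + B := by
  have hb := h.bound x
  have hb' := abs_le.1 hb
  have h1 := hj hb'.1
  have h2 := hj hb'.2
  have h3 : |ε * (s x * y x)| ≤ B := by
    rw [abs_mul, abs_of_pos hε]
    nlinarith [abs_nonneg (s x * y x)]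
  have h3' := abs_le.1 h3
  rw [h.z_eq x hx, abs_le]
  constructor <;>
    linarith [neg_abs_le (j (-B)), le_abs_self (j B), neg_abs_le (j 0), le_abs_self (j 0),
      abs_nonneg (j B), abs_nonneg (j (-B))]

theorem abs_F_sub_le (h : IsApprox j s w f η B C R ε y F z) {Cw : ℝ} (hCw : ∀ x, |w x| ≤ Cw)
    (hw : Continuous w) (hηi : Integrable η volume) {a b : ℝ} (ha : a ∈ Icc (-R) R)
    (hb : b ∈ Icc (-R) R) : |F b - F a| ≤ Cw * C + ∫ x, |η x| := by
  have hCw0 : 0 ≤ Cw := (abs_nonneg _).trans (hCw 0)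
  have hwy : Integrable (fun x => w x * y x) volume :=
    h.integrable.bdd_mul hw.aestronglyMeasurable (ae_of_all _ hCw)
  rw [h.F_sub a ha b hb, ← Real.norm_eq_abs]
  refine intervalIntegral.norm_integral_le_integral_norm_uIoc.trans ?_
  refine (setIntegral_le_integral (hwy.sub hηi).norm (ae_of_all _ fun x => norm_nonneg _)).trans ?_
  have h1 : ∫ x, ‖w x * y x - η x‖ ≤ ∫ x, (Cw * |y x| + |η x|) := by
    refine integral_mono (hwy.sub hηi).norm ((h.integrable.abs.const_mul Cw).add hηi.abs)
      fun x => ?_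
    refine (norm_sub_le _ _).trans ?_
    rw [norm_mul, Real.norm_eq_abs, Real.norm_eq_abs, Real.norm_eq_abs]
    gcongr
    exact hCw x
  rw [integral_add (h.integrable.abs.const_mul Cw) hηi.abs, integral_const_mul] at h1
  have h2 := mul_le_mul_of_nonneg_left h.integral_le hCw0
  exact h1.trans (by linarith)

/-- No boundary value of `F` is prescribed. Its mean over [0, 1] is controlled by z(1) - z(0) and ∫
|f y|, and its oscillation by `abs_F_sub_le`. -/
theorem abs_F_le (h : IsApprox j s w f η B C R ε y F z) (hj : Monotone j) (hε : 0 < ε)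
    (hε1 : ε ≤ 1) (hR : 1 ≤ R) {Cw Cf : ℝ} (hCw : ∀ x, |w x| ≤ Cw) (hw : Continuous w)
    (hCf : ∀ x, |f x| ≤ Cf) (hf : Continuous f) (hηi : Integrable η volume) {x : ℝ}
    (hx : x ∈ Icc (-R) R) :
    |F x| ≤ 2 * (|j B| + |j (-B)| + |j 0| + B) + Cf * C + 2 * (Cw * C + ∫ x, |η x|) := by
  have hCf0 : 0 ≤ Cf := (abs_nonneg _).trans (hCf 0)
  have h0 : (0 : ℝ) ∈ Icc (-R) R := ⟨by linarith, by linarith⟩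
  have h1 : (1 : ℝ) ∈ Icc (-R) R := ⟨by linarith, hR⟩
  have hfy : Integrable (fun x => f x * y x) volume :=
    h.integrable.bdd_mul hf.aestronglyMeasurable (ae_of_all _ hCf)
  have hz := h.z_sub 0 h0 1 h1
  rw [intervalIntegral.integral_sub (h.contF.intervalIntegrable _ _) hfy.intervalIntegrable] at hz
  have e1 : |∫ x in (0 : ℝ)..1, f x * y x| ≤ Cf * C := by
    rw [← Real.norm_eq_abs]
    refine intervalIntegral.norm_integral_le_integral_norm_uIoc.trans ?_
    refine (setIntegral_le_integral hfy.norm (ae_of_all _ fun x => norm_nonneg _)).trans ?_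
    have h1 : ∫ x, ‖f x * y x‖ ≤ ∫ x, Cf * |y x| := by
      refine integral_mono hfy.norm (h.integrable.abs.const_mul Cf) fun x => ?_
      simp only [norm_mul, Real.norm_eq_abs]
      exact mul_le_mul_of_nonneg_right (hCf x) (abs_nonneg _)
    rw [integral_const_mul] at h1
    exact h1.trans (mul_le_mul_of_nonneg_left h.integral_le hCf0)
  have e2 : |(∫ x in (0 : ℝ)..1, F x) - F x| ≤ Cw * C + ∫ x, |η x| := by
    have : (∫ t in (0 : ℝ)..1, F t) - F x = ∫ t in (0 : ℝ)..1, (F t - F x) := by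
      rw [intervalIntegral.integral_sub (h.contF.intervalIntegrable _ _)
        intervalIntegrable_const]
      simp
    rw [this, ← Real.norm_eq_abs]
    refine (intervalIntegral.norm_integral_le_of_norm_le_const
      (C := Cw * C + ∫ x, |η x|) fun t ht => ?_).trans (by simp)
    rw [uIoc_of_le zero_le_one] at ht
    exact h.abs_F_sub_le hCw hw hηi hx ⟨by linarith [ht.1], by linarith [ht.2]⟩
  have e3 := h.abs_z_le hj hε hε1 h0
  have e4 := h.abs_z_le hj hε hε1 h1
  have e5 : 0 ≤ Cw * C + ∫ x, |η x| := (abs_nonneg _).trans e2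
  rw [abs_le] at e1 e2 e3 e4 ⊢
  constructor <;> linarith [e1.1, e1.2, e2.1, e2.2, e3.1, e3.2, e4.1, e4.2]

end IsApprox

/-- Minty's argument: `y n` converges only weakly, but z_n converges pointwise and boundedly, so the
products z_n (s y_n - q) pass to the limit on bounded sets. The limit inequality for every q
identifies z₀ + j(0) by maximality of the monotone graph. -/
theorem ae_eq_of_isApprox {j s w f η : ℝ → ℝ} {B C Cz : ℝ} {R ε : ℕ → ℝ}
    {y : ℕ → ℝ → ℝ} {F z : ℕ → ℝ → ℝ} {y₀ z₀ : ℝ → ℝ} (hj : Monotone j) (hjc : Continuous j)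
    (hs : Continuous s) (hR : Tendsto R atTop atTop) (hε0 : ∀ n, 0 < ε n)
    (hε : Tendsto ε atTop (𝓝 0))
    (h : ∀ n, IsApprox j s w f η B C (R n) (ε n) (y n) (F n) (z n))
    (hz : ∀ n, ∀ x ∈ Icc (-R n) (R n), |z n x| ≤ Cz) (hy₀ : Integrable y₀ volume)
    (hlim : ∀ g : ℝ → ℝ, MemLp g 2 volume →
      Tendsto (fun n => ∫ x, y n x * g x) atTop (𝓝 (∫ x, y₀ x * g x)))
    (hz₀c : Continuous z₀) (hzl : ∀ x, Tendsto (fun n => z n x) atTop (𝓝 (z₀ x))) :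
    ∀ᵐ x, z₀ x + j 0 = j (s x * y₀ x) := by
  have hB0 : 0 ≤ B := (abs_nonneg _).trans ((h 0).bound 0)
  have hRN : ∀ N : ℝ, ∀ᶠ n in atTop, Icc (-N) N ⊆ Icc (-R n) (R n) := fun N => by
    filter_upwards [hR.eventually_ge_atTop N] with n hn
    exact Icc_subset_Icc (neg_le_neg hn) hn
  have hz₀ : ∀ x, |z₀ x| ≤ Cz := fun x => by
    refine le_of_tendsto (hzl x).abs ?_
    filter_upwards [hRN |x|] with n hn
    exact hz n x (hn (abs_le.1 le_rfl))
  have hsy : LocallyIntegrable (fun x => s x * y₀ x) volume :=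
    hy₀.locallyIntegrable.continuous_mul hs
  have key : ∀ (N : ℕ) (q : ℝ),
      ∀ᵐ x, x ∈ Icc (-(N : ℝ)) N → 0 ≤ (z₀ x + j 0 - j q) * (s x * y₀ x - q) := by
    intro N q
    set Z : ℝ → ℝ := fun x => z₀ x + j 0 - j q with hZ
    have hZc : Continuous Z := by fun_prop
    have hint : ∀ v : ℝ → ℝ, Integrable v volume → ∀ E ⊆ Icc (-(N : ℝ)) N,
        IntegrableOn (fun x => (Z x * s x) * v x) E volume ∧ IntegrableOn Z E volume :=
      fun v hv E hE => ⟨((hv.locallyIntegrable.continuous_mul (hZc.mul hs)).integrableOn_isCompact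
        isCompact_Icc).mono_set hE, hZc.continuousOn.integrableOn_Icc.mono_set hE⟩
    have hsplit : ∀ v : ℝ → ℝ, Integrable v volume → ∀ E ⊆ Icc (-(N : ℝ)) N,
        IntegrableOn (fun x => Z x * (s x * v x - q)) E volume ∧
        ∫ x in E, Z x * (s x * v x - q) = (∫ x in E, (Z x * s x) * v x) - q * ∫ x in E, Z x := by
      intro v hv E hE
      have e : (fun x => Z x * (s x * v x - q)) = fun x => (Z x * s x) * v x - q * Z x := by
        ext x; ring
      obtain ⟨i1, i2⟩ := hint v hv E hE
      rw [e]
      exact ⟨i1.sub (i2.const_mul q), by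
        rw [integral_sub i1 (i2.const_mul q), integral_const_mul]⟩
    rw [← ae_restrict_iff' measurableSet_Icc]
    refine ae_nonneg_restrict_of_forall_setIntegral_nonneg_inter
      (hsplit y₀ hy₀ _ subset_rfl).1 fun A hA _ => ?_
    set E := A ∩ Icc (-(N : ℝ)) N with hE
    have hEN : E ⊆ Icc (-(N : ℝ)) N := inter_subset_right
    have hEm : MeasurableSet E := hA.inter measurableSet_Icc
    have hfin : IsFiniteMeasure (volume.restrict E) :=
      isFiniteMeasure_restrict.2 ((measure_mono hEN).trans_lt measure_Icc_lt_top).ne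
    have l1 : Tendsto (fun n => ∫ x in E, Z x * (s x * y n x - q)) atTop
        (𝓝 (∫ x in E, Z x * (s x * y₀ x - q))) := by
      simp only [fun n => (hsplit (y n) (h n).integrable E hEN).2, (hsplit y₀ hy₀ E hEN).2]
      exact (tendsto_setIntegral_mul hlim hEm hEN (hZc.mul hs)).sub_const _
    have hdom : ∀ n, IntegrableOn (fun x => (|z n x - z₀ x| + ε n * B) * (B + |q|)) E volume :=
      fun n => by
        have hc := (h n).contz
        exact (Continuous.integrableOn_Icc (a := -(N : ℝ)) (b := N) (by fun_prop)).mono_set hEN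
    have l2 : Tendsto (fun n => -∫ x in E, (|z n x - z₀ x| + ε n * B) * (B + |q|)) atTop
        (𝓝 (-∫ _ in E, (0 : ℝ))) := by
      refine Tendsto.neg (tendsto_integral_filter_of_dominated_convergence
        (fun _ => (Cz + Cz + 1 * B) * (B + |q|))
        (Eventually.of_forall fun n => (hdom n).aestronglyMeasurable) ?_ (integrable_const _)
        (ae_of_all _ fun x => ?_))
      · filter_upwards [hRN N, hε.eventually_le_const one_pos] with n hn hn1
        refine (ae_restrict_iff' hEm).2 (ae_of_all _ fun x hx => ?_)
        have a1 := hz n x (hn (hEN hx))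
        have a2 := abs_sub (z n x) (z₀ x)
        have a3 : 0 ≤ ε n * B := mul_nonneg (hε0 n).le hB0
        rw [Real.norm_of_nonneg (by positivity)]
        gcongr
        linarith [hz₀ x]
      · have t1 : Tendsto (fun n => |z n x - z₀ x|) atTop (𝓝 0) := by
          simpa using ((hzl x).sub_const (z₀ x)).abs
        simpa using (t1.add (hε.mul_const B)).mul_const (B + |q|)
    have hle := le_of_tendsto_of_tendsto l2 l1 (by
      filter_upwards [hRN N] with n hn
      rw [← integral_neg]
      refine setIntegral_mono_on (hdom n).neg (hsplit (y n) (h n).integrable E hEN).1 hEm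
        fun x hx => ?_
      have e1 := (h n).z_eq x (hn (hEN hx))
      have e2 := (h n).bound x
      set p := s x * y n x with hp
      have e3 : 0 ≤ (j p - j q) * (p - q) := by
        rcases le_total p q with hpq | hpq
        · exact mul_nonneg_of_nonpos_of_nonpos (sub_nonpos.2 (hj hpq)) (sub_nonpos.2 hpq)
        · exact mul_nonneg (sub_nonneg.2 (hj hpq)) (sub_nonneg.2 hpq)
      -- Monotonicity makes the first product nonnegative; the second is the error of replacing z_n
      -- by z₀ and dropping ε_n p, and tends to 0 in the integral.
      have e4 : Z x * (p - q) = (j p - j q) * (p - q) - (z n x - z₀ x - ε n * p) * (p - q) := by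
        rw [hZ, e1]; ring
      have e5 : |(z n x - z₀ x - ε n * p) * (p - q)| ≤ (|z n x - z₀ x| + ε n * B) * (B + |q|) := by
        rw [abs_mul]
        have hεn := hε0 n
        refine mul_le_mul ((abs_sub _ _).trans ?_) ((abs_sub _ _).trans ?_) (abs_nonneg _)
          (by positivity)
        · rw [abs_mul, abs_of_pos hεn]; gcongr
        · gcongr
      have e6 := (abs_le.1 e5).2
      rw [e4]; linarith)
    simpa using hle
  -- Rational q keep the exceptional set null; continuity of `j` then gives all real q.
  have key' : ∀ᵐ x, ∀ (N : ℕ) (q : ℚ),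
      x ∈ Icc (-(N : ℝ)) N → 0 ≤ (z₀ x + j 0 - j q) * (s x * y₀ x - q) :=
    ae_all_iff.2 fun N => ae_all_iff.2 fun q => key N q
  filter_upwards [key'] with x hx
  obtain ⟨N, hN⟩ := exists_nat_ge |x|
  refine eq_of_forall_mul_nonneg hjc fun q => ?_
  have hcl : IsClosed {q : ℝ | 0 ≤ (z₀ x + j 0 - j q) * (s x * y₀ x - q)} :=
    isClosed_le continuous_const (by fun_prop)
  have hsub : range ((↑) : ℚ → ℝ) ⊆ {q : ℝ | 0 ≤ (z₀ x + j 0 - j q) * (s x * y₀ x - q)} := by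
    rintro _ ⟨q, rfl⟩
    exact hx N q (abs_le.1 hN)
  exact hcl.closure_subset_iff.2 hsub (Rat.denseRange_cast q)

theorem IsPrimitive.congr_ae {F G G' : ℝ → ℝ} (h : IsPrimitive F G) (hG : G =ᵐ[volume] G') :
    IsPrimitive F G' :=
  ⟨h.locInt.congr hG, fun a b => (h.sub_eq a b).trans
    (intervalIntegral.integral_congr_ae (hG.mono fun _ hx _ => hx))⟩

theorem exists_limit_of_isApprox {j s w f η : ℝ → ℝ} {B C s₀ Cw Cf : ℝ} {R ε : ℕ → ℝ}
    {y F z : ℕ → ℝ → ℝ} (hj : Monotone j) (hjc : Continuous j)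
    (hs : Continuous s) (hs0 : 0 < s₀) (hss : ∀ x, s₀ ≤ s x) (hw : Continuous w)
    (hCw : ∀ x, |w x| ≤ Cw) (hf : Continuous f) (hCf : ∀ x, |f x| ≤ Cf)
    (hηi : Integrable η volume)
    (hR : Tendsto R atTop atTop) (hR1 : ∀ n, 1 ≤ R n) (hε0 : ∀ n, 0 < ε n) (hε1 : ∀ n, ε n ≤ 1)
    (hε : Tendsto ε atTop (𝓝 0))
    (h : ∀ n, IsApprox j s w f η B C (R n) (ε n) (y n) (F n) (z n)) :
    ∃ y₀ F₀ z₀ : ℝ → ℝ, Integrable y₀ volume ∧ IsPrimitive F₀ (fun x => w x * y₀ x - η x) ∧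
      IsPrimitive z₀ (fun x => F₀ x - f x * y₀ x) ∧ (∃ D, ∀ x, |z₀ x| ≤ D) ∧
      ∀ᵐ x, z₀ x = j (s x * y₀ x) := by
  set Cz := |j B| + |j (-B)| + |j 0| + B with hCz
  set CF := 2 * Cz + Cf * C + 2 * (Cw * C + ∫ x, |η x|) with hCF
  have hz : ∀ n, ∀ x ∈ Icc (-R n) (R n), |z n x| ≤ Cz := fun n x hx =>
    (h n).abs_z_le hj (hε0 n) (hε1 n) hx
  have hF : ∀ n, ∀ x ∈ Icc (-R n) (R n), |F n x| ≤ CF := fun n x hx =>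
    (h n).abs_F_le hj (hε0 n) (hε1 n) (hR1 n) hCw hw hCf hf hηi hx
  have hmem0 : ∀ n, (0 : ℝ) ∈ Icc (-R n) (R n) := fun n =>
    ⟨by linarith [hR1 n], by linarith [hR1 n]⟩
  have hyb : ∀ n x, |y n x| ≤ B / s₀ := fun n x => by
    rw [le_div_iff₀ hs0]
    have h1 := (h n).bound x
    rw [abs_mul, abs_of_pos (hs0.trans_le (hss x))] at h1
    nlinarith [abs_nonneg (y n x), hss x]
  -- convergent subsequences
  obtain ⟨⟨a, c⟩, -, φ₁, hφ₁, hac⟩ := tendsto_subseq_of_bounded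
    (s := Icc (-CF) CF ×ˢ Icc (-Cz) Cz)
    ((Metric.isBounded_Icc _ _).prod (Metric.isBounded_Icc _ _))
    (x := fun n => (F n 0, z n 0))
    (fun n => ⟨abs_le.1 (hF n 0 (hmem0 n)), abs_le.1 (hz n 0 (hmem0 n))⟩)
  obtain ⟨y₀, hy₀, -, φ₂, hφ₂, hlim⟩ := exists_weak_limit (u := fun n => y (φ₁ n))
    (fun n => (h (φ₁ n)).integrable) (fun n => hyb (φ₁ n)) (fun n => (h (φ₁ n)).integral_le)
  set ψ : ℕ → ℕ := fun n => φ₁ (φ₂ n) with hψ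
  have hψt : Tendsto ψ atTop atTop := hφ₁.tendsto_atTop.comp hφ₂.tendsto_atTop
  have ha : Tendsto (fun n => F (ψ n) 0) atTop (𝓝 a) :=
    ((continuous_fst.tendsto _).comp hac).comp hφ₂.tendsto_atTop
  have hc : Tendsto (fun n => z (ψ n) 0) atTop (𝓝 c) :=
    ((continuous_snd.tendsto _).comp hac).comp hφ₂.tendsto_atTop
  have hmem : ∀ x : ℝ, ∀ᶠ n in atTop, ∀ t, |t| ≤ |x| → t ∈ Icc (-R (ψ n)) (R (ψ n)) :=
    fun x => by
      filter_upwards [(hR.comp hψt).eventually_ge_atTop |x|] with n hn t ht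
      exact abs_le.1 (ht.trans hn)
  have hwi : ∀ v : ℝ → ℝ, Integrable v volume → Integrable (fun x => w x * v x) volume :=
    fun v hv => hv.bdd_mul hw.aestronglyMeasurable (ae_of_all _ hCw)
  have hfi : ∀ v : ℝ → ℝ, Integrable v volume → Integrable (fun x => f x * v x) volume :=
    fun v hv => hv.bdd_mul hf.aestronglyMeasurable (ae_of_all _ hCf)
  -- the limits of `F` and `z`
  set F₀ : ℝ → ℝ := fun x => (∫ t in (0 : ℝ)..x, (w t * y₀ t - η t)) + a with hF₀
  have pF : IsPrimitive F₀ (fun x => w x * y₀ x - η x) :=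
    (isPrimitive_integral ((hwi y₀ hy₀).sub hηi).locallyIntegrable 0).add_const a
  have hFl : ∀ x, Tendsto (fun n => F (ψ n) x) atTop (𝓝 (F₀ x)) := fun x => by
    have e : ∀ v : ℝ → ℝ, Integrable v volume → ∫ t in (0 : ℝ)..x, (w t * v t - η t) =
        (∫ t in (0 : ℝ)..x, w t * v t) - ∫ t in (0 : ℝ)..x, η t := fun v hv =>
      intervalIntegral.integral_sub (hwi v hv).intervalIntegrable hηi.intervalIntegrable
    have l := ((tendsto_intervalIntegral_mul hlim hw 0 x).sub_const
      (∫ t in (0 : ℝ)..x, η t)).add ha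
    simp only [hF₀, e y₀ hy₀]
    refine l.congr' ?_
    filter_upwards [hmem x] with n hn
    have := (h (ψ n)).F_sub 0 (hmem0 _) x (hn x le_rfl)
    rw [e _ (h (ψ n)).integrable] at this
    linarith
  have hzi : LocallyIntegrable (fun x => F₀ x - f x * y₀ x) volume :=
    pF.continuous.locallyIntegrable.sub (hfi y₀ hy₀).locallyIntegrable
  set z₀ : ℝ → ℝ := fun x => (∫ t in (0 : ℝ)..x, (F₀ t - f t * y₀ t)) + c with hz₀
  have pz : IsPrimitive z₀ (fun x => F₀ x - f x * y₀ x) := (isPrimitive_integral hzi 0).add_const c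
  have hzl : ∀ x, Tendsto (fun n => z (ψ n) x) atTop (𝓝 (z₀ x)) := fun x => by
    have e : ∀ G v : ℝ → ℝ, Continuous G → Integrable v volume →
        ∫ t in (0 : ℝ)..x, (G t - f t * v t) =
        (∫ t in (0 : ℝ)..x, G t) - ∫ t in (0 : ℝ)..x, f t * v t := fun G v hG hv =>
      intervalIntegral.integral_sub (hG.intervalIntegrable _ _) (hfi v hv).intervalIntegrable
    have lF : Tendsto (fun n => ∫ t in (0 : ℝ)..x, F (ψ n) t) atTop
        (𝓝 (∫ t in (0 : ℝ)..x, F₀ t)) := by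
      refine intervalIntegral.tendsto_integral_filter_of_dominated_convergence (fun _ => CF)
        (Eventually.of_forall fun n => (h (ψ n)).contF.aestronglyMeasurable) ?_
        intervalIntegrable_const (ae_of_all _ fun t _ => hFl t)
      filter_upwards [hmem x] with n hn
      refine ae_of_all _ fun t ht => hF (ψ n) t (hn t ?_)
      have := abs_sub_left_of_mem_uIcc (uIoc_subset_uIcc ht)
      simpa using this
    have l := (lF.sub (tendsto_intervalIntegral_mul hlim hf 0 x)).add hc
    simp only [hz₀, e F₀ y₀ pF.continuous hy₀]
    refine l.congr' ?_
    filter_upwards [hmem x] with n hn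
    have := (h (ψ n)).z_sub 0 (hmem0 _) x (hn x le_rfl)
    rw [e _ _ (h (ψ n)).contF (h (ψ n)).integrable] at this
    linarith
  have hzb : ∀ x, |z₀ x| ≤ Cz := fun x => by
    refine le_of_tendsto (hzl x).abs ?_
    filter_upwards [hmem x] with n hn
    exact hz _ x (hn x le_rfl)
  -- The constant j(0), subtracted to be compatible with zero boundary values, is restored; the flux
  -- equation is unaffected.
  refine ⟨y₀, F₀, fun x => z₀ x + j 0, hy₀, pF, pz.add_const _, ⟨Cz + |j 0|, fun x => ?_⟩,
    ae_eq_of_isApprox hj hjc hs (hR.comp hψt) (fun n => hε0 (ψ n)) (hε.comp hψt)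
      (fun n => h (ψ n)) (fun n => hz (ψ n)) hy₀ hlim pz.continuous hzl⟩
  exact (abs_add_le _ _).trans (by linarith [hzb x])

/-- Solvability for continuous right-hand sides of compact support and large `lam`. -/
theorem exists_isSol_of_large {h f σ : ℝ → ℝ} {Λ Cf Cσ Cσ' ρ : ℝ} (hh : CostHyp h)
    (hf : ContDiff ℝ 1 f) (hΛ : ∀ x, |deriv f x| ≤ Λ) (hCf : ∀ x, |f x| ≤ Cf)
    (hσ : ContDiff ℝ 1 σ) (hCσ : ∀ x, |σ x| ≤ Cσ) (hCσ' : ∀ x, |deriv σ x| ≤ Cσ')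
    (hρ : 0 < ρ) (hρσ : ∀ x, ρ ≤ |σ x|) :
    ∃ lam₁, Λ < lam₁ ∧ ∀ lam, lam₁ ≤ lam → ∀ (g : ℝ → ℝ) (hg : Integrable g volume),
      Continuous g → HasCompactSupport g → ∃ y, IsSol h f σ lam hg.toL1 y := by
  have hσ0 : ∀ x, σ x ≠ 0 := fun x h0 => by
    have := hρσ x
    rw [h0, abs_zero] at this; linarith
  have hΛ0 : 0 ≤ Λ := (abs_nonneg _).trans (hΛ 0)
  have hCf0 : 0 ≤ Cf := (abs_nonneg _).trans (hCf 0)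
  have hCσ'0 : 0 ≤ Cσ' := (abs_nonneg _).trans (hCσ' 0)
  have hCσ0 : 0 < Cσ := hρ.trans_le ((hρσ 0).trans (hCσ 0))
  set s : ℝ → ℝ := fun x => σ x ^ 2 / 2 with hs
  have hs0 : ∀ x, 0 < s x := fun x => by
    have := hσ0 x
    simp only [hs]; positivity
  have hsl : ∀ x, ρ ^ 2 / 2 ≤ s x := fun x => by
    have := pow_le_pow_left₀ hρ.le (hρσ x) 2
    rw [sq_abs] at this
    simp only [hs]; linarith
  have hsu : ∀ x, s x ≤ Cσ ^ 2 / 2 := fun x => by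
    have := pow_le_pow_left₀ (abs_nonneg _) (hCσ x) 2
    rw [sq_abs] at this
    simp only [hs]; linarith
  have hσd : ∀ x, HasDerivAt σ (deriv σ x) x := fun x =>
    (hσ.differentiable one_ne_zero x).hasDerivAt
  have hfd : ∀ x, HasDerivAt f (deriv f x) x := fun x =>
    (hf.differentiable one_ne_zero x).hasDerivAt
  have hsd : ∀ x, HasDerivAt s (σ x * deriv σ x) x := fun x => by
    have := ((hσd x).fun_pow 2).div_const 2
    exact this.congr_deriv (by norm_num; ring)
  have hkd : ∀ x, HasDerivAt (fun x => f x / s x)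
      ((deriv f x * s x - f x * (σ x * deriv σ x)) / s x ^ 2) x := fun x =>
    (hfd x).fun_div (hsd x) (hs0 x).ne'
  -- `(w / s) - (f / s)' = lam / s + f s' / s²`
  refine ⟨max (Λ + 1) (Cσ ^ 2 / 2 + Cf * (Cσ * Cσ') / (ρ ^ 2 / 2)), by
    exact (lt_add_one Λ).trans_le (le_max_left _ _), fun lam hlam g hg hgc hgs => ?_⟩
  have hlam1 : Λ + 1 ≤ lam := (le_max_left _ _).trans hlam
  have hlam2 := (le_max_right _ _).trans hlam
  set w : ℝ → ℝ := fun x => lam + deriv f x with hw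
  have hwc : Continuous w := continuous_const.add (hf.continuous_deriv le_rfl)
  -- Largeness of `lam` is needed here: it must dominate sup s + sup |f s' / s|, which is what the
  -- second entry of the maximum bounds.
  have hmk : ∀ x, 1 ≤ w x / s x - deriv (fun x => f x / s x) x := fun x => by
    rw [(hkd x).deriv]
    have e : w x / s x - (deriv f x * s x - f x * (σ x * deriv σ x)) / s x ^ 2 =
        (lam + f x * (σ x * deriv σ x) / s x) / s x := by
      have := (hs0 x).ne'
      simp only [hw]; field_simp; ring
    rw [e, le_div_iff₀ (hs0 x), one_mul]
    have e2 : |f x * (σ x * deriv σ x) / s x| ≤ Cf * (Cσ * Cσ') / (ρ ^ 2 / 2) := by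
      rw [abs_div, abs_mul, abs_mul, abs_of_pos (hs0 x)]
      gcongr
      · exact hCf x
      · exact hCσ x
      · exact hCσ' x
      · exact hsl x
    linarith [(abs_le.1 e2).1, hsu x]
  obtain ⟨B, hB⟩ := hgc.bounded_above_of_compact_support hgs
  have hB0 : 0 ≤ B := (norm_nonneg _).trans (hB 0)
  have hCk : ∀ x, |f x / s x| ≤ Cf / (ρ ^ 2 / 2) := fun x => by
    rw [abs_div, abs_of_pos (hs0 x)]
    gcongr
    · exact hCf x
    · exact hsl x
  have hex := fun n : ℕ => exists_isApprox (j := Hstar h) (s := s) (w := w) (f := f) (η := g)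
    (δ := 1) (R := (n : ℝ) + 1) (ε := 1 / ((n : ℝ) + 1)) (monotone_Hstar hh)
    (continuous_Hstar hh) (by have := hσ.continuous; fun_prop) hs0 hwc one_pos
    (fun x => by simp only [hw]; linarith [(abs_le.1 (hΛ x)).1]) hgc hg
    (fun x => (hkd x).differentiableAt) hCk hmk hB0 hB (by positivity) (by positivity)
  choose y F z hyz using hex
  obtain ⟨y₀, F₀, z₀, hy₀, pF, pz, ⟨D, hD⟩, hz⟩ := exists_limit_of_isApprox
    (Cw := lam + Λ) (monotone_Hstar hh)
    (continuous_Hstar hh) (by have := hσ.continuous; fun_prop) (s₀ := ρ ^ 2 / 2) (by positivity)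
    hsl hwc (fun x => (abs_add_le _ _).trans (by
      rw [abs_of_nonneg (by linarith : 0 ≤ lam)]; linarith [hΛ x])) hf.continuous hCf hg
    (tendsto_atTop_add_const_right _ _ tendsto_natCast_atTop_atTop)
    (fun n => by linarith [(Nat.cast_nonneg n : (0 : ℝ) ≤ n)]) (fun n => by positivity)
    (fun n => by
      rw [div_le_one (by positivity)]; linarith [(Nat.cast_nonneg n : (0 : ℝ) ≤ n)])
    tendsto_one_div_add_atTop_nhds_zero_nat hyz
  have hy : (hy₀.toL1 : ℝ → ℝ) =ᵐ[volume] y₀ := hy₀.coeFn_toL1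
  refine ⟨hy₀.toL1, hg.toL1 - lam • hy₀.toL1,
    mem_opA_of_primitives hf hΛ hCf (F := F₀) (z := z₀) (pF.congr_ae ?_) (pz.congr_ae ?_) ?_ hD,
    by abel⟩
  · filter_upwards [hy, hg.coeFn_toL1, Lp.coeFn_sub (hg.toL1) (lam • hy₀.toL1),
      Lp.coeFn_smul lam (hy₀.toL1)] with x h1 h2 h3 h4
    rw [h3, Pi.sub_apply, h4, Pi.smul_apply, h1, h2]
    simp only [hw, smul_eq_mul]; ring
  · filter_upwards [hy] with x h1
    rw [h1]
  · filter_upwards [hy, hz] with x h1 h2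
    rw [h1, h2]
    simp only [hs]
    congr 1; ring

end DynProg

/-! ### The main theorem. -/

theorem mainTheorem3 (h f σ : ℝ → ℝ)
    (hh : DynProg.CostHyp h)
    (hf : DynProg.IsCb 2 f) (hf2 : Integrable (deriv (deriv f)) volume)
    (hσ : DynProg.IsCb 1 σ) (hρ : ∃ ρ : ℝ, 0 < ρ ∧ ∀ x, ρ ≤ |σ x|)
    (lam₀ : ℝ) (hlam₀ : lam₀ = (eLpNorm (deriv f) ∞ volume).toReal) :
    (∀ lam : ℝ, lam₀ < lam →
      (∀ η : DynProg.L1, ∃! y : DynProg.L1, DynProg.IsSol h f σ lam η y) ∧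
      (∀ η η' y y' : DynProg.L1,
        DynProg.IsSol h f σ lam η y → DynProg.IsSol h f σ lam η' y' →
          ‖y - y'‖ ≤ (lam - lam₀)⁻¹ * ‖η - η'‖)) ∧
    DynProg.IsQuasiMAccretive (DynProg.opA h f σ) := by
  obtain ⟨ρ, hρ0, hρσ⟩ := hρ
  have hf1 : ContDiff ℝ 1 f := hf.contDiff.of_le (by norm_num)
  have hσ1 : ContDiff ℝ 1 σ := hσ.contDiff
  obtain ⟨Cf, hCf⟩ := hf.bounded 0 (by norm_num)
  obtain ⟨Cf', hCf'⟩ := hf.bounded 1 (by norm_num)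
  obtain ⟨Cσ, hCσ⟩ := hσ.bounded 0 (by norm_num)
  obtain ⟨Cσ', hCσ'⟩ := hσ.bounded 1 le_rfl
  simp only [iteratedDeriv_zero, iteratedDeriv_one] at hCf hCf' hCσ hCσ'
  have hfc : Continuous (deriv f) := hf1.continuous_deriv le_rfl
  have hfm : MemLp (deriv f) ∞ volume :=
    memLp_top_of_bound hfc.aestronglyMeasurable Cf' (Filter.Eventually.of_forall hCf')
  -- The essential supremum of the continuous f' bounds it at every point, since a set of full
  -- measure is dense.
  have hΛ : ∀ x, |deriv f x| ≤ lam₀ := by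
    have hae : ∀ᵐ x, |deriv f x| ≤ lam₀ := by
      filter_upwards [ae_le_eLpNormEssSup (f := deriv f) (μ := volume)] with x hx
      rw [hlam₀, ← Real.norm_eq_abs, ← toReal_enorm, eLpNorm_exponent_top]
      refine ENNReal.toReal_mono ?_ hx
      rw [← eLpNorm_exponent_top]
      exact hfm.eLpNorm_ne_top
    have hcl : IsClosed {x | |deriv f x| ≤ lam₀} := isClosed_le hfc.abs continuous_const
    have hd := (Measure.dense_of_ae hae).closure_eq
    rw [hcl.closure_eq] at hd
    exact fun x => by
      have : x ∈ {x | |deriv f x| ≤ lam₀} := hd ▸ mem_univ x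
      exact this
  obtain ⟨lam₁, hlam₁, hex⟩ :=
    DynProg.exists_isSol_of_large hh hf1 hΛ hCf hσ1 hCσ hCσ' hρ0 hρσ
  -- The equation is solved first at max(lam, lam₁), for dense and then for all right-hand sides,
  -- and then brought down to `lam`.
  have hsol : ∀ lam, lam₀ < lam → ∀ η : DynProg.L1, ∃ y, DynProg.IsSol h f σ lam η y :=
    fun lam hlam => DynProg.exists_isSol_of_le hh hf1 hΛ hCf hlam (le_max_left lam lam₁)
      (DynProg.exists_isSol_of_dense hh hf1 hΛ hCf hσ1.continuous hCσ
        (hlam.trans_le (le_max_left _ _)) (hex _ (le_max_right _ _)))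
  refine ⟨fun lam hlam => ⟨fun η => ?_, fun η η' y y' hy hy' =>
    DynProg.norm_sub_le_of_isSol hh hf1 hΛ hCf hlam hy hy'⟩, lam₀,
    DynProg.isAccretive_shift hh hf1 hΛ hCf, fun l hl w => ?_⟩
  · obtain ⟨y, hy⟩ := hsol lam hlam η
    exact ⟨y, hy, fun y' hy' => DynProg.isSol_unique hh hf1 hΛ hCf hlam hy' hy⟩
  · obtain ⟨y, v, hv, hvw⟩ := hsol (lam₀ + l) (by linarith) w
    refine ⟨y, lam₀ • y + v, ⟨v, hv, rfl⟩, ?_⟩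
    rw [← hvw, add_smul]; abel
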